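/- Let $X$ be a smooth manifold of real dimension $2n$ with a complex structure $J$ (a smooth integrable endomorphism of $TX$ with $J^2=-1$). Let $\omega$ be a locally conformal Kähler structure on $X$ with Lee form $\vartheta$: $\omega$ is a smooth real $2$-form with $\omega(Ju,Jv)=\omega(u,v)$ such that $g:=\omega(\cdot,J\cdot)$ is positive definite, $\vartheta$ is a smooth real $1$-form, $d\omega=\vartheta\wedge\omega$ and $d\vartheta=0$. Write $L=\omega\wedge\cdot$ and $L^j=0$ for $j<0$; write $\Lambda=-\iota_{\omega^{-1}}$, that is, in a local frame $(e_a)$ of $TX$, with $(\omega^{ab})$ the inverse of the matrix $(\omega(e_a,e_b))$, $\Lambda\alpha=-\frac12\sum_{a,b}\omega^{ab}\,\alpha(e_a,e_b,\dots)$; and let $P^kX=\ker(\Lambda|_{\wedge^kX})$ be the space of smooth primitive $k$-forms (zero for $k<0$). For a closed $1$-form $\eta$ put $d_\eta=d-\eta\wedge\cdot$ and $d^c_\eta=J^{-1}d_\eta J$, where $(J\alpha)(v_1,\dots,v_k)=\alpha(Jv_1,\dots,Jv_k)$. Let $*$ be the Hodge operator of $g$ and of the orientation given by $J$, and put $$(d^c_\eta)^*:=-*\,d^c_\eta\,*.$$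 Then, for all $j,k,\ell\in\mathbb Z$, $$\left.\left(\Lambda\, d_{\ell\vartheta}-d_{(\ell-1)\vartheta}\,\Lambda\right)\right|_{L^jP^kX}=-\left.\left(d^c_{(n+\ell-k-2j)\vartheta}\right)^*\right|_{L^jP^kX}.$$ -/

import Mathlib

open scoped Manifold ContDiff

noncomputable section

namespace LCK

/-! ### Exterior algebra on one finite-dimensional real vector space -/

section Fibre

variable {V : Type*} [AddCommGroup V] [Module ℝ V] [TopologicalSpace V]
  [IsTopologicalAddGroup V] [ContinuousSMul ℝ V]

/-- An alternating form on a finite-dimensional space, seen as a continuous one. -/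
def toCont [T2Space V] [FiniteDimensional ℝ V] {k : ℕ} (f : V [⋀^Fin k]→ₗ[ℝ] ℝ) :
    V [⋀^Fin k]→L[ℝ] ℝ :=
  { f with
    cont := by
      let b := Module.finBasis ℝ V
      have hf : ∀ v : Fin k → V, f v =
          ∑ r : Fin k → Fin (Module.finrank ℝ V),
            (∏ i, b.repr (v i) (r i)) • f (fun i => b (r i)) := by
        intro v
        conv_lhs => rw [show v = fun i => ∑ j, b.repr (v i) j • b j from
          funext fun i => (b.sum_repr (v i)).symm]
        change f.toMultilinearMap _ = _
        rw [MultilinearMap.map_sum]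
        refine Finset.sum_congr rfl fun r _ => ?_
        rw [MultilinearMap.map_smul_univ]
        rfl
      refine (continuous_congr hf).2 ?_
      refine continuous_finsetSum _ fun r _ => ?_
      simp only [smul_eq_mul]
      refine Continuous.mul ?_ continuous_const
      refine continuous_finsetProd _ fun i _ => ?_
      exact ((b.coord (r i)).continuous_of_finiteDimensional).comp (continuous_apply i) }

/-- The wedge product of a `p`-form and a `q`-form (sum over `(p, q)`-shuffles). -/
def wedge [T2Space V] [FiniteDimensional ℝ V] {p q r : ℕ} (h : p + q = r)
    (α : V [⋀^Fin p]→L[ℝ] ℝ) (β : V [⋀^Fin q]→L[ℝ] ℝ) : V [⋀^Fin r]→L[ℝ] ℝ :=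
  toCont (((LinearMap.mul' ℝ ℝ).compAlternatingMap
    (α.toAlternatingMap.domCoprod β.toAlternatingMap)).domDomCongr
      (finSumFinEquiv.trans (finCongr h)))

theorem append_cast_update {W : Type*} {k p m : ℕ} (h : k + p = m) (u : Fin k → W)
    (w : Fin p → W) [DecidableEq (Fin p)] (i : Fin p) (x : W) :
    Fin.append u (Function.update w i x) ∘ Fin.cast h.symm =
      Function.update (Fin.append u w ∘ Fin.cast h.symm) (Fin.cast h (Fin.natAdd k i)) x := by
  subst h
  funext q
  induction q using Fin.addCases with
  | left q =>
    rw [Function.update_of_ne]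
    · simp
    · intro hq
      have := congrArg Fin.val hq
      simp at this
      omega
  | right q =>
    by_cases hq : q = i
    · subst hq
      simp
    · rw [Function.update_of_ne]
      · simp [Function.update_of_ne hq]
      · intro hq'
        exact hq (by simpa using hq')

/-- Insertion of `u₁, …, u_k` in the first `k` slots:
`contract u α (w₁, …, w_p) = α (u₁, …, u_k, w₁, …, w_p)`. -/
def contract {k p m : ℕ} (h : k + p = m) (u : Fin k → V) (α : V [⋀^Fin m]→L[ℝ] ℝ) :
    V [⋀^Fin p]→L[ℝ] ℝ where
  toFun w := α (Fin.append u w ∘ Fin.cast h.symm)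
  map_update_add' := by
    intro _ w i x y
    change α _ = α _ + α _
    rw [append_cast_update h, append_cast_update h, append_cast_update h]
    exact α.map_update_add _ _ _ _
  map_update_smul' := by
    intro _ w i c x
    change α _ = c • α _
    rw [append_cast_update h, append_cast_update h]
    exact α.map_update_smul _ _ _ _
  map_eq_zero_of_eq' := by
    intro w i j hw hij
    refine α.map_eq_zero_of_eq _ (i := Fin.cast h (Fin.natAdd k i))
      (j := Fin.cast h (Fin.natAdd k j)) (by simpa using hw) (by simpa using hij)
  cont := by
    refine α.cont.comp (continuous_pi fun q => ?_)
    subst h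
    induction q using Fin.addCases with
    | left q => simpa using continuous_const
    | right q => simpa using continuous_apply q

/-- The matrix `Ω_{ab} = Ω(b_a, b_b)` of a `2`-form in a basis of `V`. -/
def gram [FiniteDimensional ℝ V] (Ω : V [⋀^Fin 2]→L[ℝ] ℝ) :
    Matrix (Fin (Module.finrank ℝ V)) (Fin (Module.finrank ℝ V)) ℝ :=
  Matrix.of fun a b => Ω ![Module.finBasis ℝ V a, Module.finBasis ℝ V b]

/-- `ι_{Ω⁻¹} α = (1/2) ∑ Ω^{ab} α(b_a, b_b, …)`, where `(Ω^{ab})` is the inverse matrix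
of `(Ω_{ab})`; this does not depend on the basis. -/
def contractInv [FiniteDimensional ℝ V] (Ω : V [⋀^Fin 2]→L[ℝ] ℝ) {k : ℕ}
    (α : V [⋀^Fin (k + 2)]→L[ℝ] ℝ) : V [⋀^Fin k]→L[ℝ] ℝ :=
  (1 / 2 : ℝ) • ∑ a, ∑ b, (gram Ω)⁻¹ a b •
    contract (Nat.add_comm 2 k) ![Module.finBasis ℝ V a, Module.finBasis ℝ V b] α

/-- A unitary frame `e₀, e₁ = J e₀, e₂, e₃ = J e₂, …`: a basis that is orthonormal
for `g = Ω(·, J·)` and positively oriented for the orientation given by `J`. -/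
def IsUnitaryFrame {n : ℕ} (J : V →L[ℝ] V) (Ω : V [⋀^Fin 2]→L[ℝ] ℝ)
    (e : Module.Basis (Fin (2 * n)) ℝ V) : Prop :=
  (∀ i j, Ω ![e i, J (e j)] = if i = j then 1 else 0) ∧
  ∀ i : Fin n, e ⟨2 * i + 1, by omega⟩ = J (e ⟨2 * i, by omega⟩)

/-- Hodge star from `k`-forms to `p`-forms, `k + p = m`, of the inner product and the orientation
for which `e` is an oriented orthonormal basis, with volume form `e.det`:
`(*β)(w) = (1/k!) ∑_{a₁, …, a_k} β(e_{a₁}, …, e_{a_k}) vol(e_{a₁}, …, e_{a_k}, w)`,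
that is, `α ∧ *β = ⟨α, β⟩ vol`. -/
def starFrame [T2Space V] [FiniteDimensional ℝ V] {k p m : ℕ} (h : k + p = m)
    (e : Module.Basis (Fin m) ℝ V) (β : V [⋀^Fin k]→L[ℝ] ℝ) : V [⋀^Fin p]→L[ℝ] ℝ :=
  (1 / (k.factorial : ℝ)) • ∑ a : Fin k → Fin m,
    β (fun i => e (a i)) • contract h (fun i => e (a i)) (toCont e.det)

open Classical in
/-- Hodge star of the Hermitian metric `g = Ω(·, J·)` and of the orientation given by `J`,
computed in a unitary frame (it does not depend on the frame; a unitary frame exists as soon as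
`J² = -1`, `Ω` is `J`-invariant and `Ω(v, J v) > 0` for `v ≠ 0`). -/
def star [T2Space V] [FiniteDimensional ℝ V] {n k p : ℕ} (h : k + p = 2 * n)
    (J : V →L[ℝ] V) (Ω : V [⋀^Fin 2]→L[ℝ] ℝ) (β : V [⋀^Fin k]→L[ℝ] ℝ) :
    V [⋀^Fin p]→L[ℝ] ℝ :=
  if he : ∃ e : Module.Basis (Fin (2 * n)) ℝ V, IsUnitaryFrame J Ω e
  then starFrame h he.choose β else 0

end Fibre

/-! ### Differential forms on a manifold of real dimension `2n` -/

section Manifold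

variable {n : ℕ} {X : Type*} [TopologicalSpace X]
  [ChartedSpace (EuclideanSpace ℝ (Fin (2 * n))) X]

instance instT2Tangent (x : X) : T2Space (TangentSpace (𝓡 (2 * n)) x) :=
  inferInstanceAs (T2Space (EuclideanSpace ℝ (Fin (2 * n))))

instance instFinTangent (x : X) : FiniteDimensional ℝ (TangentSpace (𝓡 (2 * n)) x) :=
  inferInstanceAs (FiniteDimensional ℝ (EuclideanSpace ℝ (Fin (2 * n))))

variable (n X) in
/-- Real differential forms of degree `k` (smoothness is the predicate `Smooth`). -/
abbrev Form (k : ℕ) : Type _ := ∀ x : X, TangentSpace (𝓡 (2 * n)) x [⋀^Fin k]→L[ℝ] ℝ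

variable (n X) in
/-- Forms of arbitrary, possibly mixed, degree: a family of components, one in each degree. -/
abbrev MixedForm : Type _ := ∀ k : ℕ, Form n X k

/-- The expression of a form in the chart at `x₀`: its pullback under the inverse chart. -/
def localRep {k : ℕ} (α : Form n X k) (x₀ : X) (y : EuclideanSpace ℝ (Fin (2 * n))) :
    EuclideanSpace ℝ (Fin (2 * n)) [⋀^Fin k]→L[ℝ] ℝ :=
  (α ((extChartAt (𝓡 (2 * n)) x₀).symm y)).compContinuousLinearMap
    (mfderiv 𝓘(ℝ, EuclideanSpace ℝ (Fin (2 * n))) (𝓡 (2 * n))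
      (extChartAt (𝓡 (2 * n)) x₀).symm y)

/-- A form is smooth if its expressions in the charts are. -/
def Smooth {k : ℕ} (α : Form n X k) : Prop :=
  ∀ x₀ : X, ContDiffOn ℝ ∞ (localRep α x₀) (extChartAt (𝓡 (2 * n)) x₀).target

/-- The exterior derivative, computed at `x` in the chart at `x`. -/
def extD {k : ℕ} (α : Form n X k) : Form n X (k + 1) := fun x =>
  ContinuousAlternatingMap.compContinuousLinearMap
    (extDeriv (localRep α x) (extChartAt (𝓡 (2 * n)) x x))
    (mfderiv (𝓡 (2 * n)) 𝓘(ℝ, EuclideanSpace ℝ (Fin (2 * n))) (extChartAt (𝓡 (2 * n)) x) x)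

/-- `d` on forms of mixed degree. -/
def d (β : MixedForm n X) : MixedForm n X
  | 0 => 0
  | m + 1 => extD (β m)

/-- `η ∧ β` for a `p`-form `η`. -/
def wedgeLeft {p : ℕ} (η : Form n X p) (β : MixedForm n X) : MixedForm n X := fun m =>
  if h : p ≤ m then fun x => wedge (Nat.add_sub_cancel' h) (η x) (β (m - p) x) else 0

/-- The twisted differential `d_η = d - η ∧ ·`. -/
def dTwisted (η : Form n X 1) (β : MixedForm n X) : MixedForm n X := d β - wedgeLeft η β

/-- `Λ = -ι_{Ω⁻¹}`. -/
def Lam (Ω : Form n X 2) (β : MixedForm n X) : MixedForm n X := fun m x =>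
  -contractInv (Ω x) (β (m + 2) x)

/-- `L^j`, where `L = Ω ∧ ·`; by convention `L^j = 0` for `j < 0`. -/
def LPow (Ω : Form n X 2) (j : ℤ) (β : MixedForm n X) : MixedForm n X :=
  if 0 ≤ j then (wedgeLeft Ω)^[j.toNat] β else 0

/-- The space `P^k X` of primitive forms: smooth forms of pure degree `k` killed by `Λ`. -/
def Primitive (Ω : Form n X 2) (k : ℤ) : Set (MixedForm n X) :=
  {α | (∀ m, Smooth (α m)) ∧ (∀ m : ℕ, (m : ℤ) ≠ k → α m = 0) ∧ Lam Ω α = 0}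

variable (n X) in
/-- A complex structure on `X`: a smooth integrable almost-complex structure. -/
structure ComplexStructure [IsManifold (𝓡 (2 * n)) ∞ X] where
  /-- The endomorphism `J` of the tangent bundle. -/
  J : ∀ x : X, TangentSpace (𝓡 (2 * n)) x →L[ℝ] TangentSpace (𝓡 (2 * n)) x
  sq : ∀ x v, J x (J x v) = -v
  smooth : ∀ x₀ : X, ContDiffOn ℝ ∞
    (fun y : EuclideanSpace ℝ (Fin (2 * n)) =>
      show EuclideanSpace ℝ (Fin (2 * n)) →L[ℝ] EuclideanSpace ℝ (Fin (2 * n)) from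
      (mfderiv (𝓡 (2 * n)) 𝓘(ℝ, EuclideanSpace ℝ (Fin (2 * n))) (extChartAt (𝓡 (2 * n)) x₀)
        ((extChartAt (𝓡 (2 * n)) x₀).symm y)) ∘L
      (J ((extChartAt (𝓡 (2 * n)) x₀).symm y)) ∘L
      (mfderiv 𝓘(ℝ, EuclideanSpace ℝ (Fin (2 * n))) (𝓡 (2 * n))
        (extChartAt (𝓡 (2 * n)) x₀).symm y))
    (extChartAt (𝓡 (2 * n)) x₀).target
  /-- The Nijenhuis tensor vanishes. -/
  integrable : ∀ (x : X) (V W : ∀ x : X, TangentSpace (𝓡 (2 * n)) x),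
    ContMDiffAt (𝓡 (2 * n)) (𝓡 (2 * n)).tangent ∞
      (fun y => (⟨y, V y⟩ : TangentBundle (𝓡 (2 * n)) X)) x →
    ContMDiffAt (𝓡 (2 * n)) (𝓡 (2 * n)).tangent ∞
      (fun y => (⟨y, W y⟩ : TangentBundle (𝓡 (2 * n)) X)) x →
    VectorField.mlieBracket (𝓡 (2 * n)) (fun y => J y (V y)) (fun y => J y (W y)) x
      - J x (VectorField.mlieBracket (𝓡 (2 * n)) (fun y => J y (V y)) W x)
      - J x (VectorField.mlieBracket (𝓡 (2 * n)) V (fun y => J y (W y)) x)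
      - VectorField.mlieBracket (𝓡 (2 * n)) V W x = 0

variable [IsManifold (𝓡 (2 * n)) ∞ X]

/-- `J` on forms: `(Jα)(v₁, …, v_k) = α(J v₁, …, J v_k)`. -/
def actJ (C : ComplexStructure n X) (β : MixedForm n X) : MixedForm n X := fun m x =>
  (β m x).compContinuousLinearMap (C.J x)

/-- `J⁻¹` on forms; the inverse of `J` on tangent vectors is `-J`. -/
def actJInv (C : ComplexStructure n X) (β : MixedForm n X) : MixedForm n X := fun m x =>
  (β m x).compContinuousLinearMap (-C.J x)

/-- `d^c_η = J⁻¹ d_η J`. -/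
def dcTwisted (C : ComplexStructure n X) (η : Form n X 1) (β : MixedForm n X) : MixedForm n X :=
  actJInv C (dTwisted η (actJ C β))

/-- The Hodge star of `g = Ω(·, J·)` on forms of mixed degree. -/
def hodge (C : ComplexStructure n X) (Ω : Form n X 2) (β : MixedForm n X) : MixedForm n X :=
  fun p => if h : p ≤ 2 * n then
    fun x => star (Nat.sub_add_cancel h) (C.J x) (Ω x) (β (2 * n - p) x) else 0

/-- `(d^c_η)^* = - * d^c_η *`, with `*` the Hodge star. -/
def dcStar (C : ComplexStructure n X) (Ω : Form n X 2) (η : Form n X 1) (β : MixedForm n X) :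
    MixedForm n X :=
  -hodge C Ω (dcTwisted C η (hodge C Ω β))

/-- `Ω` is a locally conformal Kähler structure with Lee form `θ`: `Ω` is a smooth positive real
`(1,1)`-form, `θ` is a smooth real `1`-form, `dΩ = θ ∧ Ω` and `dθ = 0`. -/
structure IsLCK (C : ComplexStructure n X) (Ω : Form n X 2) (θ : Form n X 1) : Prop where
  smooth_form : Smooth Ω
  smooth_lee : Smooth θ
  invariant : ∀ x v w, Ω x ![C.J x v, C.J x w] = Ω x ![v, w]
  positive : ∀ x v, v ≠ 0 → 0 < Ω x ![v, C.J x v]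
  d_form : extD Ω = fun x => wedge rfl (θ x) (Ω x)
  d_lee : extD θ = 0

end Manifold

end LCK

end

noncomputable section

namespace LCK

/-! ### The wedge product -/

section WedgeFibre

variable {V W : Type*} [AddCommGroup V] [Module ℝ V] [TopologicalSpace V]
  [IsTopologicalAddGroup V] [ContinuousSMul ℝ V] [T2Space V] [FiniteDimensional ℝ V]
  [AddCommGroup W] [Module ℝ W] [TopologicalSpace W]
  [IsTopologicalAddGroup W] [ContinuousSMul ℝ W] [T2Space W] [FiniteDimensional ℝ W]

/-! The identity is of first order, and it holds at every point for every smooth form of pure degree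
K; the theorem is the case K = k + 2j. Behind it is the Weyl connection: the torsion-free connection
with ∇J = 0 and ∇Ω = θ ⊗ Ω. In the Kähler case this is the Levi-Civita connection, and its
compatibility with J and Ω at a point is an algebraic consequence of the vanishing there of the
Nijenhuis tensor and of dΩ (`exists_compatible_symm`). When dΩ = θ ∧ Ω, the same algebra applies to
the derivative of Ω corrected by -θ ⊗ Ω (`exists_gauge`).

The connection is used through a frame A near y₀ with A(y₀) = 1 and symmetric derivative at y₀. The
frame carries J(y₀) to J and satisfies A^*Ω = μ² Ω(y₀), with μ(y₀) = 1 and dμ = θ/2 at y₀. Symmetry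
makes dα at y₀ the antisymmetrisation of the derivative F of α read in the frame
(`IsGauge.extDeriv_eq`). In the frame, Λ is μ^(-2) times a constant operator, and * on K-forms is
μ^(2n-2K) times a constant operator. A weight N adds (N/2)θ to the twist (`IsGauge.twisted_eq`), so
the weights 0, -2 and 2n - 2K account for the twists ℓ, ℓ - 1 and n + ℓ - K. With these twists, all
three derivatives come from the same tensor F - ℓθ ⊗ α.

What remains is an identity in one Hermitian vector space (`kahlerIdentity`). It is linear in the
tensor, so it is enough to treat η ⊗ α. Let X be the vector with Ω(X, ·) = η. Then [Λ, η ∧ ·] is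
contraction with -X (`contractInv_wedgeOne`). On the other side, * J⁻¹(η ∧ J * α) = *((η ∘ J⁻¹) ∧ *
α) is contraction with the metric dual of η ∘ J⁻¹ (`starFrame_wedgeOne_starFrame`), and this dual is
-X (`IsHermitian.sharp_eq`). -/

@[simp]
theorem toCont_apply {k : ℕ} (f : V [⋀^Fin k]→ₗ[ℝ] ℝ) (v : Fin k → V) : toCont f v = f v := rfl

theorem wedge_apply {p q r : ℕ} (h : p + q = r) (α : V [⋀^Fin p]→L[ℝ] ℝ)
    (β : V [⋀^Fin q]→L[ℝ] ℝ) (v : Fin r → V) :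
    wedge h α β v = LinearMap.mul' ℝ ℝ (α.toAlternatingMap.domCoprod β.toAlternatingMap
      (fun i => v (finCongr h (finSumFinEquiv i)))) := rfl

theorem wedge_comp {p q r : ℕ} (h : p + q = r) (α : V [⋀^Fin p]→L[ℝ] ℝ)
    (β : V [⋀^Fin q]→L[ℝ] ℝ) (A : W →L[ℝ] V) :
    (wedge h α β).compContinuousLinearMap A =
      wedge h (α.compContinuousLinearMap A) (β.compContinuousLinearMap A) := by
  ext v
  simp only [ContinuousAlternatingMap.compContinuousLinearMap_apply, wedge_apply,
    AlternatingMap.domCoprod_apply, sum_apply]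
  congr 1
  refine Finset.sum_congr rfl fun σ _ => ?_
  induction σ using Quotient.inductionOn'
  rfl

theorem wedge_add_left {p q r : ℕ} (h : p + q = r) (α α' : V [⋀^Fin p]→L[ℝ] ℝ)
    (β : V [⋀^Fin q]→L[ℝ] ℝ) : wedge h (α + α') β = wedge h α β + wedge h α' β := by
  ext v
  have : (α + α').toAlternatingMap.domCoprod β.toAlternatingMap =
      α.toAlternatingMap.domCoprod β.toAlternatingMap +
      α'.toAlternatingMap.domCoprod β.toAlternatingMap := by
    simp only [← AlternatingMap.domCoprod'_apply, ← map_add, ← TensorProduct.add_tmul]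
    rfl
  rw [wedge_apply, this, AlternatingMap.add_apply, map_add]
  rfl

theorem wedge_add_right {p q r : ℕ} (h : p + q = r) (α : V [⋀^Fin p]→L[ℝ] ℝ)
    (β β' : V [⋀^Fin q]→L[ℝ] ℝ) : wedge h α (β + β') = wedge h α β + wedge h α β' := by
  ext v
  have : α.toAlternatingMap.domCoprod (β + β').toAlternatingMap =
      α.toAlternatingMap.domCoprod β.toAlternatingMap +
      α.toAlternatingMap.domCoprod β'.toAlternatingMap := by
    simp only [← AlternatingMap.domCoprod'_apply, ← map_add, ← TensorProduct.tmul_add]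
    rfl
  rw [wedge_apply, this, AlternatingMap.add_apply, map_add]
  rfl

theorem wedge_smul_left {p q r : ℕ} (h : p + q = r) (c : ℝ) (α : V [⋀^Fin p]→L[ℝ] ℝ)
    (β : V [⋀^Fin q]→L[ℝ] ℝ) : wedge h (c • α) β = c • wedge h α β := by
  ext v
  have : (c • α).toAlternatingMap.domCoprod β.toAlternatingMap =
      c • α.toAlternatingMap.domCoprod β.toAlternatingMap := by
    simp only [← AlternatingMap.domCoprod'_apply, ← map_smul]
    rfl
  rw [wedge_apply, this, AlternatingMap.smul_apply, map_smul]
  rfl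

theorem wedge_smul_right {p q r : ℕ} (h : p + q = r) (c : ℝ) (α : V [⋀^Fin p]→L[ℝ] ℝ)
    (β : V [⋀^Fin q]→L[ℝ] ℝ) : wedge h α (c • β) = c • wedge h α β := by
  ext v
  have : α.toAlternatingMap.domCoprod (c • β).toAlternatingMap =
      c • α.toAlternatingMap.domCoprod β.toAlternatingMap := by
    simp only [← AlternatingMap.domCoprod'_apply, ← map_smul, ← TensorProduct.tmul_smul]
    rfl
  rw [wedge_apply, this, AlternatingMap.smul_apply, map_smul]
  rfl

/-- The wedge product as a bilinear map. -/
def wedgeBilin {p q r : ℕ} (h : p + q = r) :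
    (V [⋀^Fin p]→L[ℝ] ℝ) →ₗ[ℝ] (V [⋀^Fin q]→L[ℝ] ℝ) →ₗ[ℝ] (V [⋀^Fin r]→L[ℝ] ℝ) :=
  LinearMap.mk₂ ℝ (wedge h) (wedge_add_left h) (wedge_smul_left h) (wedge_add_right h)
    (wedge_smul_right h)

/-- Each shuffle is a coset of S_p × S_q, hence is represented by p! q! permutations with the same
signed contribution. -/
theorem factorial_smul_wedge_apply {p q : ℕ} (α : V [⋀^Fin p]→L[ℝ] ℝ)
    (β : V [⋀^Fin q]→L[ℝ] ℝ) {r : ℕ} (h : p + q = r) (v : Fin r → V) :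
    ((p.factorial * q.factorial : ℕ) : ℝ) * wedge h α β v =
      ∑ σ : Equiv.Perm (Fin r), (Equiv.Perm.sign σ : ℤ) •
        (α (fun i => v (σ (Fin.cast h (Fin.castAdd q i)))) *
          β (fun i => v (σ (Fin.cast h (Fin.natAdd p i))))) := by
  subst h
  have key := MultilinearMap.domCoprod_alternization_eq (R' := ℝ) (Mᵢ := V)
    α.toAlternatingMap β.toAlternatingMap
  have key2 := congrArg (fun f => LinearMap.mul' ℝ ℝ (f fun i => v (finSumFinEquiv i))) key
  simp only [Fintype.card_fin] at key2
  have : ((p.factorial * q.factorial : ℕ) : ℝ) * wedge rfl α β v = LinearMap.mul' ℝ ℝ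
      (((p.factorial * q.factorial) • α.toAlternatingMap.domCoprod β.toAlternatingMap)
        fun i => v (finSumFinEquiv i)) := by
    rw [AlternatingMap.smul_apply, map_nsmul, nsmul_eq_mul]
    rfl
  rw [this, ← key2, MultilinearMap.alternatization_apply, map_sum]
  refine Fintype.sum_equiv (finSumFinEquiv.permCongr) _ _ fun σ => ?_
  simp only [Equiv.Perm.sign_permCongr]
  rw [Units.smul_def, map_zsmul]
  congr 1
  simp [Equiv.permCongr_apply]

end WedgeFibre

/-! ### Wedge product with a 1-form as an antisymmetrisation. -/

section OneForm

variable {E : Type*} [NormedAddCommGroup E] [NormedSpace ℝ E]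

/-- The `1`-form, as an alternating form, of a linear functional. -/
def oneForm (η : E [⋀^Fin 1]→L[ℝ] ℝ) : E →L[ℝ] ℝ :=
  (ContinuousAlternatingMap.ofSubsingleton ℝ E ℝ (0 : Fin 1)).symm η

@[simp]
theorem oneForm_apply (η : E [⋀^Fin 1]→L[ℝ] ℝ) (v : E) : oneForm η v = η ![v] := by
  simp only [oneForm, ContinuousAlternatingMap.ofSubsingleton]
  change η _ = η _
  congr 1
  ext i
  fin_cases i
  rfl

/-- The wedge product of a linear functional and a form. -/
def wedgeOne {k : ℕ} (η : E →L[ℝ] ℝ) (α : E [⋀^Fin k]→L[ℝ] ℝ) : E [⋀^Fin (k + 1)]→L[ℝ] ℝ :=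
  ContinuousAlternatingMap.alternatizeUncurryFin (η.smulRight α)

theorem wedgeOne_apply {k : ℕ} (η : E →L[ℝ] ℝ) (α : E [⋀^Fin k]→L[ℝ] ℝ) (v : Fin (k + 1) → E) :
    wedgeOne η α v = ∑ i : Fin (k + 1), (-1) ^ (i : ℕ) • (η (v i) * α (i.removeNth v)) := by
  simp [wedgeOne, ContinuousAlternatingMap.alternatizeUncurryFin_apply]

/-- Both sides antisymmetrise η(v₀) α(v₁, …, v_k), one over shuffles and the other over the slot
occupied by η. They are compared after averaging over S_{k+1}. The right side is the form in which η
∧ · matches `extDeriv`. -/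
theorem wedge_eq_wedgeOne [FiniteDimensional ℝ E] {k : ℕ} (η : E [⋀^Fin 1]→L[ℝ] ℝ)
    (α : E [⋀^Fin k]→L[ℝ] ℝ) (h : 1 + k = k + 1) :
    wedge h η α = wedgeOne (oneForm η) α := by
  ext v
  set m : (Fin (k + 1) → E) → ℝ := fun v => η ![v 0] * α (fun i => v i.succ) with hm
  have h1 : ((k.factorial : ℕ) : ℝ) * wedge h η α v =
      ∑ σ : Equiv.Perm (Fin (k + 1)), (Equiv.Perm.sign σ : ℤ) • m (v ∘ σ) := by
    have := factorial_smul_wedge_apply η α h v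
    rw [Nat.factorial_one, one_mul] at this
    rw [this]
    refine Finset.sum_congr rfl fun σ _ => ?_
    congr 2
    · congr 1
      ext i
      fin_cases i
      rfl
    · congr 1
      ext i
      simp only [Function.comp]
      congr 2
      ext
      simp
  have h2 : (((k + 1).factorial : ℕ) : ℝ) * wedgeOne (oneForm η) α v =
      ∑ σ : Equiv.Perm (Fin (k + 1)), (Equiv.Perm.sign σ : ℤ) • wedgeOne (oneForm η) α (v ∘ σ) := by
    have : ∀ σ : Equiv.Perm (Fin (k + 1)), (Equiv.Perm.sign σ : ℤ) •
        wedgeOne (oneForm η) α (v ∘ σ) = wedgeOne (oneForm η) α v := by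
      intro σ
      have := (wedgeOne (oneForm η) α).toAlternatingMap.map_perm v σ
      change wedgeOne (oneForm η) α (v ∘ σ) = Equiv.Perm.sign σ • wedgeOne (oneForm η) α v at this
      rw [this, Units.smul_def, smul_smul]
      simp [← Units.val_mul]
    simp [this, Fintype.card_perm]
  -- The inverse of `p.cycleRange` brings slot p to the front and keeps the order of the others; its
  -- sign is (-1)^p.
  have h3 : ∀ w : Fin (k + 1) → E, wedgeOne (oneForm η) α w =
      ∑ p : Fin (k + 1), (-1 : ℤ) ^ (p : ℕ) • m (w ∘ p.cycleRange.symm) := by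
    intro w
    rw [wedgeOne_apply]
    refine Finset.sum_congr rfl fun p _ => ?_
    have e1 : ∀ i : Fin k, p.cycleRange.symm i.succ = p.succAbove i := fun i =>
      Fin.cycleRange_symm_succ p i
    have e0 : p.cycleRange.symm 0 = p := Fin.cycleRange_symm_zero p
    simp only [hm, Function.comp, oneForm_apply, e1, e0]
    simp only [zsmul_eq_mul, Int.cast_pow, Int.cast_neg, Int.cast_one]
    rfl
  have h4 : (((k + 1).factorial : ℕ) : ℝ) * wedgeOne (oneForm η) α v =
      (k + 1 : ℝ) * (((k.factorial : ℕ) : ℝ) * wedge h η α v) := by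
    rw [h2, h1]
    simp_rw [h3, Finset.smul_sum]
    rw [Finset.sum_comm]
    -- Translating σ by the cycle absorbs the sign (-1)^p, so all k + 1 slots give the same sum.
    have : ∀ p : Fin (k + 1), ∑ σ : Equiv.Perm (Fin (k + 1)), (Equiv.Perm.sign σ : ℤ) •
        ((-1 : ℤ) ^ (p : ℕ) • m ((v ∘ σ) ∘ p.cycleRange.symm)) =
        ∑ σ : Equiv.Perm (Fin (k + 1)), (Equiv.Perm.sign σ : ℤ) • m (v ∘ σ) := by
      intro p
      refine Fintype.sum_equiv (Equiv.mulRight p.cycleRange.symm) _ _ fun σ => ?_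
      simp only [Equiv.coe_mulRight, Equiv.Perm.sign_mul, Equiv.Perm.sign_symm,
        Fin.sign_cycleRange, smul_smul]
      simp [Function.comp_assoc]
    simp only [this]
    simp
  have hk : ((k.factorial : ℕ) : ℝ) ≠ 0 := by positivity
  have hk1 : (k + 1 : ℝ) ≠ 0 := by positivity
  rw [Nat.factorial_succ] at h4
  push_cast at h4
  rw [mul_assoc] at h4
  exact (mul_left_cancel₀ hk (mul_left_cancel₀ hk1 h4)).symm

end OneForm

/-! ### The Hodge star in a frame -/

section Star

variable {E : Type*} [NormedAddCommGroup E] [NormedSpace ℝ E]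

/-- Contraction with `v` as a linear map. -/
def curryLeftₗ (k : ℕ) (v : E) : (E [⋀^Fin (k + 1)]→L[ℝ] ℝ) →ₗ[ℝ] (E [⋀^Fin k]→L[ℝ] ℝ) where
  toFun α := α.curryLeft v
  map_add' _ _ := rfl
  map_smul' _ _ := rfl

theorem curryLeftₗ_apply {k : ℕ} (v : E) (α : E [⋀^Fin (k + 1)]→L[ℝ] ℝ) :
    curryLeftₗ k v α = α.curryLeft v := rfl

/-- Polarisation of the vanishing of the double contraction with u + v. -/
theorem curryLeft_curryLeft_swap {k : ℕ} (α : E [⋀^Fin (k + 2)]→L[ℝ] ℝ) (u v : E) :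
    (α.curryLeft u).curryLeft v = -(α.curryLeft v).curryLeft u := by
  have h := α.curryLeft_same (u + v)
  have hu := α.curryLeft_same u
  have hv := α.curryLeft_same v
  simp only [map_add, ContinuousAlternatingMap.curryLeft_add, add_apply, hu, hv,
    zero_add, add_zero] at h
  exact eq_neg_of_add_eq_zero_right h

/-- Contraction is an antiderivation. Degree 0 is separate, here and later, because a 0-form has no
contraction. -/
theorem curryLeft_wedgeOne_zero (η : E →L[ℝ] ℝ) (α : E [⋀^Fin 0]→L[ℝ] ℝ) (v : E) :
    (wedgeOne η α).curryLeft v = η v • α := by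
  ext w
  simp only [ContinuousAlternatingMap.curryLeft_apply_apply, wedgeOne_apply,
    ContinuousAlternatingMap.smul_apply]
  simp [Subsingleton.elim w ![]]

theorem curryLeft_wedgeOne {k : ℕ} (η : E →L[ℝ] ℝ) (α : E [⋀^Fin (k + 1)]→L[ℝ] ℝ) (v : E) :
    (wedgeOne η α).curryLeft v = η v • α - wedgeOne η (α.curryLeft v) := by
  ext w
  rw [ContinuousAlternatingMap.curryLeft_apply_apply, wedgeOne_apply, Fin.sum_univ_succ,
    ContinuousAlternatingMap.sub_apply, ContinuousAlternatingMap.smul_apply]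
  simp only [Fin.val_zero, pow_zero, one_smul, Matrix.cons_val_zero, smul_eq_mul, wedgeOne_apply,
      sub_eq_add_neg, Fin.val_succ, pow_succ, mul_neg, mul_one,
    neg_smul, Finset.sum_neg_distrib]
  congr 3
  funext i
  simp only [Matrix.cons_val_succ, ContinuousAlternatingMap.curryLeft_apply_apply]
  congr 3
  funext j
  refine Fin.cases ?_ (fun j => ?_) j <;> simp [Fin.removeNth]

theorem wedgeOne_add_right {k : ℕ} (η : E →L[ℝ] ℝ) (α β : E [⋀^Fin k]→L[ℝ] ℝ) :
    wedgeOne η (α + β) = wedgeOne η α + wedgeOne η β := by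
  ext v
  simp only [wedgeOne_apply, ContinuousAlternatingMap.add_apply, mul_add, smul_add,
      Finset.sum_add_distrib]

theorem wedgeOne_smul_right {k : ℕ} (η : E →L[ℝ] ℝ) (c : ℝ) (α : E [⋀^Fin k]→L[ℝ] ℝ) :
    wedgeOne η (c • α) = c • wedgeOne η α := by
  ext v
  simp only [wedgeOne_apply, ContinuousAlternatingMap.smul_apply, smul_eq_mul, Finset.mul_sum,
      zsmul_eq_mul]
  refine Finset.sum_congr rfl fun i _ => by ring

/-- `η ∧ ·` as a linear map. -/
def wedgeOneₗ (k : ℕ) (η : E →L[ℝ] ℝ) :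
    (E [⋀^Fin k]→L[ℝ] ℝ) →ₗ[ℝ] (E [⋀^Fin (k + 1)]→L[ℝ] ℝ) where
  toFun := wedgeOne η
  map_add' := wedgeOne_add_right η
  map_smul' := wedgeOne_smul_right η

theorem wedgeOne_sum {k : ℕ} {ι : Type*} (s : Finset ι) (η : E →L[ℝ] ℝ)
    (α : ι → E [⋀^Fin k]→L[ℝ] ℝ) :
    wedgeOne η (∑ i ∈ s, α i) = ∑ i ∈ s, wedgeOne η (α i) :=
  map_sum (wedgeOneₗ k η) α s

theorem contract_zero {p : ℕ} (h : 0 + p = p) (u : Fin 0 → E)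
    (α : E [⋀^Fin p]→L[ℝ] ℝ) : contract h u α = α := by
  ext w
  change α _ = α _
  congr 1
  funext i
  have : (Fin.cast h.symm i) = Fin.natAdd 0 i := by ext; simp
  simp only [Function.comp, this, Fin.append_right]

theorem contract_succ {k p m : ℕ} (h : k + 1 + p = m + 1) (h' : k + p = m) (x : E)
    (u : Fin k → E) (α : E [⋀^Fin (m + 1)]→L[ℝ] ℝ) :
    contract h (Fin.cons x u) α = contract h' u (α.curryLeft x) := by
  ext w
  change α _ = α (Matrix.vecCons x _)
  congr 1
  funext i
  subst h'
  refine Fin.cases ?_ (fun i => ?_) i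
  · have : Fin.cast h.symm 0 = Fin.castAdd p (0 : Fin (k + 1)) := by ext; simp
    simp only [Function.comp, this, Fin.append_left]
    rfl
  · simp only [Function.comp, Matrix.cons_val_succ]
    refine Fin.addCases (fun i => ?_) (fun i => ?_) i
    · have : Fin.cast h.symm (Fin.castAdd p i).succ = Fin.castAdd p i.succ := by ext; simp
      simp [this]
    · have : Fin.cast h.symm (Fin.natAdd k i).succ = Fin.natAdd (k + 1) i := by
        ext; simp; omega
      rw [this, Fin.append_right]
      simp

theorem contract_add {k p m : ℕ} (h : k + p = m) (u : Fin k → E) (α β : E [⋀^Fin m]→L[ℝ] ℝ) :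
    contract h u (α + β) = contract h u α + contract h u β := rfl

theorem contract_smul {k p m : ℕ} (h : k + p = m) (u : Fin k → E) (c : ℝ)
    (α : E [⋀^Fin m]→L[ℝ] ℝ) : contract h u (c • α) = c • contract h u α := rfl

/-- `∑ₐ β(eₐ) ι_{eₐ} τ`, the sum over all multi-indices `a`. -/
def frameSum {ι : Type*} [Fintype ι] {k p m : ℕ} (h : k + p = m) (e : ι → E)
    (β : E [⋀^Fin k]→L[ℝ] ℝ) (τ : E [⋀^Fin m]→L[ℝ] ℝ) : E [⋀^Fin p]→L[ℝ] ℝ :=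
  ∑ a : Fin k → ι, β (fun i => e (a i)) • contract h (fun i => e (a i)) τ

variable {ι : Type*} [Fintype ι] {k p m : ℕ} (e : ι → E)

theorem frameSum_add_left (h : k + p = m) (β β' : E [⋀^Fin k]→L[ℝ] ℝ) (τ : E [⋀^Fin m]→L[ℝ] ℝ) :
    frameSum h e (β + β') τ = frameSum h e β τ + frameSum h e β' τ := by
  simp [frameSum, add_smul, Finset.sum_add_distrib]

theorem frameSum_smul_left (h : k + p = m) (c : ℝ) (β : E [⋀^Fin k]→L[ℝ] ℝ)
    (τ : E [⋀^Fin m]→L[ℝ] ℝ) : frameSum h e (c • β) τ = c • frameSum h e β τ := by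
  simp [frameSum, Finset.smul_sum, smul_smul]

theorem frameSum_add_right (h : k + p = m) (β : E [⋀^Fin k]→L[ℝ] ℝ) (τ τ' : E [⋀^Fin m]→L[ℝ] ℝ) :
    frameSum h e β (τ + τ') = frameSum h e β τ + frameSum h e β τ' := by
  simp [frameSum, contract_add, Finset.sum_add_distrib]

theorem frameSum_smul_right (h : k + p = m) (c : ℝ) (β : E [⋀^Fin k]→L[ℝ] ℝ)
    (τ : E [⋀^Fin m]→L[ℝ] ℝ) : frameSum h e β (c • τ) = c • frameSum h e β τ := by
  simp [frameSum, contract_smul, Finset.smul_sum, smul_smul, mul_comm]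

/-- `frameSum` as a bilinear map. -/
def frameSumₗ (h : k + p = m) : (E [⋀^Fin k]→L[ℝ] ℝ) →ₗ[ℝ] (E [⋀^Fin m]→L[ℝ] ℝ) →ₗ[ℝ]
    (E [⋀^Fin p]→L[ℝ] ℝ) :=
  LinearMap.mk₂ ℝ (frameSum h e) (frameSum_add_left e h) (frameSum_smul_left e h)
    (frameSum_add_right e h) (frameSum_smul_right e h)

theorem frameSumₗ_apply (h : k + p = m) (β : E [⋀^Fin k]→L[ℝ] ℝ) (τ : E [⋀^Fin m]→L[ℝ] ℝ) :
    frameSum h e β τ = frameSumₗ e h β τ := rfl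

theorem frameSum_zero (h : 0 + p = p) (β : E [⋀^Fin 0]→L[ℝ] ℝ)
    (τ : E [⋀^Fin p]→L[ℝ] ℝ) : frameSum h e β τ = β ![] • τ := by
  rw [frameSum, Fintype.sum_unique, contract_zero]
  congr 1
  exact congrArg β (Subsingleton.elim _ _)

/-- Splitting off the first index drives the inductions on degree below. -/
theorem frameSum_succ (h : k + 1 + p = m + 1) (h' : k + p = m) (β : E [⋀^Fin (k + 1)]→L[ℝ] ℝ)
    (τ : E [⋀^Fin (m + 1)]→L[ℝ] ℝ) :
    frameSum h e β τ = ∑ i, frameSum h' e (β.curryLeft (e i)) (τ.curryLeft (e i)) := by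
  simp only [frameSum]
  rw [← Fintype.sum_prod_type']
  refine Fintype.sum_equiv (Fin.consEquiv (fun _ => ι)).symm _ _ fun a => ?_
  have : (fun i => e (a i)) = Fin.cons (e (a 0)) (fun i => e (a i.succ)) := by
    funext i
    refine Fin.cases ?_ (fun i => ?_) i <;> simp
  rw [this, contract_succ h h']
  rfl

/-- The vector `∑ᵢ η(eᵢ) eᵢ`. -/
def sharp (η : E →L[ℝ] ℝ) : E := ∑ i, η (e i) • e i

theorem curryLeft_sharp (η : E →L[ℝ] ℝ) (α : E [⋀^Fin (k + 1)]→L[ℝ] ℝ) :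
    α.curryLeft (sharp e η) = ∑ i, η (e i) • α.curryLeft (e i) := by
  simp [sharp]

/-- The sign is the cost of moving u past the k inserted frame vectors. -/
theorem curryLeft_frameSum (h : k + (p + 1) = m + 1) (h' : k + p = m) (β : E [⋀^Fin k]→L[ℝ] ℝ)
    (τ : E [⋀^Fin (m + 1)]→L[ℝ] ℝ) (u : E) :
    (frameSum h e β τ).curryLeft u = (-1 : ℝ) ^ k • frameSum h' e β (τ.curryLeft u) := by
  induction k generalizing m with
  | zero =>
    have h0 : p = m := by omega
    subst h0
    rw [frameSum_zero, frameSum_zero]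
    simp
  | succ k ih =>
    obtain ⟨m, rfl⟩ : ∃ m', m = m' + 1 := ⟨k + p, by omega⟩
    rw [frameSum_succ e h (by omega), frameSum_succ e h' (by omega)]
    have hs : (∑ i, frameSum (by omega) e (β.curryLeft (e i)) (τ.curryLeft (e i))).curryLeft u =
        ∑ i, (frameSum (m := m + 1) (p := p + 1) (by omega) e (β.curryLeft (e i))
          (τ.curryLeft (e i))).curryLeft u := by
      rw [← curryLeftₗ_apply, map_sum]
      rfl
    rw [hs, Finset.smul_sum]
    refine Finset.sum_congr rfl fun i _ => ?_
    rw [ih (by omega) (by omega), curryLeft_curryLeft_swap, frameSumₗ_apply, frameSumₗ_apply,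
      map_neg, pow_succ]
    simp

/-- Each of the k + 1 slots that η can occupy contributes equally, and summing η(eᵢ) eᵢ over that
slot inserts the dual vector of η into τ. -/
theorem frameSum_wedgeOne (h : k + 1 + p = m + 1) (h' : k + p = m) (η : E →L[ℝ] ℝ)
    (γ : E [⋀^Fin k]→L[ℝ] ℝ) (τ : E [⋀^Fin (m + 1)]→L[ℝ] ℝ) :
    frameSum h e (wedgeOne η γ) τ = (k + 1 : ℝ) • frameSum h' e γ (τ.curryLeft (sharp e η)) := by
  induction k generalizing m with
  | zero =>
    rw [frameSum_succ e h h', curryLeft_sharp, frameSumₗ_apply, map_sum]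
    simp [curryLeft_wedgeOne_zero, frameSumₗ_apply]
  | succ k ih =>
    obtain ⟨m, rfl⟩ : ∃ m', m = m' + 1 := ⟨k + p, by omega⟩
    rw [frameSum_succ e h h']
    have : ∀ i, frameSum h' e ((wedgeOne η γ).curryLeft (e i)) (τ.curryLeft (e i)) =
        η (e i) • frameSum h' e γ (τ.curryLeft (e i)) +
          (k + 1 : ℝ) • frameSum (by omega) e (γ.curryLeft (e i))
            ((τ.curryLeft (sharp e η)).curryLeft (e i)) := by
      intro i
      rw [curryLeft_wedgeOne, frameSumₗ_apply, map_sub, LinearMap.sub_apply, ← frameSumₗ_apply,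
        ← frameSumₗ_apply, ih h' (by omega), frameSum_smul_left, curryLeft_curryLeft_swap,
        sub_eq_add_neg]
      simp only [frameSumₗ_apply, map_neg, smul_neg, neg_neg]
    simp only [this, Finset.sum_add_distrib, ← Finset.smul_sum]
    rw [← frameSum_succ e h' (by omega), curryLeft_sharp]
    simp only [frameSumₗ_apply, map_sum, map_smul]
    push_cast
    rw [add_smul (k + 1 : ℝ) 1, one_smul, add_comm]

theorem wedgeOne_frameSum_zero (h : 0 + p = m) (h1 : 0 + (p + 1) = m + 1)
    (η : E →L[ℝ] ℝ) (γ : E [⋀^Fin 0]→L[ℝ] ℝ) (τ : E [⋀^Fin m]→L[ℝ] ℝ) :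
    wedgeOne η (frameSum h e γ τ) = frameSum h1 e γ (wedgeOne η τ) := by
  have h0 : p = m := by omega
  subst h0
  rw [frameSum_zero, frameSum_zero, wedgeOne_smul_right]

/-- Iteration of η ∧ ι_e τ = η(e) τ - ι_e(η ∧ τ). For τ of top degree the term with η ∧ τ
disappears, which is how `wedgeOne_starFrame` uses it. -/
theorem wedgeOne_frameSum (h : k + 1 + p = m) (h1 : k + 1 + (p + 1) = m + 1)
    (h2 : k + (p + 1) = m) (η : E →L[ℝ] ℝ)
    (γ : E [⋀^Fin (k + 1)]→L[ℝ] ℝ) (τ : E [⋀^Fin m]→L[ℝ] ℝ) :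
    wedgeOne η (frameSum h e γ τ) = (-1 : ℝ) ^ (k + 1) • frameSum h1 e γ (wedgeOne η τ) +
      ((-1 : ℝ) ^ k * (k + 1)) • frameSum h2 e (γ.curryLeft (sharp e η)) τ := by
  induction k generalizing m with
  | zero =>
    obtain ⟨m, rfl⟩ : ∃ m', m = m' + 1 := ⟨p, by omega⟩
    have h3 : 0 + p = m := by omega
    rw [frameSum_succ e h h3, frameSum_succ e h1 h2, wedgeOne_sum, curryLeft_sharp]
    have : ∀ i, wedgeOne η (frameSum h3 e (γ.curryLeft (e i)) (τ.curryLeft (e i))) =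
        η (e i) • frameSum h2 e (γ.curryLeft (e i)) τ -
        frameSum h2 e (γ.curryLeft (e i)) ((wedgeOne η τ).curryLeft (e i)) := by
      intro i
      rw [wedgeOne_frameSum_zero e h3 h2, curryLeft_wedgeOne]
      simp only [frameSumₗ_apply, map_sub, map_smul]
      abel
    simp only [this, Finset.sum_sub_distrib]
    simp only [frameSumₗ_apply, map_sum, map_smul, LinearMap.sum_apply, LinearMap.smul_apply]
    simp
    module
  | succ k ih =>
    obtain ⟨m, rfl⟩ : ∃ m', m = m' + 1 := ⟨k + 1 + p, by omega⟩
    have h3 : k + 1 + p = m := by omega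
    have h4 : k + (p + 1) = m := by omega
    rw [frameSum_succ e h h3, frameSum_succ e h1 h2, wedgeOne_sum]
    have : ∀ i, wedgeOne η (frameSum h3 e (γ.curryLeft (e i)) (τ.curryLeft (e i))) =
        (-1 : ℝ) ^ (k + 1) • η (e i) • frameSum h2 e (γ.curryLeft (e i)) τ -
        (-1 : ℝ) ^ (k + 1) •
          frameSum h2 e (γ.curryLeft (e i)) ((wedgeOne η τ).curryLeft (e i)) -
        ((-1 : ℝ) ^ k * (k + 1)) •
          frameSum h4 e ((γ.curryLeft (sharp e η)).curryLeft (e i)) (τ.curryLeft (e i)) := by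
      intro i
      rw [ih h3 h2 h4, curryLeft_wedgeOne, curryLeft_curryLeft_swap γ (sharp e η)]
      simp only [frameSumₗ_apply, map_sub, map_smul, map_neg, LinearMap.neg_apply, smul_neg,
          smul_sub]
      module
    simp only [this, Finset.sum_sub_distrib, ← Finset.smul_sum]
    rw [← frameSum_succ e h2 h4]
    have h5 : ∑ i, η (e i) • frameSum h2 e (γ.curryLeft (e i)) τ =
        frameSum h2 e (γ.curryLeft (sharp e η)) τ := by
      rw [curryLeft_sharp]
      simp only [frameSumₗ_apply, map_sum, map_smul, LinearMap.sum_apply, LinearMap.smul_apply]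
    rw [h5]
    push_cast
    module

end Star

/-! ### Contraction with the inverse of a `2`-form -/

section Lambda

variable {V W : Type*} [AddCommGroup V] [Module ℝ V] [TopologicalSpace V]
  [AddCommGroup W] [Module ℝ W] [TopologicalSpace W]

/-- `J` is a complex structure, `Ω` is `J`-invariant, and `Ω(·, J·)` is positive definite. -/
structure IsHermitian (J : V →L[ℝ] V) (Ω : V [⋀^Fin 2]→L[ℝ] ℝ) : Prop where
  sq : ∀ v, J (J v) = -v
  invariant : ∀ v w, Ω ![J v, J w] = Ω ![v, w]
  positive : ∀ v, v ≠ 0 → 0 < Ω ![v, J v]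

/-- The bilinear form `(u, v) ↦ α(u, v, w₁, …, w_k)`. -/
def firstTwo {k : ℕ} (α : V [⋀^Fin (k + 2)]→L[ℝ] ℝ) (w : Fin k → V) : LinearMap.BilinForm ℝ V :=
  LinearMap.mk₂ ℝ (fun u v => α.toAlternatingMap.curryLeft u (Matrix.vecCons v w))
    (fun u u' v => by simp) (fun c u v => by simp)
    (fun u v v' => (α.toAlternatingMap.curryLeft u).toMultilinearMap.cons_add w v v')
    (fun c u v => (α.toAlternatingMap.curryLeft u).toMultilinearMap.cons_smul w c v)

@[simp]
theorem firstTwo_apply {k : ℕ} (α : V [⋀^Fin (k + 2)]→L[ℝ] ℝ) (w : Fin k → V) (u v : V) :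
    firstTwo α w u v = α (Matrix.vecCons u (Matrix.vecCons v w)) := rfl

theorem firstTwo_two_apply (Ω : V [⋀^Fin 2]→L[ℝ] ℝ) (u v : V) :
    firstTwo (k := 0) Ω ![] u v = Ω ![u, v] := rfl

theorem two_form_swap (Ω : V [⋀^Fin 2]→L[ℝ] ℝ) (u v : V) : Ω ![u, v] = -Ω ![v, u] := by
  have := Ω.toAlternatingMap.map_swap ![v, u] (i := 0) (j := 1) (by decide)
  change _ = -Ω.toAlternatingMap ![v, u]
  rw [← this]
  change Ω _ = Ω _
  congr 1
  funext i
  fin_cases i <;> rfl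

/-- The sum is the trace of G⁻¹ Bᵀ, and both G and B transform by P^T · P. With G = Ω this makes Λ
independent of the basis; with G the metric it makes sums over orthonormal frames independent of the
frame. -/
theorem toMatrix_inv_sum_eq {V : Type*} [AddCommGroup V] [Module ℝ V] {ι κ : Type*} [Fintype ι]
    [DecidableEq ι] [Fintype κ] [DecidableEq κ]
    (b : Module.Basis ι ℝ V) (c : Module.Basis κ ℝ V) (G B : LinearMap.BilinForm ℝ V)
    (hG : IsUnit (LinearMap.BilinForm.toMatrix b G).det) :
    ∑ i, ∑ j, (LinearMap.BilinForm.toMatrix c G)⁻¹ i j * B (c i) (c j) =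
      ∑ i, ∑ j, (LinearMap.BilinForm.toMatrix b G)⁻¹ i j * B (b i) (b j) := by
  have key : ∀ {μ : Type _} [Fintype μ] [DecidableEq μ] (e : Module.Basis μ ℝ V),
      ∑ i, ∑ j, (LinearMap.BilinForm.toMatrix e G)⁻¹ i j * B (e i) (e j) =
      ((LinearMap.BilinForm.toMatrix e G)⁻¹ *
        (LinearMap.BilinForm.toMatrix e B).transpose).trace := by
    intro μ _ _ e
    simp [Matrix.trace, Matrix.mul_apply]
  have key' : ∑ i, ∑ j, (LinearMap.BilinForm.toMatrix b G)⁻¹ i j * B (b i) (b j) =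
      ((LinearMap.BilinForm.toMatrix b G)⁻¹ *
        (LinearMap.BilinForm.toMatrix b B).transpose).trace := by
    simp [Matrix.trace, Matrix.mul_apply]
  rw [key, key']
  set P := b.toMatrix c
  set Q := c.toMatrix b
  have hPQ : P * Q = 1 := b.toMatrix_mul_toMatrix_flip c
  have hQP : Q * P = 1 := c.toMatrix_mul_toMatrix_flip b
  have hGc := LinearMap.BilinForm.toMatrix_mul_basis_toMatrix b c G
  have hBc := LinearMap.BilinForm.toMatrix_mul_basis_toMatrix b c B
  set M := LinearMap.BilinForm.toMatrix b G
  rw [← hGc, ← hBc]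
  have hinv : (P.transpose * M * P)⁻¹ = Q * M⁻¹ * Q.transpose := by
    apply Matrix.inv_eq_right_inv
    calc P.transpose * M * P * (Q * M⁻¹ * Q.transpose)
        = P.transpose * (M * (P * Q) * M⁻¹) * Q.transpose := by simp only [Matrix.mul_assoc]
      _ = 1 := by
        rw [hPQ, Matrix.mul_one, Matrix.mul_nonsing_inv _ hG, Matrix.mul_one,
          ← Matrix.transpose_mul, hQP, Matrix.transpose_one]
  rw [hinv]
  simp only [Matrix.transpose_mul, Matrix.transpose_transpose]
  calc (Q * M⁻¹ * Q.transpose * (P.transpose *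
        ((LinearMap.BilinForm.toMatrix b B).transpose * P))).trace
      = (Q * (M⁻¹ * (P * Q).transpose *
          (LinearMap.BilinForm.toMatrix b B).transpose * P)).trace := by
        simp only [Matrix.mul_assoc, Matrix.transpose_mul]
    _ = _ := by
        rw [Matrix.trace_mul_comm, hPQ, Matrix.transpose_one, Matrix.mul_one,
          Matrix.mul_assoc _ P Q, hPQ, Matrix.mul_one]

variable {J : V →L[ℝ] V} {Ω : V [⋀^Fin 2]→L[ℝ] ℝ}

theorem IsHermitian.eq_zero (h : IsHermitian J Ω) {v : V} (hv : ∀ u, Ω ![v, u] = 0) : v = 0 := by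
  by_contra hne
  exact (h.positive v hne).ne' (hv _)

theorem IsHermitian.isUnit_toMatrix (h : IsHermitian J Ω) {ι : Type*} [Fintype ι] [DecidableEq ι]
    (b : Module.Basis ι ℝ V) :
    IsUnit (LinearMap.BilinForm.toMatrix b (firstTwo (k := 0) Ω ![])).det := by
  rw [isUnit_iff_ne_zero]
  intro h0
  obtain ⟨x, hx, hx0⟩ := Matrix.exists_mulVec_eq_zero_iff.2 h0
  apply hx
  have hv : ∑ j, x j • b j = 0 := by
    refine h.eq_zero fun u => ?_
    rw [two_form_swap, neg_eq_zero, ← firstTwo_two_apply]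
    have : (firstTwo (k := 0) Ω ![]).flip (∑ j, x j • b j) = 0 := by
      refine b.ext fun i => ?_
      have := congrFun hx0 i
      simp only [Matrix.mulVec, dotProduct, LinearMap.BilinForm.toMatrix_apply,
        Pi.zero_apply] at this
      change firstTwo (k := 0) Ω ![] (b i) (∑ j, x j • b j) = 0
      rw [map_sum, ← this]
      refine Finset.sum_congr rfl fun j _ => ?_
      rw [map_smul, smul_eq_mul, mul_comm]
    exact LinearMap.congr_fun this u
  funext j
  exact linearIndependent_iff'.1 b.linearIndependent Finset.univ x hv j (Finset.mem_univ j)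

theorem contract_pair_apply {k : ℕ} (h : 2 + k = k + 2) (a b : V) (α : V [⋀^Fin (k + 2)]→L[ℝ] ℝ)
    (w : Fin k → V) :
    contract h ![a, b] α w = α (Matrix.vecCons a (Matrix.vecCons b w)) := by
  change α _ = α _
  congr 1
  funext i
  refine Fin.cases ?_ (fun i => ?_) i
  · have : Fin.cast h.symm 0 = Fin.castAdd k (0 : Fin 2) := by ext; simp
    simp only [Function.comp, this, Fin.append_left]
    rfl
  · refine Fin.cases ?_ (fun i => ?_) i
    · have : Fin.cast h.symm (Fin.succ 0) = Fin.castAdd k (1 : Fin 2) := by ext; simp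
      simp only [Function.comp, this, Fin.append_left]
      rfl
    · have : Fin.cast h.symm i.succ.succ = Fin.natAdd 2 i := by ext; simp; omega
      simp only [Function.comp, this, Fin.append_right]
      rfl

theorem contractInv_apply_basis [IsTopologicalAddGroup V] [ContinuousSMul ℝ V]
    [FiniteDimensional ℝ V] (h : IsHermitian J Ω) {ι : Type*} [Fintype ι] [DecidableEq ι]
    (b : Module.Basis ι ℝ V) {k : ℕ} (α : V [⋀^Fin (k + 2)]→L[ℝ] ℝ) (w : Fin k → V) :
    contractInv Ω α w = (1 / 2 : ℝ) * ∑ i, ∑ j,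
      (LinearMap.BilinForm.toMatrix b (firstTwo (k := 0) Ω ![]))⁻¹ i j *
        α (Matrix.vecCons (b i) (Matrix.vecCons (b j) w)) := by
  have := toMatrix_inv_sum_eq b (Module.finBasis ℝ V) (firstTwo (k := 0) Ω ![]) (firstTwo α w)
    (h.isUnit_toMatrix b)
  simp only [firstTwo_apply] at this
  rw [← this, contractInv]
  simp only [ContinuousAlternatingMap.smul_apply, ContinuousAlternatingMap.sum_apply,
    contract_pair_apply, smul_eq_mul]
  have hg : gram Ω = LinearMap.BilinForm.toMatrix (Module.finBasis ℝ V)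
      (firstTwo (k := 0) Ω ![]) := by
    ext i j
    rw [LinearMap.BilinForm.toMatrix_apply]
    rfl
  rw [hg]

theorem contractInv_add [IsTopologicalAddGroup V] [ContinuousSMul ℝ V]
    [FiniteDimensional ℝ V] {k : ℕ} (α β : V [⋀^Fin (k + 2)]→L[ℝ] ℝ) :
    contractInv Ω (α + β) = contractInv Ω α + contractInv Ω β := by
  ext w
  simp [contractInv, contract_pair_apply, Finset.sum_add_distrib, mul_add]

theorem contractInv_smul [IsTopologicalAddGroup V] [ContinuousSMul ℝ V]
    [FiniteDimensional ℝ V] {k : ℕ} (c : ℝ) (α : V [⋀^Fin (k + 2)]→L[ℝ] ℝ) :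
    contractInv Ω (c • α) = c • contractInv Ω α := by
  ext w
  simp only [contractInv, contract_pair_apply, Finset.mul_sum, smul_eq_mul,
    ContinuousAlternatingMap.smul_apply, ContinuousAlternatingMap.sum_apply]
  refine Finset.sum_congr rfl fun i _ => Finset.sum_congr rfl fun j _ => by ring

/-- `contractInv Ω` as a linear map. -/
def contractInvₗ [IsTopologicalAddGroup V] [ContinuousSMul ℝ V]
    [FiniteDimensional ℝ V] (Ω : V [⋀^Fin 2]→L[ℝ] ℝ) (k : ℕ) :
    (V [⋀^Fin (k + 2)]→L[ℝ] ℝ) →ₗ[ℝ] (V [⋀^Fin k]→L[ℝ] ℝ) where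
  toFun := contractInv Ω
  map_add' := contractInv_add
  map_smul' := contractInv_smul

/-- `contractInv` is natural, up to scale, under conformal isomorphisms. -/
theorem contractInv_comp [IsTopologicalAddGroup V] [ContinuousSMul ℝ V]
    [FiniteDimensional ℝ V] [IsTopologicalAddGroup W] [ContinuousSMul ℝ W]
    [FiniteDimensional ℝ W] (h : IsHermitian J Ω) {J' : W →L[ℝ] W} {Ω' : W [⋀^Fin 2]→L[ℝ] ℝ}
    (h' : IsHermitian J' Ω') (A : V ≃L[ℝ] W) (c : ℝ)
    (hA : ∀ u v, Ω' ![A u, A v] = c * Ω ![u, v]) {k : ℕ} (α : W [⋀^Fin (k + 2)]→L[ℝ] ℝ) :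
    c • (contractInv Ω' α).compContinuousLinearMap (A : V →L[ℝ] W) =
      contractInv Ω (α.compContinuousLinearMap (A : V →L[ℝ] W)) := by
  classical
  ext w
  let b := Module.finBasis ℝ V
  rw [contractInv_apply_basis h b, ContinuousAlternatingMap.smul_apply,
    ContinuousAlternatingMap.compContinuousLinearMap_apply,
    contractInv_apply_basis h' (b.map A.toLinearEquiv)]
  set M := LinearMap.BilinForm.toMatrix b (firstTwo (k := 0) Ω ![]) with hM
  have hM' : LinearMap.BilinForm.toMatrix (b.map A.toLinearEquiv) (firstTwo (k := 0) Ω' ![]) =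
      c • M := by
    ext i j
    simp only [LinearMap.BilinForm.toMatrix_apply, Matrix.smul_apply, hM, firstTwo_two_apply,
      smul_eq_mul, Module.Basis.map_apply]
    exact hA _ _
  rw [hM']
  have e : ∀ i j, α (Matrix.vecCons (b.map A.toLinearEquiv i)
      (Matrix.vecCons (b.map A.toLinearEquiv j) (A ∘ w))) =
      (α.compContinuousLinearMap (A : V →L[ℝ] W))
        (Matrix.vecCons (b i) (Matrix.vecCons (b j) w)) := by
    intro i j
    rw [ContinuousAlternatingMap.compContinuousLinearMap_apply]
    congr 1
    funext s
    refine Fin.cases rfl (fun s => Fin.cases rfl (fun s => rfl) s) s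
  have e' : ((A : V →L[ℝ] W) ∘ w) = A ∘ w := rfl
  rw [e']
  simp only [e]
  have hu : IsUnit M.det := h.isUnit_toMatrix b
  -- In dimension 0 all the sums are empty and c may vanish. Otherwise c ≠ 0, because c • M is the
  -- matrix of the nondegenerate form Ω'.
  rcases isEmpty_or_nonempty (Fin (Module.finrank ℝ V)) with hemp | hne
  · simp
  · have hc : c ≠ 0 := by
      rintro rfl
      have := h'.isUnit_toMatrix (b.map A.toLinearEquiv)
      rw [hM', zero_smul, Matrix.det_zero] at this
      exact not_isUnit_zero this
    have : (c • M)⁻¹ = c⁻¹ • M⁻¹ := by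
      apply Matrix.inv_eq_right_inv
      rw [Matrix.smul_mul, Matrix.mul_smul, smul_smul, mul_inv_cancel₀ hc, one_smul,
        Matrix.mul_nonsing_inv _ hu]
    rw [this]
    simp only [Matrix.smul_apply, smul_eq_mul, mul_assoc, ← Finset.mul_sum]
    field_simp

end Lambda

/-! ### The commutator of Λ with the wedge product by a 1-form. -/

section Commutator

variable {E : Type*} [NormedAddCommGroup E] [NormedSpace ℝ E] [FiniteDimensional ℝ E]
  {J : E →L[ℝ] E} {Ω : E [⋀^Fin 2]→L[ℝ] ℝ}

theorem toMatrix_inv_swap {E : Type*} [AddCommGroup E] [Module ℝ E] [TopologicalSpace E]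
    (Ω : E [⋀^Fin 2]→L[ℝ] ℝ) {ι : Type*} [Fintype ι] [DecidableEq ι]
    (b : Module.Basis ι ℝ E) (i j : ι) :
    (LinearMap.BilinForm.toMatrix b (firstTwo (k := 0) Ω ![]))⁻¹ i j =
      -(LinearMap.BilinForm.toMatrix b (firstTwo (k := 0) Ω ![]))⁻¹ j i := by
  set M := LinearMap.BilinForm.toMatrix b (firstTwo (k := 0) Ω ![]) with hM
  have h1 : M.transpose = -M := by
    ext i j
    simp only [hM, Matrix.transpose_apply, Matrix.neg_apply, LinearMap.BilinForm.toMatrix_apply,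
      firstTwo_two_apply]
    exact two_form_swap Ω _ _
  have h2 : M⁻¹.transpose = -M⁻¹ := by
    rw [Matrix.transpose_nonsing_inv, h1, ← neg_one_smul ℝ M, ← neg_one_smul ℝ M⁻¹]
    by_cases hu : IsUnit M.det
    · apply Matrix.inv_eq_right_inv
      rw [Matrix.smul_mul, Matrix.mul_smul, smul_smul, Matrix.mul_nonsing_inv _ hu]
      simp
    · rw [Matrix.nonsing_inv_apply_not_isUnit _ hu, Matrix.nonsing_inv_apply_not_isUnit]
      · simp
      · rwa [Matrix.det_smul, IsUnit.mul_iff, not_and_or, or_iff_right]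
        simp [isUnit_iff_ne_zero]
  have := congrFun (congrFun h2 j) i
  simpa using this

/-- The entries of the inverse of the matrix of `Ω`. -/
def invGram (Ω : E [⋀^Fin 2]→L[ℝ] ℝ) (i j : Fin (Module.finrank ℝ E)) : ℝ :=
  (LinearMap.BilinForm.toMatrix (Module.finBasis ℝ E) (firstTwo (k := 0) Ω ![]))⁻¹ i j

theorem invGram_swap (Ω : E [⋀^Fin 2]→L[ℝ] ℝ) (i j : Fin (Module.finrank ℝ E)) :
    invGram Ω i j = -invGram Ω j i :=
  toMatrix_inv_swap Ω _ i j

/-- The vector `X` with `Ω(X, ·) = η`. -/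
def dualVector (Ω : E [⋀^Fin 2]→L[ℝ] ℝ) (η : E →L[ℝ] ℝ) : E :=
  ∑ i, ∑ j, invGram Ω i j •
    η (Module.finBasis ℝ E i) • Module.finBasis ℝ E j

theorem apply_dualVector (h : IsHermitian J Ω) (η : E →L[ℝ] ℝ) (w : E) :
    Ω ![dualVector Ω η, w] = η w := by
  set b := Module.finBasis ℝ E with hb
  have : (firstTwo (k := 0) Ω ![]) (dualVector Ω η) = η := by
    refine b.ext fun l => ?_
    simp only [dualVector, map_sum, map_smul, LinearMap.sum_apply, LinearMap.smul_apply,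
      smul_eq_mul, ← hb]
    set M := LinearMap.BilinForm.toMatrix b (firstTwo (k := 0) Ω ![]) with hM
    have e0 : ∀ i j, invGram Ω i j = M⁻¹ i j := fun i j => rfl
    simp only [e0]
    have e : ∀ i j, M⁻¹ i j * (η (b i) * firstTwo (k := 0) Ω ![] (b j) (b l)) =
        η (b i) * (M⁻¹ i j * M j l) := by
      intro i j
      rw [hM, LinearMap.BilinForm.toMatrix_apply]
      ring
    simp only [e, ← Finset.mul_sum, ← Matrix.mul_apply]
    rw [Matrix.nonsing_inv_mul _ (h.isUnit_toMatrix b)]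
    simp [Matrix.one_apply]
  exact LinearMap.congr_fun this w

theorem contractInv_eq_sum_curryLeft (h : IsHermitian J Ω) {k : ℕ}
    (α : E [⋀^Fin (k + 2)]→L[ℝ] ℝ) :
    contractInv Ω α = (1 / 2 : ℝ) • ∑ i, ∑ j,
      invGram Ω i j •
        (α.curryLeft (Module.finBasis ℝ E i)).curryLeft (Module.finBasis ℝ E j) := by
  ext w
  rw [contractInv_apply_basis h (Module.finBasis ℝ E)]
  simp [invGram]

/-- The sum is antisymmetrised in (i, j), using the skew symmetry of the inverse matrix, so that it
matches the double contraction of η ∧ α term by term. -/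
theorem curryLeft_dualVector {k : ℕ} (Ω : E [⋀^Fin 2]→L[ℝ] ℝ) (η : E →L[ℝ] ℝ)
    (α : E [⋀^Fin (k + 1)]→L[ℝ] ℝ) :
    α.curryLeft (dualVector Ω η) = (1 / 2 : ℝ) • ∑ i, ∑ j,
      invGram Ω i j •
        (η (Module.finBasis ℝ E i) • α.curryLeft (Module.finBasis ℝ E j) -
          η (Module.finBasis ℝ E j) • α.curryLeft (Module.finBasis ℝ E i)) := by
  simp only [smul_sub, Finset.sum_sub_distrib]
  set b := Module.finBasis ℝ E with hb
  have e : ∑ i, ∑ j, invGram Ω i j • η (b j) • α.curryLeft (b i) =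
      -∑ i, ∑ j, invGram Ω i j • η (b i) • α.curryLeft (b j) := by
    rw [Finset.sum_comm, ← Finset.sum_neg_distrib]
    refine Finset.sum_congr rfl fun i _ => ?_
    rw [← Finset.sum_neg_distrib]
    refine Finset.sum_congr rfl fun j _ => ?_
    rw [invGram_swap, neg_smul]
  rw [e]
  simp only [dualVector, map_sum, map_smul, ← hb]
  module

/-- By the antiderivation rule, ι_j ι_i(η ∧ α) = η_i ι_j α - η_j ι_i α + η ∧ ι_j ι_i α. The last
term gives η ∧ ι_{Ω⁻¹}α, and the first two give contraction with the dual vector. -/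
theorem contractInv_wedgeOne (h : IsHermitian J Ω) {k : ℕ} (η : E →L[ℝ] ℝ)
    (α : E [⋀^Fin (k + 2)]→L[ℝ] ℝ) :
    contractInv Ω (wedgeOne η α) - wedgeOne η (contractInv Ω α) =
      α.curryLeft (dualVector Ω η) := by
  rw [contractInv_eq_sum_curryLeft h, contractInv_eq_sum_curryLeft h, curryLeft_dualVector,
    wedgeOne_smul_right, wedgeOne_sum]
  refine (smul_sub _ _ _).symm.trans (congrArg _ ?_)
  refine (Finset.sum_sub_distrib _ _).symm.trans (Finset.sum_congr rfl fun i _ => ?_)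
  rw [wedgeOne_sum]
  refine (Finset.sum_sub_distrib _ _).symm.trans (Finset.sum_congr rfl fun j _ => ?_)
  rw [wedgeOne_smul_right]
  refine (smul_sub _ _ _).symm.trans (congrArg _ ?_)
  rw [curryLeft_wedgeOne, ← curryLeftₗ_apply, map_sub,
    map_smul, curryLeftₗ_apply, curryLeftₗ_apply, curryLeft_wedgeOne]
  abel

theorem contractInv_wedgeOne_one (h : IsHermitian J Ω) (η : E →L[ℝ] ℝ)
    (α : E [⋀^Fin 1]→L[ℝ] ℝ) :
    contractInv Ω (wedgeOne η α) = α.curryLeft (dualVector Ω η) := by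
  rw [contractInv_eq_sum_curryLeft h, curryLeft_dualVector]
  congr 1
  refine Finset.sum_congr rfl fun i _ => ?_
  refine Finset.sum_congr rfl fun j _ => ?_
  rw [curryLeft_wedgeOne, ← curryLeftₗ_apply, map_sub, curryLeftₗ_apply, curryLeftₗ_apply,
    curryLeft_wedgeOne_zero]
  rfl

end Commutator

/-! ### The star of an oriented orthonormal basis: its square and its conjugate of η ∧ ·. -/

section StarFrame

variable {E : Type*} [NormedAddCommGroup E] [NormedSpace ℝ E] [FiniteDimensional ℝ E]

theorem form_eq_zero_of_finrank_lt {k : ℕ} (hk : Module.finrank ℝ E < k)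
    (α : E [⋀^Fin k]→L[ℝ] ℝ) : α = 0 := by
  ext v
  refine α.toAlternatingMap.map_linearDependent v fun h => ?_
  have := h.fintype_card_le_finrank
  rw [Fintype.card_fin] at this
  omega

variable {N : ℕ} (e : Module.Basis (Fin N) ℝ E)

theorem starFrame_eq_frameSum {k p : ℕ} (h : k + p = N) (β : E [⋀^Fin k]→L[ℝ] ℝ) :
    starFrame h e β = (1 / (k.factorial : ℝ)) • frameSum h e β (toCont e.det) := rfl

/-- The factor q + 1 from `frameSum_wedgeOne` turns 1/(q + 1)! into 1/q!. -/
theorem starFrame_wedgeOne {q p : ℕ} (h : q + 1 + p = N) (h' : q + (p + 1) = N) (η : E →L[ℝ] ℝ)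
    (γ : E [⋀^Fin q]→L[ℝ] ℝ) :
    starFrame h e (wedgeOne η γ) = (-1 : ℝ) ^ q • (starFrame h' e γ).curryLeft (sharp e η) := by
  rw [starFrame_eq_frameSum, starFrame_eq_frameSum]
  obtain ⟨M, rfl⟩ : ∃ M, N = M + 1 := ⟨q + p, by omega⟩
  rw [frameSum_wedgeOne e h (by omega), ContinuousAlternatingMap.curryLeft_smul,
    smul_apply, curryLeft_frameSum e h' (by omega), smul_smul, smul_smul, smul_smul]
  congr 1
  have h1 : ((-1 : ℝ) ^ q) * (-1 : ℝ) ^ q = 1 := by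
    rw [← pow_add, ← two_mul, pow_mul]; simp
  have : (q.factorial : ℝ) ≠ 0 := by positivity
  have : (q + 1 : ℝ) ≠ 0 := by positivity
  rw [Nat.factorial_succ]
  push_cast
  field_simp
  rw [sq, h1]

theorem wedgeOne_starFrame {k p : ℕ} (h : k + 1 + p = N) (h' : k + (p + 1) = N) (η : E →L[ℝ] ℝ)
    (γ : E [⋀^Fin (k + 1)]→L[ℝ] ℝ) :
    wedgeOne η (starFrame h e γ) =
      (-1 : ℝ) ^ k • starFrame h' e (γ.curryLeft (sharp e η)) := by
  rw [starFrame_eq_frameSum, starFrame_eq_frameSum, wedgeOne_smul_right,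
    wedgeOne_frameSum e h (by omega) h']
  have h0 : wedgeOne η (toCont e.det) = 0 :=
    form_eq_zero_of_finrank_lt (by rw [Module.finrank_eq_card_basis e]; simp) _
  rw [h0, frameSumₗ_apply, map_zero, smul_zero, zero_add, smul_smul, smul_smul]
  congr 1
  have : (k.factorial : ℝ) ≠ 0 := by positivity
  have : (k + 1 : ℝ) ≠ 0 := by positivity
  rw [Nat.factorial_succ]
  push_cast
  field_simp

theorem starFrame_zero (h : 0 + N = N) (γ : E [⋀^Fin 0]→L[ℝ] ℝ) :
    starFrame h e γ = γ ![] • toCont e.det := by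
  rw [starFrame_eq_frameSum, frameSum_zero]
  simp

/-- Only the multi-indices that are permutations contribute; each of the N! terms is (±1)² = 1. -/
theorem starFrame_det (h : N + 0 = N) : starFrame h e (toCont e.det) ![] = 1 := by
  rw [starFrame_eq_frameSum, frameSum]
  simp only [ContinuousAlternatingMap.smul_apply, ContinuousAlternatingMap.sum_apply]
  have h1 : ∀ a : Fin N → Fin N, contract h (fun i => e (a i)) (toCont e.det) ![] =
      e.det (fun i => e (a i)) := by
    intro a
    change e.det _ = e.det _
    congr 1
    funext i
    have : Fin.cast h.symm i = Fin.castAdd 0 i := by ext; simp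
    simp only [Function.comp, this, Fin.append_left]
  simp only [h1, toCont_apply]
  have h2 : ∀ a ∉ Finset.univ.image (fun σ : Equiv.Perm (Fin N) => (σ : Fin N → Fin N)),
      e.det (fun i => e (a i)) • e.det (fun i => e (a i)) = 0 := by
    intro a ha
    have : ¬ Function.Injective a := by
      intro hi
      refine ha (Finset.mem_image.2 ⟨Equiv.ofBijective a (Finite.injective_iff_bijective.1 hi),
        Finset.mem_univ _, rfl⟩)
    rw [e.det.map_eq_zero_of_not_injective _ fun hi => this fun i j hij => hi (by simp [hij]),
      smul_zero]
  rw [← Finset.sum_subset (Finset.subset_univ _) fun a _ => h2 a,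
    Finset.sum_image fun σ _ τ _ hst => Equiv.coe_fn_injective hst]
  have h3 : ∀ σ : Equiv.Perm (Fin N), e.det (fun i => e (σ i)) • e.det (fun i => e (σ i)) =
      (1 : ℝ) := by
    intro σ
    have := e.det.map_perm e σ
    have h4 : (e.det fun i => e (σ i)) = Equiv.Perm.sign σ • e.det e := this
    rw [h4, e.det_self]
    rcases Int.units_eq_one_or (Equiv.Perm.sign σ) with h | h <;> simp [h]
  simp only [h3]
  simp [Fintype.card_perm]
  field_simp

theorem sharp_coord (v : E) :
    sharp e (∑ i, e.repr v i • (e.coord i).toContinuousLinearMap) = v := by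
  simp only [sharp, sum_apply, smul_apply]
  simp [Finsupp.single_apply, e.sum_repr]

/-- Induction on the degree: a form of positive degree is determined by its contractions, and every
vector is the dual of a functional (`sharp_coord`). The two rules exchanging η ∧ · and contraction
under * lower the degree, and the base case is * * 1 = 1. -/
theorem starFrame_starFrame (hN : Even N) {m q : ℕ} (h : m + q = N) (h' : q + m = N)
    (α : E [⋀^Fin m]→L[ℝ] ℝ) :
    starFrame h' e (starFrame h e α) = (-1 : ℝ) ^ m • α := by
  induction m generalizing q with
  | zero =>
    obtain rfl : q = N := by omega
    rw [starFrame_zero, starFrame_eq_frameSum, frameSumₗ_apply, map_smul, LinearMap.smul_apply,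
      smul_comm, ← frameSumₗ_apply, ← starFrame_eq_frameSum]
    ext v
    have := starFrame_det e h'
    rw [Subsingleton.elim v ![], ContinuousAlternatingMap.smul_apply, this]
    simp
  | succ m ih =>
    have hv : ∀ v, (starFrame h' e (starFrame h e α)).curryLeft v =
        ((-1 : ℝ) ^ (m + 1) • α).curryLeft v := by
      intro v
      set η : E →L[ℝ] ℝ := ∑ i, e.repr v i • (e.coord i).toContinuousLinearMap
      have hη : sharp e η = v := sharp_coord e v
      have h1 := starFrame_wedgeOne e (p := m) (q := q) (by omega) h' η (starFrame h e α)
      rw [wedgeOne_starFrame e h (by omega), hη, starFrame_eq_frameSum, frameSumₗ_apply, map_smul,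
        LinearMap.smul_apply, smul_comm, ← frameSumₗ_apply, ← starFrame_eq_frameSum,
        ih (by omega) (by omega), smul_smul, ← pow_add] at h1
      have h2 : (-1 : ℝ) ^ q * (-1) ^ q = 1 := by rw [← pow_add, Even.neg_one_pow ⟨q, rfl⟩]
      -- The degrees q and m + 1 have the same parity because their sum is the even dimension N.
      have h3 : (-1 : ℝ) ^ q = (-1) ^ (m + 1) := by
        have : (-1 : ℝ) ^ (q + (m + 1)) = 1 := by rw [h', hN.neg_one_pow]
        have h4 : (-1 : ℝ) ^ (m + 1) * (-1) ^ (m + 1) = 1 := by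
          rw [← pow_add, Even.neg_one_pow ⟨m + 1, rfl⟩]
        rw [pow_add] at this
        calc (-1 : ℝ) ^ q = (-1) ^ q * ((-1) ^ (m + 1) * (-1) ^ (m + 1)) := by rw [h4, mul_one]
          _ = _ := by rw [← mul_assoc, this, one_mul]
      have h5 := congrArg (fun x => (-1 : ℝ) ^ q • x) h1
      simp only [smul_smul, h2, one_smul] at h5
      rw [← h5, ContinuousAlternatingMap.curryLeft_smul, smul_apply, Even.neg_one_pow ⟨m, rfl⟩,
        mul_one, h3]
    ext w
    have := congrArg (fun f => f (Fin.tail w)) (hv (w 0))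
    simp only [ContinuousAlternatingMap.curryLeft_apply_apply] at this
    have hw : Matrix.vecCons (w 0) (Fin.tail w) = w := Fin.cons_self_tail w
    rwa [hw] at this

/-- There is no sign left: the (-1)^m from moving η through * cancels the one from * * on m-forms.
-/
theorem starFrame_wedgeOne_starFrame (hN : Even N) {m q : ℕ} (h : m + 1 + q = N)
    (h' : q + 1 + m = N) (η : E →L[ℝ] ℝ) (α : E [⋀^Fin (m + 1)]→L[ℝ] ℝ) :
    starFrame h' e (wedgeOne η (starFrame h e α)) = α.curryLeft (sharp e η) := by
  rw [wedgeOne_starFrame e h (by omega), starFrame_eq_frameSum, frameSumₗ_apply, map_smul,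
    LinearMap.smul_apply, smul_comm, ← frameSumₗ_apply, ← starFrame_eq_frameSum,
    starFrame_starFrame e hN (by omega) h', smul_smul, ← pow_add, Even.neg_one_pow ⟨m, rfl⟩,
    one_smul]

/-- `starFrame` as a linear map. -/
def starFrameₗ {k p : ℕ} (h : k + p = N) : (E [⋀^Fin k]→L[ℝ] ℝ) →ₗ[ℝ] (E [⋀^Fin p]→L[ℝ] ℝ) :=
  (1 / (k.factorial : ℝ)) • (frameSumₗ e h).flip (toCont e.det)

end StarFrame

/-! ### The Kähler identity in one Hermitian vector space. -/

section KahlerIdentity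

variable {E : Type*} [NormedAddCommGroup E] [NormedSpace ℝ E]

theorem wedgeOne_comp {k : ℕ} (η : E →L[ℝ] ℝ) (α : E [⋀^Fin k]→L[ℝ] ℝ) (A : E →L[ℝ] E) :
    (wedgeOne η α).compContinuousLinearMap A =
      wedgeOne (η ∘L A) (α.compContinuousLinearMap A) := by
  ext v
  simp only [ContinuousAlternatingMap.compContinuousLinearMap_apply, wedgeOne_apply]
  rfl

theorem pullback_neg_pullback {J : E →L[ℝ] E} (hJ : ∀ v, J (J v) = -v) {k : ℕ}
    (α : E [⋀^Fin k]→L[ℝ] ℝ) :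
    (α.compContinuousLinearMap J).compContinuousLinearMap (-J) = α := by
  ext v
  simp only [ContinuousAlternatingMap.compContinuousLinearMap_apply]
  congr 1
  funext i
  simp [hJ]

/-- Pullback of forms as a linear map. -/
def pullbackₗ (k : ℕ) (A : E →L[ℝ] E) : (E [⋀^Fin k]→L[ℝ] ℝ) →ₗ[ℝ] (E [⋀^Fin k]→L[ℝ] ℝ) where
  toFun α := α.compContinuousLinearMap A
  map_add' _ _ := rfl
  map_smul' _ _ := rfl

/-- Total antisymmetrisation as a linear map. -/
abbrev altₗ (k : ℕ) : (E →L[ℝ] E [⋀^Fin k]→L[ℝ] ℝ) →ₗ[ℝ] (E [⋀^Fin (k + 1)]→L[ℝ] ℝ) :=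
  (ContinuousAlternatingMap.alternatizeUncurryFinCLM ℝ E ℝ).toLinearMap

/-- Postcomposition with a linear map between finite-dimensional spaces. -/
def postₗ {M P : Type*} [NormedAddCommGroup M] [NormedSpace ℝ M] [FiniteDimensional ℝ M]
    [NormedAddCommGroup P] [NormedSpace ℝ P] (T : M →ₗ[ℝ] P) :
    (E →L[ℝ] M) →ₗ[ℝ] (E →L[ℝ] P) where
  toFun F := T.toContinuousLinearMap ∘L F
  map_add' _ _ := by ext; simp
  map_smul' _ _ := by ext; simp

theorem postₗ_smulRight {M P : Type*} [NormedAddCommGroup M] [NormedSpace ℝ M]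
    [FiniteDimensional ℝ M] [NormedAddCommGroup P] [NormedSpace ℝ P] (T : M →ₗ[ℝ] P)
    (η : E →L[ℝ] ℝ) (x : M) : postₗ T (η.smulRight x) = η.smulRight (T x) := by
  ext v
  simp [postₗ]

theorem altₗ_smulRight {k : ℕ} (η : E →L[ℝ] ℝ) (α : E [⋀^Fin k]→L[ℝ] ℝ) :
    altₗ k (η.smulRight α) = wedgeOne η α := rfl

variable [FiniteDimensional ℝ E]

instance finiteDimensional_form (k : ℕ) : FiniteDimensional ℝ (E [⋀^Fin k]→L[ℝ] ℝ) := by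
  let f : (E [⋀^Fin k]→L[ℝ] ℝ) →ₗ[ℝ] MultilinearMap ℝ (fun _ : Fin k => E) ℝ :=
    { toFun := fun α => α.toAlternatingMap.toMultilinearMap
      map_add' := fun _ _ => rfl
      map_smul' := fun _ _ => rfl }
  refine FiniteDimensional.of_injective f fun α β h => ?_
  ext v
  exact congrArg (fun m => m v) h

theorem eq_sum_smulRight {M : Type*} [NormedAddCommGroup M] [NormedSpace ℝ M] {ι : Type*}
    [Fintype ι] (b : Module.Basis ι ℝ E) (F : E →L[ℝ] M) :
    F = ∑ i, ((b.coord i).toContinuousLinearMap).smulRight (F (b i)) := by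
  ext v
  have := congrArg F (b.sum_repr v)
  rw [map_sum] at this
  rw [sum_apply, ← this]
  simp only [map_smul]
  rfl

/-- Maps E → M are sums of pure tensors η ⊗ x. This reduces identities in a covariant derivative to
the case η ⊗ α. -/
theorem linearMap_ext_smulRight {M P : Type*} [NormedAddCommGroup M] [NormedSpace ℝ M]
    [AddCommGroup P] [Module ℝ P] {S T : (E →L[ℝ] M) →ₗ[ℝ] P}
    (h : ∀ (η : E →L[ℝ] ℝ) (x : M), S (η.smulRight x) = T (η.smulRight x)) (F : E →L[ℝ] M) :
    S F = T F := by
  rw [eq_sum_smulRight (Module.finBasis ℝ E) F, map_sum, map_sum]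
  exact Finset.sum_congr rfl fun i _ => h _ _

variable {n : ℕ} {J : E →L[ℝ] E} {Ω : E [⋀^Fin 2]→L[ℝ] ℝ}

/-- The left vector represents η ∘ J⁻¹ for g = Ω(·, J·), so pairing it under Ω with Jw gives -η(Jw).
Since J is onto, it represents -η under Ω. -/
theorem IsHermitian.sharp_eq (h : IsHermitian J Ω) {e : Module.Basis (Fin (2 * n)) ℝ E}
    (he : IsUnitaryFrame J Ω e) (η : E →L[ℝ] ℝ) :
    sharp e (η ∘L (-J)) = -dualVector Ω η := by
  have key : ∀ w, Ω ![sharp e (η ∘L (-J)), J w] = (η ∘L (-J)) w := by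
    intro w
    have : (firstTwo (k := 0) Ω ![] (sharp e (η ∘L (-J)))) ∘ₗ J.toLinearMap =
        (η ∘L (-J)).toLinearMap := by
      refine e.ext fun j => ?_
      have h0 : ∀ i, firstTwo (k := 0) Ω ![] (e i) (J (e j)) = if i = j then 1 else 0 :=
        fun i => he.1 i j
      simp only [sharp, LinearMap.comp_apply, map_sum, map_smul, LinearMap.sum_apply,
        LinearMap.smul_apply, ContinuousLinearMap.coe_coe, h0, smul_eq_mul]
      simp
    exact LinearMap.congr_fun this w
  rw [← sub_eq_zero, sub_neg_eq_add]
  refine h.eq_zero fun u => ?_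
  have hu : u = J (-J u) := by rw [map_neg, h.sq, neg_neg]
  have h1 : Ω ![sharp e (η ∘L (-J)), u] = -η u := by
    conv_lhs => rw [hu]
    rw [key]
    simp [h.sq]
  have h2 := apply_dualVector h η u
  have h3 := LinearMap.congr_fun
    ((firstTwo (k := 0) Ω ![]).map_add (sharp e (η ∘L (-J))) (dualVector Ω η)) u
  simp only [LinearMap.add_apply, firstTwo_two_apply] at h3
  rw [h3, h1, h2, neg_add_cancel]

/-- The tensor F stands for the covariant derivative of a 1-form. In this degree Λα = 0, so the
commutator has a single term. -/
theorem kahlerIdentity_one (hJ : IsHermitian J Ω) {e : Module.Basis (Fin (2 * n)) ℝ E}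
    (he : IsUnitaryFrame J Ω e) {q : ℕ} (h : 1 + q = 2 * n) (h' : q + 1 + 0 = 2 * n)
    (F : E →L[ℝ] E [⋀^Fin 1]→L[ℝ] ℝ) :
    -contractInv Ω (altₗ 1 F) =
      starFrame h' e ((altₗ q (postₗ (pullbackₗ q J ∘ₗ starFrameₗ e h) F)).compContinuousLinearMap
        (-J)) := by
  refine linearMap_ext_smulRight (S := -(contractInvₗ Ω 0 ∘ₗ altₗ 1))
    (T := starFrameₗ e h' ∘ₗ pullbackₗ (q + 1) (-J) ∘ₗ altₗ q ∘ₗ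
      postₗ (pullbackₗ q J ∘ₗ starFrameₗ e h)) (fun η α => ?_) F
  simp only [LinearMap.neg_apply, LinearMap.comp_apply, postₗ_smulRight, altₗ_smulRight]
  change -contractInv Ω (wedgeOne η α) = starFrame h' e ((wedgeOne η
    ((starFrame h e α).compContinuousLinearMap J)).compContinuousLinearMap (-J))
  rw [wedgeOne_comp, pullback_neg_pullback hJ.sq,
    starFrame_wedgeOne_starFrame e (even_two_mul n) (m := 0) h h', hJ.sharp_eq he,
    contractInv_wedgeOne_one hJ, map_neg]

/-- For F = η ⊗ α both sides are contraction of α with -X, where Ω(X, ·) = η: on the left by the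
commutator formula, on the right since J⁻¹(η ∧ J * α) = (η ∘ J⁻¹) ∧ * α. -/
theorem kahlerIdentity (hJ : IsHermitian J Ω) {e : Module.Basis (Fin (2 * n)) ℝ E}
    (he : IsUnitaryFrame J Ω e) {m q : ℕ} (h : m + 2 + q = 2 * n) (h' : q + 1 + (m + 1) = 2 * n)
    (F : E →L[ℝ] E [⋀^Fin (m + 2)]→L[ℝ] ℝ) :
    -contractInv Ω (altₗ (m + 2) F) - altₗ m (postₗ (-contractInvₗ Ω m) F) =
      starFrame h' e ((altₗ q (postₗ (pullbackₗ q J ∘ₗ starFrameₗ e h) F)).compContinuousLinearMap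
        (-J)) := by
  refine linearMap_ext_smulRight
    (S := -(contractInvₗ Ω (m + 1) ∘ₗ altₗ (m + 2)) - altₗ m ∘ₗ postₗ (-contractInvₗ Ω m))
    (T := starFrameₗ e h' ∘ₗ pullbackₗ (q + 1) (-J) ∘ₗ altₗ q ∘ₗ
      postₗ (pullbackₗ q J ∘ₗ starFrameₗ e h)) (fun η α => ?_) F
  simp only [LinearMap.neg_apply, LinearMap.sub_apply, LinearMap.comp_apply, postₗ_smulRight,
    altₗ_smulRight]
  change -contractInv Ω (wedgeOne η α) - wedgeOne η (-contractInv Ω α) =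
    starFrame h' e ((wedgeOne η
      ((starFrame h e α).compContinuousLinearMap J)).compContinuousLinearMap (-J))
  rw [wedgeOne_comp, pullback_neg_pullback hJ.sq,
    starFrame_wedgeOne_starFrame e (even_two_mul n) (m := m + 1) h h', hJ.sharp_eq he, map_neg,
    ← contractInv_wedgeOne hJ, ← neg_one_smul ℝ (contractInv Ω α), wedgeOne_smul_right]
  module

end KahlerIdentity

/-! ### The Hodge star does not depend on the unitary frame -/

section FrameChange

variable {V : Type*} [AddCommGroup V] [Module ℝ V]

theorem sum_mul_eq_of_orthonormal {ι κ : Type*} [Fintype ι] [DecidableEq ι] [Fintype κ]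
    [DecidableEq κ] (g : LinearMap.BilinForm ℝ V) (e : Module.Basis ι ℝ V) (f : Module.Basis κ ℝ V)
    (he : ∀ i j, g (e i) (e j) = if i = j then 1 else 0)
    (hf : ∀ i j, g (f i) (f j) = if i = j then 1 else 0) (φ ψ : V →ₗ[ℝ] ℝ) :
    ∑ i, φ (e i) * ψ (e i) = ∑ i, φ (f i) * ψ (f i) := by
  have hE : LinearMap.BilinForm.toMatrix e g = 1 := by
    ext i j; rw [LinearMap.BilinForm.toMatrix_apply, he, Matrix.one_apply]
  have hF : LinearMap.BilinForm.toMatrix f g = 1 := by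
    ext i j; rw [LinearMap.BilinForm.toMatrix_apply, hf, Matrix.one_apply]
  have := toMatrix_inv_sum_eq f e g (LinearMap.BilinForm.linMulLin φ ψ) (by rw [hF]; simp)
  rw [hE, hF, inv_one, inv_one] at this
  simpa [Matrix.one_apply] using this

/-- The frame is exchanged one slot at a time, each time by the trace identity for the metric, whose
matrix is 1 in both frames. -/
theorem sum_multilinear_eq_of_orthonormal {ι κ : Type*} [Fintype ι] [DecidableEq ι] [Fintype κ]
    [DecidableEq κ] (g : LinearMap.BilinForm ℝ V) (e : Module.Basis ι ℝ V) (f : Module.Basis κ ℝ V)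
    (he : ∀ i j, g (e i) (e j) = if i = j then 1 else 0)
    (hf : ∀ i j, g (f i) (f j) = if i = j then 1 else 0) {k : ℕ}
    (φ ψ : MultilinearMap ℝ (fun _ : Fin k => V) ℝ) :
    ∑ a : Fin k → ι, φ (fun i => e (a i)) * ψ (fun i => e (a i)) =
      ∑ a : Fin k → κ, φ (fun i => f (a i)) * ψ (fun i => f (a i)) := by
  induction k with
  | zero =>
    rw [Fintype.sum_unique, Fintype.sum_unique]
    congr 2 <;> exact Subsingleton.elim _ _
  | succ k ih =>
    have split : ∀ {μ : Type _} [Fintype μ] (b : μ → V),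
        ∑ a : Fin (k + 1) → μ, φ (fun i => b (a i)) * ψ (fun i => b (a i)) =
        ∑ i, ∑ a : Fin k → μ, φ.curryLeft (b i) (fun j => b (a j)) *
          ψ.curryLeft (b i) (fun j => b (a j)) := by
      intro μ _ b
      rw [← Fintype.sum_prod_type']
      refine Fintype.sum_equiv (Fin.consEquiv (fun _ => μ)).symm _ _ fun a => ?_
      have : (fun i => b (a i)) = Fin.cons (b (a 0)) (fun i => b (a i.succ)) := by
        funext i
        refine Fin.cases ?_ (fun i => ?_) i <;> simp
      rw [this]
      rfl
    have split' : ∑ a : Fin (k + 1) → κ, φ (fun i => f (a i)) * ψ (fun i => f (a i)) =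
        ∑ i, ∑ a : Fin k → κ, φ.curryLeft (f i) (fun j => f (a j)) *
          ψ.curryLeft (f i) (fun j => f (a j)) := by
      rw [← Fintype.sum_prod_type']
      refine Fintype.sum_equiv (Fin.consEquiv (fun _ => κ)).symm _ _ fun a => ?_
      have : (fun i => f (a i)) = Fin.cons (f (a 0)) (fun i => f (a i.succ)) := by
        funext i
        refine Fin.cases ?_ (fun i => ?_) i <;> simp
      rw [this]
      rfl
    rw [split, split']
    simp only [ih]
    rw [Finset.sum_comm, Finset.sum_comm (s := Finset.univ (α := κ))]
    refine Finset.sum_congr rfl fun a _ => ?_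
    have ev : ∀ (χ : MultilinearMap ℝ (fun _ : Fin (k + 1) => V) ℝ) (x : V),
        χ.curryLeft x (fun j => f (a j)) =
          (MultilinearMap.toLinearMap χ (Fin.cons 0 fun j => f (a j)) 0) x := by
      intro χ x
      simp
    simp only [ev]
    exact sum_mul_eq_of_orthonormal g e f he hf _ _

/-- With J as multiplication by i, T is complex linear, and its real determinant is the squared
modulus of its complex one. -/
theorem det_pos_of_commute {J T : V →ₗ[ℝ] V} [FiniteDimensional ℝ V] (hJ : ∀ v, J (J v) = -v)
    (hT : ∀ v, T (J v) = J (T v)) (hdet : LinearMap.det T ≠ 0) : 0 < LinearMap.det T := by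
  have hJ2 : J * J = -1 := by ext v; simp [hJ]
  let φ : ℂ →ₐ[ℝ] Module.End ℝ V := Complex.liftAux J hJ2
  let : Module ℂ V := Module.compHom V φ.toRingHom
  have hsm : ∀ (z : ℂ) (v : V), z • v = z.re • v + z.im • J v := by
    intro z v
    change (Complex.liftAux J hJ2 z) v = _
    rw [Complex.liftAux_apply]
    simp [Module.algebraMap_end_apply]
  have : IsScalarTower ℝ ℂ V := ⟨fun r z v => by
    simp only [hsm, Complex.real_smul, Complex.mul_re, Complex.mul_im, Complex.ofReal_re,
      Complex.ofReal_im, smul_add, smul_smul]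
    simp⟩
  let S : V →ₗ[ℂ] V :=
    { toFun := T
      map_add' := T.map_add
      map_smul' := fun z v => by simp [hsm, hT] }
  have key := LinearMap.det_restrictScalars (R := ℝ) (f := S)
  have h1 : LinearMap.det T = Complex.normSq (LinearMap.det S) := by
    rw [← Algebra.norm_complex_apply, ← key]
    rfl
  rw [h1] at hdet ⊢
  exact lt_of_le_of_ne (Complex.normSq_nonneg _) (Ne.symm hdet)

/-- A Hermitian vector space has a unitary frame `e₀, e₁ = J e₀, e₂, …`. -/
theorem exists_unitary_basis {n : ℕ} {J : V →ₗ[ℝ] V} [FiniteDimensional ℝ V]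
    (Ω : LinearMap.BilinForm ℝ V) (hΩ : ∀ u v, Ω u v = -Ω v u) (hJ : ∀ v, J (J v) = -v)
    (hinv : ∀ u v, Ω (J u) (J v) = Ω u v) (hpos : ∀ v, v ≠ 0 → 0 < Ω v (J v))
    (hd : Module.finrank ℝ V = 2 * n) :
    ∃ e : Module.Basis (Fin (2 * n)) ℝ V, (∀ i j, Ω (e i) (J (e j)) = if i = j then 1 else 0) ∧
      ∀ i : Fin n, e ⟨2 * i + 1, by omega⟩ = J (e ⟨2 * i, by omega⟩) := by
  have hJ2 : J * J = -1 := by ext v; simp [hJ]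
  let φ : ℂ →ₐ[ℝ] Module.End ℝ V := Complex.liftAux J hJ2
  let : Module ℂ V := Module.compHom V φ.toRingHom
  have hsm : ∀ (z : ℂ) (v : V), z • v = z.re • v + z.im • J v := by
    intro z v
    change (Complex.liftAux J hJ2 z) v = _
    rw [Complex.liftAux_apply]
    simp [Module.algebraMap_end_apply]
  have : IsScalarTower ℝ ℂ V := ⟨fun r z v => by
    simp only [hsm, Complex.real_smul, Complex.mul_re, Complex.mul_im, Complex.ofReal_re,
      Complex.ofReal_im, smul_add, smul_smul]
    simp⟩
  have hsymm : ∀ u v, Ω u (J v) = Ω v (J u) := fun u v => by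
    rw [← hinv u, hJ, map_neg, hΩ (J u) v, neg_neg]
  have hself : ∀ v, Ω v v = 0 := fun v => by linarith [hΩ v v]
  -- The Hermitian product with real part Ω(u, Jv) and imaginary part Ω(u, v). A complex orthonormal
  -- basis b yields the real frame b₀, Jb₀, b₁, Jb₁, ….
  let core : InnerProductSpace.Core ℂ V :=
    { inner := fun u v => ⟨Ω u (J v), Ω u v⟩
      conj_inner_symm := fun u v => by
        apply Complex.ext
        · simp [hsymm]
        · simp [hΩ v u]
      re_inner_nonneg := fun v => by
        by_cases hv : v = 0
        · simp [hv]
        · exact (hpos v hv).le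
      add_left := fun u v w => by apply Complex.ext <;> simp
      smul_left := fun u v z => by
        apply Complex.ext
        · simp [hsm, hinv]
        · simp [hsm, hΩ (J u) v, hsymm v u]
      definite := fun v hv => by
        by_contra hne
        exact (hpos v hne).ne' (congrArg Complex.re hv) }
  let : NormedAddCommGroup V := core.toNormedAddCommGroup
  let : InnerProductSpace ℂ V := InnerProductSpace.ofCore core.toCore
  have : FiniteDimensional ℂ V := FiniteDimensional.right ℝ ℂ V
  have hfr : Module.finrank ℂ V = n := by
    have := Module.finrank_mul_finrank ℝ ℂ V
    rw [Complex.finrank_real_complex, hd] at this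
    omega
  let b := (stdOrthonormalBasis ℂ V).reindex (finCongr hfr)
  have hb : ∀ i j, Ω (b i) (J (b j)) = (if i = j then 1 else 0) ∧ Ω (b i) (b j) = 0 := by
    intro i j
    have h1 : (⟨Ω (b i) (J (b j)), Ω (b i) (b j)⟩ : ℂ) = if i = j then 1 else 0 :=
      orthonormal_iff_ite.1 b.orthonormal i j
    refine ⟨(congrArg Complex.re h1).trans ?_, (congrArg Complex.im h1).trans ?_⟩ <;>
      split_ifs <;> simp
  let e : Module.Basis (Fin (2 * n)) ℝ V :=
    (Complex.basisOneI.smulTower b.toBasis).reindex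
      ((Equiv.prodComm _ _).trans (finProdFinEquiv.trans (finCongr (Nat.mul_comm n 2))))
  have he : ∀ (i : Fin n) (s : Fin 2), e ⟨2 * i + s, by omega⟩ = Complex.basisOneI s • b i := by
    intro i s
    have : (⟨2 * i + s, by omega⟩ : Fin (2 * n)) = ((Equiv.prodComm _ _).trans
        (finProdFinEquiv.trans (finCongr (Nat.mul_comm n 2)))) (s, i) := by
      ext
      simp [add_comm]
    rw [this, Module.Basis.reindex_apply, Equiv.symm_apply_apply, Module.Basis.smulTower_apply,
      OrthonormalBasis.coe_toBasis]
  have he0 : ∀ i : Fin n, e ⟨2 * i, by omega⟩ = b i := fun i => by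
    have := he i 0
    simpa using this
  have he1 : ∀ i : Fin n, e ⟨2 * i + 1, by omega⟩ = J (b i) := fun i => by
    have := he i 1
    simpa [hsm] using this
  refine ⟨e, fun i j => ?_, fun i => by rw [he0, he1]⟩
  have hcase : ∀ i : Fin (2 * n),
      ∃ j : Fin n, i = ⟨2 * j, by omega⟩ ∨ i = ⟨2 * j + 1, by omega⟩ := by
    intro i
    refine ⟨⟨i / 2, by omega⟩, ?_⟩
    rcases Nat.even_or_odd' i with ⟨c, hc | hc⟩
    · left; ext; simp; omega
    · right; ext; simp; omega
  obtain ⟨s, rfl | rfl⟩ := hcase i <;> obtain ⟨t, rfl | rfl⟩ := hcase j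
  · rw [he0, he0, (hb s t).1]
    simp [Fin.ext_iff]
  · rw [he0, he1, hJ, map_neg, (hb s t).2, neg_zero, if_neg]
    simp [Fin.ext_iff]; omega
  · rw [he0, he1, hinv, (hb s t).2, if_neg]
    simp [Fin.ext_iff]; omega
  · rw [he1, he1, hinv, (hb s t).1]
    simp [Fin.ext_iff]

end FrameChange

/-! ### Unitary frames, and naturality of the star under conformal maps. -/

section Frames

variable {V W : Type*} [AddCommGroup V] [Module ℝ V] [TopologicalSpace V]
  [AddCommGroup W] [Module ℝ W] [TopologicalSpace W]
  {n : ℕ} {J : V →L[ℝ] V} {Ω : V [⋀^Fin 2]→L[ℝ] ℝ}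

/-- The metric `Ω(·, J·)`. -/
def metric (J : V →L[ℝ] V) (Ω : V [⋀^Fin 2]→L[ℝ] ℝ) : LinearMap.BilinForm ℝ V :=
  (firstTwo (k := 0) Ω ![]).compl₂ J.toLinearMap

theorem metric_apply (u v : V) : metric J Ω u v = Ω ![u, J v] := rfl

/-- The change of frame commutes with J, so its determinant is positive; it is orthogonal, so the
determinant squares to 1. -/
theorem IsUnitaryFrame.det_eq [FiniteDimensional ℝ V] (h : IsHermitian J Ω)
    {e f : Module.Basis (Fin (2 * n)) ℝ V}
    (he : IsUnitaryFrame J Ω e) (hf : IsUnitaryFrame J Ω f) : e.det = f.det := by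
  set T : V →ₗ[ℝ] V := f.constr ℝ e with hT
  have hTf : ∀ i, T (f i) = e i := fun i => f.constr_basis ℝ e i
  have hcomm : ∀ v, T (J v) = J (T v) := by
    have : T ∘ₗ J.toLinearMap = J.toLinearMap ∘ₗ T := by
      refine f.ext fun i => ?_
      simp only [LinearMap.comp_apply, ContinuousLinearMap.coe_coe, hTf]
      obtain ⟨j, hj | hj⟩ : ∃ j : Fin n, i = ⟨2 * j, by omega⟩ ∨ i = ⟨2 * j + 1, by omega⟩ := by
        refine ⟨⟨i / 2, by omega⟩, ?_⟩
        rcases Nat.even_or_odd' i with ⟨c, hc | hc⟩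
        · left; ext; simp; omega
        · right; ext; simp; omega
      · rw [hj, ← hf.2 j, ← he.2 j, hTf]
      · rw [hj, hf.2 j, he.2 j, h.sq, h.sq, map_neg, hTf]
    exact LinearMap.congr_fun this
  have h1 : f.det e = LinearMap.det T := by
    have := f.det_comp T f
    rw [f.det_self, mul_one] at this
    rw [← this]
    congr 1
    funext i
    exact (hTf i).symm
  have hE : LinearMap.BilinForm.toMatrix e (metric J Ω) = 1 := by
    ext i j; rw [LinearMap.BilinForm.toMatrix_apply, metric_apply, he.1, Matrix.one_apply]
  have hF : LinearMap.BilinForm.toMatrix f (metric J Ω) = 1 := by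
    ext i j; rw [LinearMap.BilinForm.toMatrix_apply, metric_apply, hf.1, Matrix.one_apply]
  have h2 : f.det e * f.det e = 1 := by
    have := LinearMap.BilinForm.toMatrix_mul_basis_toMatrix f e (metric J Ω)
    rw [hE, hF, Matrix.mul_one] at this
    have := congrArg Matrix.det this
    rwa [Matrix.det_mul, Matrix.det_transpose, Matrix.det_one] at this
  have h3 : 0 < f.det e := by
    rw [h1]
    refine det_pos_of_commute (J := J.toLinearMap) h.sq hcomm ?_
    rw [← h1]
    intro h0
    rw [h0] at h2
    simp at h2
  have h4 : f.det e = 1 := by nlinarith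
  have := f.det.eq_smul_basis_det e
  rw [h4, one_smul] at this
  exact this.symm

theorem contract_comp {k p m : ℕ} (h : k + p = m) (u : Fin k → V) (α : W [⋀^Fin m]→L[ℝ] ℝ)
    (A : V →L[ℝ] W) : (contract h (A ∘ u) α).compContinuousLinearMap A =
      contract h u (α.compContinuousLinearMap A) := by
  ext w
  change α _ = α _
  congr 1
  funext i
  simp only [Function.comp]
  generalize Fin.cast h.symm i = i'
  refine Fin.addCases (fun j => ?_) (fun j => ?_) i' <;> simp

/-- `contract h u α w` as a multilinear function of `u`. -/
def contractMultilinear {k p m : ℕ} (h : k + p = m) (α : V [⋀^Fin m]→L[ℝ] ℝ) (w : Fin p → V) :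
    MultilinearMap ℝ (fun _ : Fin k => V) ℝ :=
  ({ toFun := fun m => m w
     map_add' := fun _ _ => rfl
     map_smul' := fun _ _ => rfl } :
    MultilinearMap ℝ (fun _ : Fin p => V) ℝ →ₗ[ℝ] ℝ).compMultilinearMap
    ((α.toAlternatingMap.domDomCongr (finCongr h.symm)).domDomCongr finSumFinEquiv.symm
      ).toMultilinearMap.currySum

theorem contract_apply_eq_contractMultilinear {k p m : ℕ} (h : k + p = m) (u : Fin k → V)
    (α : V [⋀^Fin m]→L[ℝ] ℝ) (w : Fin p → V) :
    contract h u α w = contractMultilinear h α w u := by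
  change α _ = α _
  congr 1
  funext i
  generalize hi : Fin.cast h.symm i = i'
  have hi' : finCongr h.symm i = i' := hi
  simp only [Function.comp, hi, hi']
  refine Fin.addCases (fun j => ?_) (fun j => ?_) i'
  · rw [Fin.append_left, finSumFinEquiv_symm_apply_castAdd]
  · rw [Fin.append_right, finSumFinEquiv_symm_apply_natAdd]

/-- A Hermitian vector space of real dimension `2n` has a unitary frame. -/
theorem IsHermitian.exists_isUnitaryFrame [FiniteDimensional ℝ V] (h : IsHermitian J Ω)
    (hd : Module.finrank ℝ V = 2 * n) :
    ∃ e : Module.Basis (Fin (2 * n)) ℝ V, IsUnitaryFrame J Ω e := by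
  obtain ⟨e, he⟩ := exists_unitary_basis (J := J.toLinearMap) (firstTwo (k := 0) Ω ![])
    (two_form_swap Ω) h.sq h.invariant h.positive hd
  exact ⟨e, he⟩

variable [IsTopologicalAddGroup V] [ContinuousSMul ℝ V] [T2Space V] [FiniteDimensional ℝ V]
  [IsTopologicalAddGroup W] [ContinuousSMul ℝ W] [T2Space W] [FiniteDimensional ℝ W]

theorem IsUnitaryFrame.starFrame_eq (h : IsHermitian J Ω)
    {e f : Module.Basis (Fin (2 * n)) ℝ V} (he : IsUnitaryFrame J Ω e)
    (hf : IsUnitaryFrame J Ω f) {k p : ℕ} (hk : k + p = 2 * n) (β : V [⋀^Fin k]→L[ℝ] ℝ) :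
    starFrame hk e β = starFrame hk f β := by
  ext w
  rw [starFrame, starFrame, he.det_eq h hf]
  simp only [ContinuousAlternatingMap.smul_apply, ContinuousAlternatingMap.sum_apply]
  congr 1
  simp only [contract_apply_eq_contractMultilinear]
  exact sum_multilinear_eq_of_orthonormal (metric J Ω) e f (fun i j => he.1 i j)
    (fun i j => hf.1 i j) β.toMultilinearMap (contractMultilinear hk (toCont f.det) w)

/-- If `f` is the image of the frame `e` under `A`, scaled by `c⁻¹`, then the Hodge stars of
`e` and `f` correspond to each other up to a power of `c`. -/
theorem starFrame_comp {N : ℕ} (A : V ≃L[ℝ] W) {c : ℝ} (e : Module.Basis (Fin N) ℝ V)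
    (f : Module.Basis (Fin N) ℝ W) (hf : ∀ i, A (e i) = c • f i) {k p : ℕ} (hk : k + p = N)
    (β : W [⋀^Fin k]→L[ℝ] ℝ) :
    c ^ N • starFrame hk e (β.compContinuousLinearMap (A : V →L[ℝ] W)) =
      (c ^ k * c ^ k) • (starFrame hk f β).compContinuousLinearMap (A : V →L[ℝ] W) := by
  -- The volume contributes c^N. Passing from A e to f in the k summed slots costs c^k in β and c^k
  -- in the volume.
  have h1 : (toCont f.det).compContinuousLinearMap (A : V →L[ℝ] W) = c ^ N • toCont e.det := by
    have := ((toCont f.det).compContinuousLinearMap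
      (A : V →L[ℝ] W)).toAlternatingMap.eq_smul_basis_det e
    have h2 : ((toCont f.det).compContinuousLinearMap (A : V →L[ℝ] W)).toAlternatingMap e =
        c ^ N := by
      change f.det (fun i => A (e i)) = c ^ N
      simp only [hf]
      rw [f.det.map_smul_univ, f.det_self]
      simp
    rw [h2] at this
    ext w
    exact congrArg (fun g => g w) this
  ext w
  simp only [starFrame, ContinuousAlternatingMap.smul_apply,
    ContinuousAlternatingMap.compContinuousLinearMap_apply, ContinuousAlternatingMap.sum_apply,
    smul_eq_mul, Finset.mul_sum]
  refine Finset.sum_congr rfl fun a _ => ?_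
  have h3 : β ((A : V →L[ℝ] W) ∘ fun i => e (a i)) = c ^ k * β (fun i => f (a i)) := by
    have : ((A : V →L[ℝ] W) ∘ fun i => e (a i)) = fun i => c • f (a i) :=
      funext fun i => hf (a i)
    rw [this]
    have := β.toMultilinearMap.map_smul_univ (fun _ => c) (fun i => f (a i))
    simpa using this
  have h4 : c ^ N * contract hk (fun i => e (a i)) (toCont e.det) w =
      c ^ k * contract hk (fun i => f (a i)) (toCont f.det) ((A : V →L[ℝ] W) ∘ w) := by
    have h5 := congrArg (fun g => contract hk (fun i => e (a i)) g w) h1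
    have h6 : contract hk (fun i => e (a i)) (c ^ N • toCont e.det) w =
      c ^ N * contract hk (fun i => e (a i)) (toCont e.det) w := rfl
    simp only [h6] at h5
    rw [← h5, ← contract_comp, ContinuousAlternatingMap.compContinuousLinearMap_apply,
      contract_apply_eq_contractMultilinear, contract_apply_eq_contractMultilinear]
    have : ((A : V →L[ℝ] W) ∘ fun i => e (a i)) = fun i => c • f (a i) :=
      funext fun i => hf (a i)
    rw [this, MultilinearMap.map_smul_univ]
    simp
  rw [h3]
  linear_combination (1 / (k.factorial : ℝ)) * c ^ k * β (fun i => f (a i)) * h4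

theorem IsHermitian.star_eq (h : IsHermitian J Ω) {e : Module.Basis (Fin (2 * n)) ℝ V}
    (he : IsUnitaryFrame J Ω e) {k p : ℕ} (hk : k + p = 2 * n) (β : V [⋀^Fin k]→L[ℝ] ℝ) :
    star hk J Ω β = starFrame hk e β := by
  have hex : ∃ e : Module.Basis (Fin (2 * n)) ℝ V, IsUnitaryFrame J Ω e := ⟨e, he⟩
  rw [star, dif_pos hex]
  exact IsUnitaryFrame.starFrame_eq h hex.choose_spec he hk β

/-- The Hodge star is natural, up to scale, under conformal complex isomorphisms. -/
theorem star_comp (h : IsHermitian J Ω) {J' : W →L[ℝ] W} {Ω' : W [⋀^Fin 2]→L[ℝ] ℝ}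
    (h' : IsHermitian J' Ω') (hd : Module.finrank ℝ V = 2 * n) (A : V ≃L[ℝ] W) {c : ℝ}
    (hc : c ≠ 0) (hAJ : ∀ v, A (J v) = J' (A v)) (hA : ∀ u v, Ω' ![A u, A v] = c ^ 2 * Ω ![u, v])
    {k p : ℕ} (hk : k + p = 2 * n) (β : W [⋀^Fin k]→L[ℝ] ℝ) :
    c ^ (2 * n) • star hk J Ω (β.compContinuousLinearMap (A : V →L[ℝ] W)) =
      (c ^ k * c ^ k) • (star hk J' Ω' β).compContinuousLinearMap (A : V →L[ℝ] W) := by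
  obtain ⟨e, he⟩ := h.exists_isUnitaryFrame hd
  -- Since A scales Ω by c², it scales lengths by |c|, and the unitary frame on the target is c⁻¹ A
  -- e.
  let f : Module.Basis (Fin (2 * n)) ℝ W :=
    (e.map A.toLinearEquiv).unitsSMul fun _ => (Units.mk0 c hc)⁻¹
  have hf : ∀ i, f i = c⁻¹ • A (e i) := fun i => by
    simp only [f, Module.Basis.unitsSMul_apply, Module.Basis.map_apply]
    rfl
  have hf' : IsUnitaryFrame J' Ω' f := by
    refine ⟨fun i j => ?_, fun i => ?_⟩
    · rw [hf, hf, map_smul, ← hAJ, ← firstTwo_two_apply, map_smul, map_smul,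
        LinearMap.smul_apply, firstTwo_two_apply, hA, he.1, smul_eq_mul, smul_eq_mul]
      split_ifs
      · field_simp
      · simp
    · rw [hf, hf, he.2, hAJ, map_smul]
  rw [h.star_eq he, h'.star_eq hf']
  refine starFrame_comp A e f (fun i => ?_) hk β
  rw [hf, smul_smul, mul_inv_cancel₀ hc, one_smul]

end Frames

/-! ### The Weyl connection at a point -/

section Weyl

variable {V : Type*} [AddCommGroup V] [Module ℝ V]

/-- A bilinear family of functionals is represented by a bilinear map, by means of a
nondegenerate form. -/
theorem exists_bilinear_representing [FiniteDimensional ℝ V] (g : LinearMap.BilinForm ℝ V)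
    (hg : ∀ v, v ≠ 0 → 0 < g v v) (R : V →ₗ[ℝ] V →ₗ[ℝ] V →ₗ[ℝ] ℝ) :
    ∃ Γ : V →ₗ[ℝ] V →ₗ[ℝ] V, ∀ v u w, g (Γ v u) w = R v u w := by
  have hinj : Function.Injective g := by
    rw [← LinearMap.ker_eq_bot, LinearMap.ker_eq_bot']
    intro v hv
    by_contra hne
    have := hg v hne
    rw [hv] at this
    simp at this
  have hfr : Module.finrank ℝ V = Module.finrank ℝ (V →ₗ[ℝ] ℝ) :=
    (Subspace.dual_finrank_eq (K := ℝ) (V := V)).symm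
  let K : V ≃ₗ[ℝ] (V →ₗ[ℝ] ℝ) := LinearEquiv.ofInjectiveOfFinrankEq g hinj hfr
  refine ⟨R.compr₂ K.symm.toLinearMap, fun v u w => ?_⟩
  have : g (K.symm (R v u)) = R v u := K.apply_symm_apply (R v u)
  exact LinearMap.congr_fun this w

/-- Existence of the value at a point, in coordinates, of a torsion-free connection that is
compatible with `J` and with `Ω`, when the Nijenhuis tensor and `dΩ` vanish there. Here `D` and `W`
are the first derivatives of `J` and of `Ω`. -/
theorem exists_compatible_symm [FiniteDimensional ℝ V] (J : V →ₗ[ℝ] V) (Ω : LinearMap.BilinForm ℝ V)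
    (D : V →ₗ[ℝ] V →ₗ[ℝ] V) (W : V →ₗ[ℝ] LinearMap.BilinForm ℝ V)
    (hJ : ∀ v, J (J v) = -v) (hΩ : ∀ u v, Ω u v = -Ω v u) (hinv : ∀ u v, Ω (J u) (J v) = Ω u v)
    (hpos : ∀ v, v ≠ 0 → 0 < Ω v (J v))
    (hW : ∀ x u v, W x u v = -W x v u) (hDJ : ∀ x v, D x (J v) + J (D x v) = 0)
    (hDinv : ∀ x u v, W x (J u) (J v) + Ω (D x u) (J v) + Ω (J u) (D x v) = W x u v)
    (hN : ∀ u v, D (J u) v - D (J v) u + J (D v u) - J (D u v) = 0)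
    (hd : ∀ u v w, W u v w - W v u w + W w u v = 0) :
    ∃ Γ : V →ₗ[ℝ] V →ₗ[ℝ] V, (∀ u v, Γ u v = Γ v u) ∧ (∀ v u, D v u + J (Γ v u) = Γ v (J u)) ∧
      ∀ v u w, W v u w + Ω (Γ v u) w + Ω u (Γ v w) = 0 := by
  -- G(v, u, w) is the derivative along v of the metric g(u, w) = Ω(u, Jw).
  let G : V →ₗ[ℝ] V →ₗ[ℝ] V →ₗ[ℝ] ℝ := LinearMap.mk₂ ℝ
    (fun v u => (W v u).comp J + (Ω u).comp (D v))
    (fun _ _ _ => by ext; simp; ring) (fun _ _ _ => by ext; simp)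
    (fun _ _ _ => by ext; simp; ring) (fun _ _ _ => by ext; simp)
  have hG : ∀ v u w, G v u w = W v u (J w) + Ω u (D v w) := fun _ _ _ => rfl
  -- Koszul's formula: Γ is minus the Christoffel symbol of the Levi-Civita connection, so that the
  -- connection is ∂ - Γ.
  let R : V →ₗ[ℝ] V →ₗ[ℝ] V →ₗ[ℝ] ℝ := LinearMap.mk₂ ℝ
    (fun v u => (-(1 / 2 : ℝ)) • (G v u + G u v - (G.flip v).flip u))
    (fun _ _ _ => by ext; simp; ring) (fun _ _ _ => by ext; simp; ring)
    (fun _ _ _ => by ext; simp; ring) (fun _ _ _ => by ext; simp; ring)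
  have hR : ∀ v u w, R v u w = -(1 / 2 : ℝ) * (G v u w + G u v w - G w v u) := fun _ _ _ => rfl
  obtain ⟨Γ, hΓ⟩ := exists_bilinear_representing (Ω.compl₂ J) hpos R
  have hΓ' : ∀ v u w, Ω (Γ v u) (J w) = -(1 / 2 : ℝ) * (G v u w + G u v w - G w v u) :=
    fun v u w => (hΓ v u w).trans (hR v u w)
  have hΓ'' : ∀ v u w, Ω (Γ v u) w =
      (1 / 2 : ℝ) * (G v u (J w) + G u v (J w) - G (J w) v u) := by
    intro v u w
    have := hΓ' v u (J w)
    rw [hJ, map_neg] at this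
    linarith
  have ext : ∀ a b : V, (∀ w, Ω a (J w) = Ω b (J w)) → a = b := by
    intro a b h
    by_contra hne
    have := hpos (a - b) (sub_ne_zero.2 hne)
    rw [LinearMap.map_sub₂, h, sub_self] at this
    exact this.false
  -- The relations `ra`, `rb` and `rd` are the derivative of J² = -1, the derivative of the
  -- invariance of Ω, and the vanishing of the Nijenhuis tensor, each written with Ω. They and dΩ =
  -- 0 imply ∇J = 0 and ∇Ω = 0 by linear combination.
  have ra : ∀ x y z, Ω y (D x (J z)) = Ω (J y) (D x z) := by
    intro x y z
    have h1 := congrArg (Ω y) (hDJ x z)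
    have h2 := hinv y (J (D x z))
    rw [hJ, map_neg] at h2
    rw [map_add, map_zero] at h1
    linarith
  have rb : ∀ x y z, W x (J y) (J z) - Ω (J z) (D x y) + Ω (J y) (D x z) = W x y z := by
    intro x y z
    have := hDinv x y z
    rw [hΩ (D x y)] at this
    linarith
  have rd : ∀ x y z, Ω z (D (J x) y) - Ω z (D (J y) x) - Ω (J z) (D y x) + Ω (J z) (D x y) = 0 := by
    intro x y z
    have h1 := congrArg (Ω z) (hN x y)
    have h2 := hinv z (J (D y x))
    have h3 := hinv z (J (D x y))
    rw [hJ, map_neg] at h2 h3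
    simp only [map_add, map_sub, map_zero] at h1
    linarith
  have hGs : ∀ v u w, G v u w = G v w u := by
    intro v u w
    have h1 := ra v (J w) u
    have h2 := hW v (J u) w
    have h3 := rb v (J u) w
    simp only [hG, hJ, map_neg, LinearMap.neg_apply] at h1 h2 h3 ⊢
    linarith
  refine ⟨Γ, fun u v => ext _ _ fun w => ?_, fun v u => ext _ _ fun w => ?_, fun v u w => ?_⟩
  · rw [hΓ', hΓ', hGs w u v]
    ring
  · have e1 : Ω (J (Γ v u)) (J w) = Ω (Γ v u) w := hinv _ _
    rw [LinearMap.map_add₂, e1, hΓ'', hΓ', hΩ (D v u)]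
    have h1 := ra u v w
    have h2 := ra v u w
    have h3 := ra w (J v) (J u)
    have h4 := rb v u w
    have h5 := hd v u w
    have h6 := hd v (J u) (J w)
    have h7 := rd w u v
    simp only [hG, hJ, map_neg, LinearMap.neg_apply] at h1 h2 h3 h4 h5 h6 h7 ⊢
    linarith
  · rw [hΩ u, hΓ'', hΓ'']
    have h1 := ra (J u) v (J w)
    have h2 := ra w (J v) (J u)
    have h3 := rb v (J w) (J u)
    have h4 := hd v u w
    have h5 := hd v (J w) (J u)
    have h6 := rd (J w) u (J v)
    simp only [hG, hJ, map_neg, LinearMap.neg_apply] at h1 h2 h3 h4 h5 h6 ⊢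
    linarith

end Weyl

/-! ### Square roots near the identity -/

open Filter Topology in
/-- A square root near `1` in a Banach algebra. -/
theorem exists_sqrt_near_one (R : Type*) [NormedRing R] [NormedAlgebra ℝ R] [CompleteSpace R] :
    ∃ Ψ : R → R, Ψ 1 = 1 ∧ HasFDerivAt Ψ ((1 / 2 : ℝ) • ContinuousLinearMap.id ℝ R) 1 ∧
      (∀ᶠ h in 𝓝 (1 : R), Ψ h * Ψ h = h) ∧ ∀ᶠ X in 𝓝 (1 : R), Ψ (X * X) = X := by
  -- Squaring has derivative 2 at the unit even when R is not commutative, so the inverse function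
  -- theorem applies there.
  let e : R ≃L[ℝ] R := ContinuousLinearEquiv.smulLeft (Units.mk0 (2 : ℝ) two_ne_zero)
  have hs : HasStrictFDerivAt (fun X : R => X * X) (e : R →L[ℝ] R) 1 := by
    refine ((hasStrictFDerivAt_id (𝕜 := ℝ) (1 : R)).mul'
      (hasStrictFDerivAt_id (1 : R))).congr_fderiv
      (ContinuousLinearMap.ext fun x => ?_)
    change (1 : R) • x + x * 1 = (2 : ℝ) • x
    rw [one_smul, mul_one, two_smul]
  have h1 : hs.localInverse _ _ _ (1 : R) = 1 := by
    simpa using hs.localInverse_apply_image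
  refine ⟨hs.localInverse _ _ _, h1, ?_, ?_, hs.eventually_left_inverse⟩
  · have := hs.to_localInverse.hasFDerivAt
    rw [mul_one] at this
    refine this.congr_fderiv (ContinuousLinearMap.ext fun x => ?_)
    change (Units.mk0 (2 : ℝ) two_ne_zero)⁻¹ • x = (1 / 2 : ℝ) • x
    rw [Units.smul_def]
    simp
  · simpa using hs.eventually_right_inverse

open Filter Topology in
/-- If `σ` fixes `1` and `h y`, preserves squares and is continuous, then it fixes the square root
of `h y`. -/
theorem eventually_sqrt_fixed {R T : Type*} [NormedRing R] [TopologicalSpace T] {Ψ : R → R}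
    (h1 : Ψ 1 = 1) (hc : ContinuousAt Ψ 1) (hr : ∀ᶠ h in 𝓝 (1 : R), Ψ h * Ψ h = h)
    (hl : ∀ᶠ X in 𝓝 (1 : R), Ψ (X * X) = X) (σ : R → R) (hσ : Continuous σ) (hσ1 : σ 1 = 1)
    (hσm : ∀ X, σ X * σ X = σ (X * X)) {h : T → R} {y₀ : T} (hh : ContinuousAt h y₀)
    (hh1 : h y₀ = 1) (hfix : ∀ᶠ y in 𝓝 y₀, σ (h y) = h y) :
    ∀ᶠ y in 𝓝 y₀, σ (Ψ (h y)) = Ψ (h y) := by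
  have t1 : Tendsto h (𝓝 y₀) (𝓝 1) := hh1 ▸ hh
  -- The element σ(Ψ(h y)) squares to σ(h y) = h y and is close to 1, so by local uniqueness of the
  -- root it is Ψ(h y).
  have t2 : Tendsto (fun y => σ (Ψ (h y))) (𝓝 y₀) (𝓝 1) := by
    have a : Tendsto Ψ (𝓝 1) (𝓝 1) := by simpa [ContinuousAt, h1] using hc
    have b : Tendsto σ (𝓝 1) (𝓝 1) := by simpa [ContinuousAt, hσ1] using hσ.continuousAt (x := 1)
    exact b.comp (a.comp t1)
  filter_upwards [t1.eventually hr, t2.eventually hl, hfix] with y e1 e2 e3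
  rw [← e2, hσm, e1, e3]

/-! ### Hermitian gauges -/

section Gauge

open Filter Topology

variable {E : Type*} [NormedAddCommGroup E] [NormedSpace ℝ E] [FiniteDimensional ℝ E]

/-- A `2`-form as a continuous bilinear map. -/
def twoFormCLM : (E [⋀^Fin 2]→L[ℝ] ℝ) →L[ℝ] E →L[ℝ] E →L[ℝ] ℝ :=
  LinearMap.toContinuousLinearMap
    { toFun := fun Ω => (firstTwo (k := 0) Ω ![]).toContinuousBilinearMap
      map_add' := fun _ _ => rfl
      map_smul' := fun _ _ => rfl }

theorem twoFormCLM_apply (Ω : E [⋀^Fin 2]→L[ℝ] ℝ) (u v : E) : twoFormCLM Ω u v = Ω ![u, v] := rfl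

/-- A nondegenerate bilinear form as an isomorphism with the dual. -/
theorem exists_dual_equiv (b : E →L[ℝ] E →L[ℝ] ℝ) (hb : ∀ v, (∀ w, b v w = 0) → v = 0) :
    ∃ K : E ≃L[ℝ] (E →L[ℝ] ℝ), ∀ v, K v = b v := by
  have hinj : Function.Injective b.toLinearMap := by
    rw [← LinearMap.ker_eq_bot, LinearMap.ker_eq_bot']
    exact fun v hv => hb v fun w => by
      have : b v = 0 := hv
      rw [this]; rfl
  have hfr : Module.finrank ℝ E = Module.finrank ℝ (E →L[ℝ] ℝ) :=
    ((LinearMap.toContinuousLinearMap (𝕜 := ℝ) (E := E) (F' := ℝ)).finrank_eq.symm.trans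
      (Subspace.dual_finrank_eq (K := ℝ) (V := E))).symm
  exact ⟨(LinearEquiv.ofInjectiveOfFinrankEq b.toLinearMap hinj hfr).toContinuousLinearEquiv,
    fun v => rfl⟩

/-- A family of Hermitian structures `(J, b)` near `y₀` whose first derivatives are those of a
compatible symmetric connection up to a conformal factor admits a frame `A` that is adapted to it
up to the conformal factor, and whose derivative at `y₀` is symmetric. -/
theorem exists_gauge_of_symm {J : E → E →L[ℝ] E} {b : E → E →L[ℝ] E →L[ℝ] ℝ}
    {J' : E →L[ℝ] E →L[ℝ] E} {b' : E →L[ℝ] E →L[ℝ] E →L[ℝ] ℝ} {y₀ : E}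
    (hJ : HasFDerivAt J J' y₀) (hb : HasFDerivAt b b' y₀) (θ : E →L[ℝ] ℝ)
    (hsq : ∀ᶠ y in 𝓝 y₀, ∀ v, J y (J y v) = -v)
    (hskew : ∀ᶠ y in 𝓝 y₀, ∀ u v, b y u v = -b y v u)
    (hinv : ∀ᶠ y in 𝓝 y₀, ∀ u v, b y (J y u) (J y v) = b y u v)
    (hnd : ∀ v, (∀ w, b y₀ v w = 0) → v = 0)
    (Γ : E →L[ℝ] E →L[ℝ] E) (hΓJ : ∀ v u, J' v u + J y₀ (Γ v u) = Γ v (J y₀ u))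
    (hΓb : ∀ v u w, b' v u w + b y₀ (Γ v u) w + b y₀ u (Γ v w) = θ v * b y₀ u w) :
    ∃ (A : E → E →L[ℝ] E) (μ : E → ℝ), A y₀ = 1 ∧ HasFDerivAt A Γ y₀ ∧
      μ y₀ = 1 ∧ HasFDerivAt μ ((1 / 2 : ℝ) • θ) y₀ ∧
      ∀ᶠ y in 𝓝 y₀, IsUnit (A y) ∧ μ y ≠ 0 ∧ (∀ v, A y (J y₀ v) = J y (A y v)) ∧
        ∀ u v, b y (A y u) (A y v) = μ y ^ 2 * b y₀ u v := by
  obtain ⟨K, hK⟩ := exists_dual_equiv (b y₀) hnd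
  have hKs : ∀ f w, b y₀ (K.symm f) w = f w := fun f w => by rw [← hK, K.apply_symm_apply]
  have hext : ∀ x y, (∀ w, b y₀ x w = b y₀ y w) → x = y := fun x y h => sub_eq_zero.1 <|
    hnd _ fun w => by rw [map_sub, sub_apply, h, sub_self]
  -- a first adapted frame
  let A₁ : E → E →L[ℝ] E := fun y => 1 + Γ (y - y₀)
  have hA₁ : HasFDerivAt A₁ Γ y₀ := by
    have : HasFDerivAt (fun y => Γ (y - y₀)) Γ y₀ := by
      simpa using! Γ.hasFDerivAt.sub_const (x := y₀) (Γ y₀)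
    exact this.const_add (1 : E →L[ℝ] E)
  -- The complex linear part of A₁, from (E, J y₀) to (E, J y). The relation `hΓJ` keeps its
  -- derivative equal to Γ.
  let A₂ : E → E →L[ℝ] E := fun y => (1 / 2 : ℝ) • (A₁ y - J y ∘L (A₁ y ∘L J y₀))
  have hA₂0 : A₂ y₀ = 1 := by
    ext v
    change (1 / 2 : ℝ) • ((v + Γ (y₀ - y₀) v) - J y₀ (J y₀ v + Γ (y₀ - y₀) (J y₀ v))) = v
    have h0 : Γ (y₀ - y₀) = 0 := by rw [sub_self, map_zero]
    rw [h0, zero_apply, zero_apply, add_zero, add_zero, hsq.self_of_nhds]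
    module
  have hA₁0 : A₁ y₀ = 1 := by
    change 1 + Γ (y₀ - y₀) = 1
    rw [sub_self, map_zero, add_zero]
  have hA₂ : HasFDerivAt A₂ Γ y₀ := by
    refine ((hA₁.sub (hJ.clm_comp (hA₁.clm_comp (hasFDerivAt_const (J y₀) y₀)))).const_smul
      (1 / 2 : ℝ)).congr_fderiv ?_
    ext x u
    rw [hA₁0]
    have e := hΓJ x (J y₀ u)
    rw [hsq.self_of_nhds, map_neg] at e
    simp only [smul_apply, sub_apply, add_apply, ContinuousLinearMap.comp_apply,
      ContinuousLinearMap.compL_apply, ContinuousLinearMap.flip_apply, zero_apply,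
      one_apply_eq_self, map_zero, zero_add]
    have e' : J y₀ (Γ x (J y₀ u)) + J' x (J y₀ u) = -Γ x u := by rw [add_comm, e]
    rw [e']
    module
  have hA₂J : ∀ᶠ y in 𝓝 y₀, ∀ v, A₂ y (J y₀ v) = J y (A₂ y v) := by
    filter_upwards [hsq] with y hy v
    change (1 / 2 : ℝ) • (A₁ y (J y₀ v) - J y (A₁ y (J y₀ (J y₀ v)))) =
      J y ((1 / 2 : ℝ) • (A₁ y v - J y (A₁ y (J y₀ v))))
    rw [hsq.self_of_nhds, map_smul, map_sub, hy, map_neg, map_neg]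
    congr 1
    abel
  -- the metric in that frame
  let h : E → E →L[ℝ] E := fun y =>
    (K.symm : (E →L[ℝ] ℝ) →L[ℝ] E) ∘L
      ((ContinuousLinearMap.compL ℝ E E ℝ).flip (A₂ y) ∘L (b y ∘L A₂ y))
  have hh : ∀ y u v, b y₀ (h y u) v = b y (A₂ y u) (A₂ y v) := fun y u v => hKs _ _
  have hh0 : h y₀ = 1 := by
    ext u
    refine hext _ _ fun v => ?_
    rw [hh, hA₂0]
    rfl
  -- This is where `hΓb` enters: to first order the frame A₂ changes b only by the conformal factor
  -- 1 + θ.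
  have hhd : HasFDerivAt h (θ.smulRight (1 : E →L[ℝ] E)) y₀ := by
    refine ((hasFDerivAt_const (K.symm : (E →L[ℝ] ℝ) →L[ℝ] E) y₀).clm_comp
      ((((ContinuousLinearMap.compL ℝ E E ℝ).flip.hasFDerivAt (x := A₂ y₀)).comp y₀ hA₂).clm_comp
        (hb.clm_comp hA₂))).congr_fderiv ?_
    ext x u
    refine hext _ _ fun v => ?_
    have e := hΓb x u v
    simp only [hA₂0, add_apply, ContinuousLinearMap.comp_apply, ContinuousLinearEquiv.coe_coe,
      ContinuousLinearMap.compL_apply, ContinuousLinearMap.flip_apply, zero_apply,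
      one_apply_eq_self, map_zero, ContinuousLinearMap.smulRight_apply, map_smul,
      smul_apply, smul_eq_mul]
    rw [← e]
    simp only [add_apply, ContinuousLinearMap.comp_apply, add_zero, one_apply_eq_self, hKs, map_add]
    ring
  -- With R = √h, the frame A₂R⁻¹ pulls b y back to b y₀ exactly, provided that R is self-adjoint
  -- for b y₀; it still intertwines the complex structures if R commutes with J y₀.
  obtain ⟨Ψ, hΨ1, hΨd, hΨr, hΨl⟩ := exists_sqrt_near_one (E →L[ℝ] E)
  have hΨr' : ∀ᶠ y in 𝓝 y₀, Ψ (h y) * Ψ (h y) = h y := by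
    have : Tendsto h (𝓝 y₀) (𝓝 1) := hh0 ▸ hhd.continuousAt
    exact this.eventually hΨr
  have hRd : HasFDerivAt (fun y => Ψ (h y)) ((1 / 2 : ℝ) • θ.smulRight (1 : E →L[ℝ] E)) y₀ := by
    rw [← hh0] at hΨd
    refine (hΨd.comp y₀ hhd).congr_fderiv ?_
    ext x u
    rfl
  -- symmetries of the square root
  let σ₁ : (E →L[ℝ] E) → E →L[ℝ] E := fun X => -(J y₀ ∘L (X ∘L J y₀))
  have hσ₁ : ∀ X v, σ₁ X v = -J y₀ (X (J y₀ v)) := fun _ _ => rfl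
  let σ₂ : (E →L[ℝ] E) → E →L[ℝ] E := fun X => (K.symm : (E →L[ℝ] ℝ) →L[ℝ] E) ∘L
    ((ContinuousLinearMap.compL ℝ E E ℝ).flip X ∘L b y₀)
  have hσ₂ : ∀ X u v, b y₀ (σ₂ X u) v = b y₀ u (X v) := fun X u v => hKs _ _
  -- Being fixed by σ₁ means commuting with J y₀, and being fixed by σ₂ means being self-adjoint for
  -- b y₀. The adjoint reverses products but preserves squares, which is all that is needed.
  have hR₁ : ∀ᶠ y in 𝓝 y₀, σ₁ (Ψ (h y)) = Ψ (h y) := by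
    refine eventually_sqrt_fixed hΨ1 hΨd.continuousAt hΨr hΨl σ₁ (by fun_prop) ?_ ?_
      hhd.continuousAt hh0 ?_
    · ext v
      rw [hσ₁, one_apply_eq_self, one_apply_eq_self, hsq.self_of_nhds,
        neg_neg]
    · intro X
      ext v
      change -J y₀ (X (J y₀ (-J y₀ (X (J y₀ v))))) = -J y₀ (X (X (J y₀ v)))
      rw [map_neg, hsq.self_of_nhds, neg_neg]
    · filter_upwards [hsq, hinv, hA₂J] with y e1 e2 e3
      ext u
      refine hext _ _ fun v => ?_
      have e4 := hinv.self_of_nhds (h y (J y₀ u)) (J y₀ v)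
      rw [hsq.self_of_nhds, map_neg] at e4
      rw [hσ₁, map_neg, neg_apply, hh, ← e2, ← e3, ← e3, ← hh, ← e4]
  have hR₂ : ∀ᶠ y in 𝓝 y₀, σ₂ (Ψ (h y)) = Ψ (h y) := by
    refine eventually_sqrt_fixed hΨ1 hΨd.continuousAt hΨr hΨl σ₂ ?_ ?_ ?_
      hhd.continuousAt hh0 ?_
    · exact continuous_const.clm_comp
        ((ContinuousLinearMap.continuous _).clm_comp continuous_const)
    · ext u
      exact hext _ _ fun v => hσ₂ _ _ _
    · intro X
      ext u
      refine hext _ _ fun v => ?_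
      change b y₀ (σ₂ X (σ₂ X u)) v = _
      rw [hσ₂, hσ₂, hσ₂]
      rfl
    · filter_upwards [hskew] with y e
      ext u
      refine hext _ _ fun v => ?_
      rw [hσ₂, hh, hskew.self_of_nhds, hh, e, neg_neg]
  let μ : E → ℝ := fun y => 1 + (1 / 2 : ℝ) * θ (y - y₀)
  have hμ0 : μ y₀ = 1 := by
    change 1 + (1 / 2 : ℝ) * θ (y₀ - y₀) = 1
    rw [sub_self, map_zero, mul_zero, add_zero]
  have hμ : HasFDerivAt μ ((1 / 2 : ℝ) • θ) y₀ := by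
    have : HasFDerivAt (fun y => θ (y - y₀)) θ y₀ := by
      simpa using! θ.hasFDerivAt.sub_const (x := y₀) (θ y₀)
    exact (this.const_mul (1 / 2 : ℝ)).const_add 1
  -- The inverse root has derivative -θ/2 at y₀; the factor μ = 1 + θ/2 cancels it and leaves the
  -- symmetric derivative Γ.
  let A : E → E →L[ℝ] E := fun y => μ y • (A₂ y ∘L Ring.inverse (Ψ (h y)))
  have hinv1 : HasFDerivAt (fun y => Ring.inverse (Ψ (h y)))
      (-((1 / 2 : ℝ) • θ.smulRight (1 : E →L[ℝ] E))) y₀ := by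
    have h1 := hasFDerivAt_ringInverse (𝕜 := ℝ) (1 : (E →L[ℝ] E)ˣ)
    have h2 : Ψ (h y₀) = ((1 : (E →L[ℝ] E)ˣ) : E →L[ℝ] E) := by rw [hh0, hΨ1]; rfl
    rw [← h2] at h1
    refine (h1.comp y₀ hRd).congr_fderiv ?_
    ext x u
    simp
  have hA0 : A y₀ = 1 := by
    change μ y₀ • (A₂ y₀ ∘L Ring.inverse (Ψ (h y₀))) = 1
    rw [hμ0, hA₂0, hh0, hΨ1, Ring.inverse_one, one_smul]
    rfl
  have hA : HasFDerivAt A Γ y₀ := by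
    refine (hμ.smul (hA₂.clm_comp hinv1)).congr_fderiv ?_
    ext x u
    rw [hμ0, hA₂0, hh0, hΨ1, Ring.inverse_one]
    simp only [add_apply, smul_apply, one_smul, ContinuousLinearMap.comp_apply,
      ContinuousLinearMap.compL_apply, ContinuousLinearMap.flip_apply, neg_apply,
      one_apply_eq_self, ContinuousLinearMap.smulRight_apply, smul_eq_mul]
    module
  refine ⟨A, μ, hA0, hA, hμ0, hμ, ?_⟩
  have hu : ∀ᶠ y in 𝓝 y₀, IsUnit (A y) :=
    hA.continuousAt.eventually (Units.isOpen.mem_nhds (by rw [hA0]; exact isUnit_one))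
  have huR : ∀ᶠ y in 𝓝 y₀, IsUnit (Ψ (h y)) :=
    hRd.continuousAt.eventually (Units.isOpen.mem_nhds
      (by change IsUnit (Ψ (h y₀)); rw [hh0, hΨ1]; exact isUnit_one))
  have hμne : ∀ᶠ y in 𝓝 y₀, μ y ≠ 0 :=
    hμ.continuousAt.eventually_ne (by rw [hμ0]; exact one_ne_zero)
  filter_upwards [hu, hμne, huR, hR₁, hR₂, hA₂J, hΨr'] with y e1 e2 e3 e4 e5 e6 e7
  refine ⟨e1, e2, fun v => ?_, fun u v => ?_⟩
  · have c1 : ∀ x, Ψ (h y) (J y₀ x) = J y₀ (Ψ (h y) x) := fun x => by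
      conv_rhs => rw [← e4]
      rw [hσ₁, map_neg, hsq.self_of_nhds, neg_neg]
    have c2 : ∀ x, Ψ (h y) (Ring.inverse (Ψ (h y)) x) = x := fun x =>
      congrArg (fun T : E →L[ℝ] E => T x) (Ring.mul_inverse_cancel _ e3)
    have c3 : ∀ x, Ring.inverse (Ψ (h y)) (Ψ (h y) x) = x := fun x =>
      congrArg (fun T : E →L[ℝ] E => T x) (Ring.inverse_mul_cancel _ e3)
    have c4 : Ring.inverse (Ψ (h y)) (J y₀ v) = J y₀ (Ring.inverse (Ψ (h y)) v) := by
      rw [← c3 (J y₀ (Ring.inverse (Ψ (h y)) v)), c1, c2]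
    change μ y • A₂ y (Ring.inverse (Ψ (h y)) (J y₀ v)) =
      J y (μ y • A₂ y (Ring.inverse (Ψ (h y)) v))
    rw [c4, e6, map_smul]
  · have c2 : ∀ x, Ψ (h y) (Ring.inverse (Ψ (h y)) x) = x := fun x =>
      congrArg (fun T : E →L[ℝ] E => T x) (Ring.mul_inverse_cancel _ e3)
    change b y (μ y • A₂ y (Ring.inverse (Ψ (h y)) u))
      (μ y • A₂ y (Ring.inverse (Ψ (h y)) v)) = _
    have c3 : ∀ x z, b y₀ (h y x) z = b y₀ (Ψ (h y) x) (Ψ (h y) z) := fun x z => by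
      rw [← hσ₂, e5, ← mul_apply_eq_comp, e7]
    rw [(b y).map_smul, smul_apply, map_smul, ← hh, c3, c2, c2, smul_eq_mul, smul_eq_mul]
    ring

/-- Near a point where the Nijenhuis tensor of `J` vanishes and `dΩ = θ ∧ Ω`, there is a frame `A`
adapted to `(J, Ω)` up to a conformal factor `μ`, whose derivative at the point is symmetric. -/
theorem exists_gauge {J : E → E →L[ℝ] E} {Ω : E → E [⋀^Fin 2]→L[ℝ] ℝ}
    {J' : E →L[ℝ] E →L[ℝ] E} {Ω' : E →L[ℝ] E [⋀^Fin 2]→L[ℝ] ℝ} {y₀ : E}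
    (hJ : HasFDerivAt J J' y₀) (hΩ : HasFDerivAt Ω Ω' y₀) (θ : E →L[ℝ] ℝ)
    (hH : ∀ᶠ y in 𝓝 y₀, IsHermitian (J y) (Ω y))
    (hN : ∀ u v, J' (J y₀ u) v - J' (J y₀ v) u + J y₀ (J' v u) - J y₀ (J' u v) = 0)
    (hd : ContinuousAlternatingMap.alternatizeUncurryFin Ω' = wedgeOne θ (Ω y₀)) :
    ∃ (A : E → E →L[ℝ] E) (A' : E →L[ℝ] E →L[ℝ] E) (μ : E → ℝ), A y₀ = 1 ∧ HasFDerivAt A A' y₀ ∧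
      (∀ u v, A' u v = A' v u) ∧ μ y₀ = 1 ∧ HasFDerivAt μ ((1 / 2 : ℝ) • θ) y₀ ∧
      ∀ᶠ y in 𝓝 y₀, IsUnit (A y) ∧ μ y ≠ 0 ∧ (∀ v, A y (J y₀ v) = J y (A y v)) ∧
        ∀ u v, Ω y ![A y u, A y v] = μ y ^ 2 * Ω y₀ ![u, v] := by
  have hb : HasFDerivAt (fun y => twoFormCLM (Ω y)) (twoFormCLM ∘L Ω') y₀ :=
    by
    have h0 : HasFDerivAt (fun Ψ => twoFormCLM (E := E) Ψ) twoFormCLM (Ω y₀) :=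
      ContinuousLinearMap.hasFDerivAt _
    refine HasFDerivAt.comp (g := fun Ψ => twoFormCLM (E := E) Ψ) (g' := twoFormCLM) y₀ ?_ hΩ
    exact h0
  have hH₀ := hH.self_of_nhds
  -- Here J² = -1 is differentiated at y₀; `hDinv` does the same with Ω(J·, J·) = Ω.
  have hDJ : ∀ x v, J' x (J y₀ v) + J y₀ (J' x v) = 0 := by
    intro x v
    have h1 := hJ.clm_comp hJ
    have h2 : HasFDerivAt (fun y => J y ∘L J y) (0 : E →L[ℝ] E →L[ℝ] E) y₀ := by
      refine (hasFDerivAt_const (-1 : E →L[ℝ] E) y₀).congr_of_eventuallyEq ?_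
      filter_upwards [hH] with y hy
      ext v
      exact hy.sq v
    have h3 := congrArg (fun T : E →L[ℝ] E →L[ℝ] E => T x v) (h1.unique h2)
    rw [add_comm]
    exact h3
  have hDinv : ∀ x u v, Ω' x ![J y₀ u, J y₀ v] + Ω y₀ ![J' x u, J y₀ v] + Ω y₀ ![J y₀ u, J' x v] =
      Ω' x ![u, v] := by
    intro x u v
    have hu : HasFDerivAt (fun y => J y u) _ y₀ := hJ.clm_apply (hasFDerivAt_const u y₀)
    have hv : HasFDerivAt (fun y => J y v) _ y₀ := hJ.clm_apply (hasFDerivAt_const v y₀)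
    have h1 := (hb.clm_apply hu).clm_apply hv
    have h2 := (hb.clm_apply (hasFDerivAt_const u y₀)).clm_apply (hasFDerivAt_const v y₀)
    have h3 := h2.congr_of_eventuallyEq (f₁ := fun y => twoFormCLM (Ω y) (J y u) (J y v)) (by
      filter_upwards [hH] with y hy
      exact hy.invariant u v)
    have h4 := congrArg (fun T : E →L[ℝ] ℝ => T x) (h1.unique h3)
    simp only [add_apply, ContinuousLinearMap.comp_apply, ContinuousLinearMap.flip_apply,
      zero_apply, map_zero, zero_add, twoFormCLM_apply] at h4
    linarith
  have hdΩ : ∀ u v w, Ω' u ![v, w] - Ω' v ![u, w] + Ω' w ![u, v] =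
      θ u * Ω y₀ ![v, w] - θ v * Ω y₀ ![u, w] + θ w * Ω y₀ ![u, v] := by
    intro u v w
    have h1 := congrArg (fun T : E [⋀^Fin 3]→L[ℝ] ℝ => T ![u, v, w]) hd
    simp only [ContinuousAlternatingMap.alternatizeUncurryFin_apply, wedgeOne_apply] at h1
    have h2 := (Fin.sum_univ_three _).symm.trans (h1.trans (Fin.sum_univ_three _))
    have e0 : (0 : Fin 3).removeNth ![u, v, w] = ![v, w] := by ext i; fin_cases i <;> rfl
    have e1 : (1 : Fin 3).removeNth ![u, v, w] = ![u, w] := by ext i; fin_cases i <;> rfl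
    have e2 : (2 : Fin 3).removeNth ![u, v, w] = ![u, v] := by ext i; fin_cases i <;> rfl
    simp only [e0, e1, e2] at h2
    simpa [← sub_eq_add_neg] using h2
  -- The corrected derivative Ω' - θ ⊗ Ω. Its antisymmetrisation is dΩ - θ ∧ Ω = 0, so the Kähler
  -- algebra applies, and parallelism for W means ∇Ω = θ ⊗ Ω.
  let W : E →ₗ[ℝ] LinearMap.BilinForm ℝ E := LinearMap.mk₂ ℝ
    (fun x u => (firstTwo (k := 0) (Ω' x) ![] u - θ x • firstTwo (k := 0) (Ω y₀) ![] u))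
    (fun _ _ _ => by ext; simp; ring) (fun _ _ _ => by ext; simp; ring)
    (fun _ _ _ => by ext; simp; ring) (fun _ _ _ => by ext; simp; ring)
  have hW : ∀ x u v, W x u v = Ω' x ![u, v] - θ x * Ω y₀ ![u, v] := fun _ _ _ => rfl
  obtain ⟨Γ, hs, h1, h2⟩ := exists_compatible_symm (J y₀).toLinearMap (firstTwo (k := 0) (Ω y₀) ![])
    ((ContinuousLinearMap.coeLM ℝ).comp J'.toLinearMap) W hH₀.sq (two_form_swap _) hH₀.invariant
    hH₀.positive
    (fun x u v => by rw [hW, hW, two_form_swap, two_form_swap (Ω y₀)]; ring) hDJ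
    (fun x u v => by
      have e1 := hDinv x u v
      have e2 := hH₀.invariant u v
      change (Ω' x ![J y₀ u, J y₀ v] - θ x * Ω y₀ ![J y₀ u, J y₀ v]) + Ω y₀ ![J' x u, J y₀ v] +
        Ω y₀ ![J y₀ u, J' x v] = Ω' x ![u, v] - θ x * Ω y₀ ![u, v]
      rw [e2]
      linarith) hN
    (fun u v w => by
      have := hdΩ u v w
      rw [hW, hW, hW]
      linarith)
  obtain ⟨A, μ, hA0, hA, hμ0, hμ, hev⟩ := exists_gauge_of_symm hJ hb θ
    (hH.mono fun y hy => hy.sq) (Eventually.of_forall fun y u v => two_form_swap (Ω y) u v)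
    (hH.mono fun y hy => hy.invariant)
    (fun v hv => by
      by_contra hne
      exact (hH₀.positive v hne).ne' (hv (J y₀ v)))
    Γ.toContinuousBilinearMap h1 (fun v u w => by
      have e : (Ω' v ![u, w] - θ v * Ω y₀ ![u, w]) + Ω y₀ ![Γ v u, w] + Ω y₀ ![u, Γ v w] = 0 :=
        h2 v u w
      change Ω' v ![u, w] + Ω y₀ ![Γ v u, w] + Ω y₀ ![u, Γ v w] = θ v * Ω y₀ ![u, w]
      linarith)
  exact ⟨A, Γ.toContinuousBilinearMap, μ, hA0, hA, hs, hμ0, hμ, hev⟩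

end Gauge

/-! ### The commutation identity in a coordinate chart -/

section Local

open Filter Topology

variable {E : Type*} [NormedAddCommGroup E] [NormedSpace ℝ E]

/-- `A` is a frame adapted to `(J, Ω)` up to the conformal factor `μ`, it is the identity at `y₀`
with symmetric derivative `A'`, and `dμ = θ / 2` at `y₀`. -/
structure IsGauge (J : E → E →L[ℝ] E) (Ω : E → E [⋀^Fin 2]→L[ℝ] ℝ) (θ : E →L[ℝ] ℝ) (y₀ : E)
    (A : E → E →L[ℝ] E) (A' : E →L[ℝ] E →L[ℝ] E) (μ : E → ℝ) : Prop where
  frame_self : A y₀ = 1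
  frame_deriv : HasFDerivAt A A' y₀
  symm : ∀ u v, A' u v = A' v u
  factor_self : μ y₀ = 1
  factor_deriv : HasFDerivAt μ ((1 / 2 : ℝ) • θ) y₀
  adapted : ∀ᶠ y in 𝓝 y₀, IsUnit (A y) ∧ μ y ≠ 0 ∧ (∀ v, A y (J y₀ v) = J y (A y v)) ∧
    ∀ u v, Ω y ![A y u, A y v] = μ y ^ 2 * Ω y₀ ![u, v]

variable {J : E → E →L[ℝ] E} {Ω : E → E [⋀^Fin 2]→L[ℝ] ℝ} {θ : E →L[ℝ] ℝ} {y₀ : E}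
  {A : E → E →L[ℝ] E} {A' : E →L[ℝ] E →L[ℝ] E} {μ : E → ℝ}

/-- The exterior derivative can be computed in a frame with symmetric derivative. -/
theorem IsGauge.extDeriv_eq [CompleteSpace E] (hg : IsGauge J Ω θ y₀ A A' μ) {k : ℕ}
    {γ : E → E [⋀^Fin k]→L[ℝ] ℝ} {G : E →L[ℝ] E [⋀^Fin k]→L[ℝ] ℝ}
    (hG : HasFDerivAt (fun y => (γ y).compContinuousLinearMap (A y)) G y₀) :
    extDeriv γ y₀ = ContinuousAlternatingMap.alternatizeUncurryFin G := by
  have hB : HasFDerivAt (fun y => Ring.inverse (A y)) (-A') y₀ := by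
    have h1 := hasFDerivAt_ringInverse (𝕜 := ℝ) (1 : (E →L[ℝ] E)ˣ)
    have h2 : A y₀ = ((1 : (E →L[ℝ] E)ˣ) : E →L[ℝ] E) := hg.frame_self
    rw [← h2] at h1
    refine (h1.comp y₀ hg.frame_deriv).congr_fderiv ?_
    ext x u
    simp
  -- Near y₀, γ is its frame expression pulled back by A⁻¹. The extra term in the derivative comes
  -- from -A', and symmetry makes its antisymmetrisation vanish.
  have h3 := hG.continuousAlternatingMapCompContinuousLinearMap hB
  have h4 := h3.congr_of_eventuallyEq (f₁ := γ) (by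
    filter_upwards [hg.adapted] with y hy
    ext v
    have h5 : ∀ x, A y (Ring.inverse (A y) x) = x := fun x =>
      congrArg (fun T : E →L[ℝ] E => T x) (Ring.mul_inverse_cancel _ hy.1)
    simp only [ContinuousAlternatingMap.compContinuousLinearMap_apply]
    congr 1
    funext i
    exact (h5 _).symm)
  rw [extDeriv, h4.fderiv, ContinuousAlternatingMap.alternatizeUncurryFin_add,
    ContinuousAlternatingMap.alternatizeUncurryFin_fderivCompContinuousLinearMap_eq_zero, add_zero]
  · congr 1
    ext x v
    simp [hg.frame_self]
  · intro u v
    simp [hg.symm u v]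

theorem HasFDerivAt.postₗ {M P : Type*} [NormedAddCommGroup M] [NormedSpace ℝ M]
    [FiniteDimensional ℝ M] [NormedAddCommGroup P] [NormedSpace ℝ P] (T : M →ₗ[ℝ] P)
    {f : E → M} {f' : E →L[ℝ] M} {x : E} (hf : HasFDerivAt f f' x) :
    HasFDerivAt (fun y => T (f y)) (postₗ T f') x :=
  T.toContinuousLinearMap.hasFDerivAt.comp x hf

theorem IsGauge.hasFDerivAt_zpow (hg : IsGauge J Ω θ y₀ A A' μ) (N : ℤ) :
    HasFDerivAt (fun y => μ y ^ N) (((N : ℝ) / 2) • θ) y₀ := by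
  have h1 := hasDerivAt_zpow N (μ y₀) (Or.inl (by rw [hg.factor_self]; exact one_ne_zero))
  refine (h1.comp_hasFDerivAt y₀ hg.factor_deriv).congr_fderiv ?_
  rw [hg.factor_self, one_zpow, mul_one, smul_smul]
  congr 1
  ring

theorem IsGauge.equiv (hg : IsGauge J Ω θ y₀ A A' μ) :
    ∀ᶠ y in 𝓝 y₀, ∃ B : E ≃L[ℝ] E, (B : E →L[ℝ] E) = A y := by
  filter_upwards [hg.adapted] with y hy
  exact ⟨ContinuousLinearEquiv.unitsEquiv ℝ E hy.1.unit, rfl⟩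

variable [FiniteDimensional ℝ E]

/-- If, in the frame `A`, the form `γ` is `μ ^ N • T α` with `T` constant, then the twisted exterior
derivative of `γ` is obtained from that of `α` by applying `T` before antisymmetrising. -/
theorem IsGauge.twisted_eq (hg : IsGauge J Ω θ y₀ A A' μ) {m k : ℕ} {α : E → E [⋀^Fin m]→L[ℝ] ℝ}
    {F : E →L[ℝ] E [⋀^Fin m]→L[ℝ] ℝ}
    (hF : HasFDerivAt (fun y => (α y).compContinuousLinearMap (A y)) F y₀)
    {γ : E → E [⋀^Fin k]→L[ℝ] ℝ} (T : (E [⋀^Fin m]→L[ℝ] ℝ) →ₗ[ℝ] (E [⋀^Fin k]→L[ℝ] ℝ)) (N : ℤ)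
    (hγ : ∀ᶠ y in 𝓝 y₀, (γ y).compContinuousLinearMap (A y) =
      μ y ^ N • T ((α y).compContinuousLinearMap (A y))) (s t : ℝ) (hst : t = (N : ℝ) / 2 + s) :
    extDeriv γ y₀ - wedgeOne (t • θ) (γ y₀) = altₗ k (postₗ T (F - (s • θ).smulRight (α y₀))) := by
  have hcomp : ∀ {j : ℕ} (β : E [⋀^Fin j]→L[ℝ] ℝ), β.compContinuousLinearMap (A y₀) = β := by
    intro j β
    rw [hg.frame_self]
    rfl
  have h0 : γ y₀ = T (α y₀) := by
    have := hγ.self_of_nhds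
    rwa [hcomp, hcomp, hg.factor_self, one_zpow, one_smul] at this
  -- The derivative of μ^N at y₀ is (N/2)θ. Subtracting the twist t = N/2 + s removes this term and
  -- leaves T applied to F - sθ ⊗ α.
  have h1 := ((hg.hasFDerivAt_zpow N).smul (HasFDerivAt.postₗ T hF)).congr_of_eventuallyEq hγ
  rw [hg.extDeriv_eq h1, hg.factor_self, one_zpow, one_smul, hcomp, map_sub, map_sub,
    postₗ_smulRight, altₗ_smulRight, h0, hst]
  have h2 : ∀ r : ℝ, (altₗ k) ((r • θ).smulRight (T (α y₀))) = wedgeOne (r • θ) (T (α y₀)) :=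
    fun r => altₗ_smulRight _ _
  have h3 : wedgeOne (((N : ℝ) / 2 + s) • θ) (T (α y₀)) =
      wedgeOne (((N : ℝ) / 2) • θ) (T (α y₀)) + wedgeOne (s • θ) (T (α y₀)) := by
    ext v
    simp only [ContinuousAlternatingMap.add_apply, wedgeOne_apply, smul_apply, smul_eq_mul,
      add_mul, smul_add, Finset.sum_add_distrib]
  rw [ContinuousAlternatingMap.alternatizeUncurryFin_add]
  change _ + altₗ k _ - _ = _
  rw [h2, h3]
  change altₗ k _ + _ - _ = _
  abel

/-- Λ has weight -2 because Ω has weight 2; half of it is the shift from ℓ to ℓ - 1. -/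
theorem IsGauge.contractInv_comp (hg : IsGauge J Ω θ y₀ A A' μ)
    (hH : ∀ᶠ y in 𝓝 y₀, IsHermitian (J y) (Ω y)) {m : ℕ} (α : E → E [⋀^Fin (m + 2)]→L[ℝ] ℝ) :
    ∀ᶠ y in 𝓝 y₀, (-contractInv (Ω y) (α y)).compContinuousLinearMap (A y) =
      μ y ^ (-2 : ℤ) • (-contractInvₗ (Ω y₀) m) ((α y).compContinuousLinearMap (A y)) := by
  filter_upwards [hH, hg.adapted, hg.equiv] with y h1 h2 ⟨B, hB⟩
  have h3 := LCK.contractInv_comp hH.self_of_nhds h1 B (μ y ^ 2)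
    (fun u v => by
      have := h2.2.2.2 u v
      rw [← hB] at this
      exact this) (α y)
  rw [hB] at h3
  change -(contractInv (Ω y) (α y)).compContinuousLinearMap (A y) =
      μ y ^ (-2 : ℤ) • -contractInv (Ω y₀) ((α y).compContinuousLinearMap (A y))
  rw [← h3, smul_neg, smul_smul, zpow_neg, zpow_ofNat, inv_mul_cancel₀ (pow_ne_zero 2 h2.2.1),
    one_smul]

/-- In the frame the metric is μ² times a constant one: the volume has weight 2n and the product of
m-forms has weight -2m. Half of the total is the shift n - m of the twist. -/
theorem IsGauge.star_comp {n : ℕ} (hg : IsGauge J Ω θ y₀ A A' μ)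
    (hH : ∀ᶠ y in 𝓝 y₀, IsHermitian (J y) (Ω y)) (hd : Module.finrank ℝ E = 2 * n)
    {e : Module.Basis (Fin (2 * n)) ℝ E} (he : IsUnitaryFrame (J y₀) (Ω y₀) e) {m q : ℕ}
    (h : m + q = 2 * n) (α : E → E [⋀^Fin m]→L[ℝ] ℝ) :
    ∀ᶠ y in 𝓝 y₀, ((star h (J y) (Ω y) (α y)).compContinuousLinearMap (J y)
      ).compContinuousLinearMap (A y) = μ y ^ (2 * n - 2 * m : ℤ) •
        (pullbackₗ q (J y₀) ∘ₗ starFrameₗ e h) ((α y).compContinuousLinearMap (A y)) := by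
  filter_upwards [hH, hg.adapted, hg.equiv] with y h1 h2 ⟨B, hB⟩
  have hB' : ∀ v, B v = A y v := fun v => by rw [← hB]; rfl
  have h3 := LCK.star_comp hH.self_of_nhds h1 hd B h2.2.1
    (fun v => by rw [hB', hB', h2.2.2.1])
    (fun u v => by rw [hB', hB', h2.2.2.2]) h (α y)
  rw [hB, hH.self_of_nhds.star_eq he] at h3
  have h4 : (star h (J y) (Ω y) (α y)).compContinuousLinearMap (A y) =
      μ y ^ (2 * n - 2 * m : ℤ) • starFrame h e ((α y).compContinuousLinearMap (A y)) := by
    have h5 : μ y ^ (2 * n - 2 * m : ℤ) = (μ y ^ m * μ y ^ m)⁻¹ * μ y ^ (2 * n) := by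
      rw [zpow_sub₀ h2.2.1, ← pow_add, ← two_mul, div_eq_inv_mul]
      norm_cast
    rw [h5, mul_smul, h3, smul_smul, inv_mul_cancel₀ (by have := h2.2.1; positivity), one_smul]
  have h6 : ((star h (J y) (Ω y) (α y)).compContinuousLinearMap (J y)).compContinuousLinearMap (A y)
      = ((star h (J y) (Ω y) (α y)).compContinuousLinearMap (A y)).compContinuousLinearMap
        (J y₀) := by
    ext v
    simp only [ContinuousAlternatingMap.compContinuousLinearMap_apply]
    congr 1
    funext i
    exact (h2.2.2.1 _).symm
  rw [h6, h4]
  rfl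

variable {J' : E →L[ℝ] E →L[ℝ] E} {Ω' : E →L[ℝ] E [⋀^Fin 2]→L[ℝ] ℝ} {n : ℕ}

/-- The commutation identity in a chart, for `1`-forms. -/
theorem local_identity_one (hJ : HasFDerivAt J J' y₀) (hΩ : HasFDerivAt Ω Ω' y₀) (θ : E →L[ℝ] ℝ)
    (hH : ∀ᶠ y in 𝓝 y₀, IsHermitian (J y) (Ω y))
    (hN : ∀ u v, J' (J y₀ u) v - J' (J y₀ v) u + J y₀ (J' v u) - J y₀ (J' u v) = 0)
    (hΩθ : extDeriv Ω y₀ = wedgeOne θ (Ω y₀)) (hd : Module.finrank ℝ E = 2 * n)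
    {q : ℕ} (h : 1 + q = 2 * n) (h' : q + 1 + 0 = 2 * n) {α : E → E [⋀^Fin 1]→L[ℝ] ℝ}
    (hα : DifferentiableAt ℝ α y₀) (s : ℝ) :
    -contractInv (Ω y₀) (extDeriv α y₀ - wedgeOne (s • θ) (α y₀)) =
      star h' (J y₀) (Ω y₀)
        ((extDeriv (fun y => (star h (J y) (Ω y) (α y)).compContinuousLinearMap (J y)) y₀ -
          wedgeOne ((n + s - 1 : ℝ) • θ)
            ((star h (J y₀) (Ω y₀) (α y₀)).compContinuousLinearMap (J y₀))).compContinuousLinearMap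
          (-J y₀)) := by
  rw [extDeriv, hΩ.fderiv] at hΩθ
  obtain ⟨A, A', μ, hA⟩ := exists_gauge hJ hΩ θ hH hN hΩθ
  have hg : IsGauge J Ω θ y₀ A A' μ :=
    ⟨hA.1, hA.2.1, hA.2.2.1, hA.2.2.2.1, hA.2.2.2.2.1, hA.2.2.2.2.2⟩
  obtain ⟨e, he⟩ := hH.self_of_nhds.exists_isUnitaryFrame hd
  have hF := hα.hasFDerivAt.continuousAlternatingMapCompContinuousLinearMap hg.frame_deriv
  have t1 := hg.twisted_eq hF (γ := α) LinearMap.id 0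
    (Eventually.of_forall fun y => by rw [zpow_zero, one_smul]; rfl) s s (by simp)
  have t3 := hg.twisted_eq hF _ _ (hg.star_comp hH hd he h α) s (n + s - 1 : ℝ)
    (by push_cast; ring)
  rw [t1, t3, hH.self_of_nhds.star_eq he]
  exact kahlerIdentity_one hH.self_of_nhds he h h' _

/-- The commutation identity in a chart, for forms of degree at least two. -/
theorem local_identity (hJ : HasFDerivAt J J' y₀) (hΩ : HasFDerivAt Ω Ω' y₀) (θ : E →L[ℝ] ℝ)
    (hH : ∀ᶠ y in 𝓝 y₀, IsHermitian (J y) (Ω y))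
    (hN : ∀ u v, J' (J y₀ u) v - J' (J y₀ v) u + J y₀ (J' v u) - J y₀ (J' u v) = 0)
    (hΩθ : extDeriv Ω y₀ = wedgeOne θ (Ω y₀)) (hd : Module.finrank ℝ E = 2 * n)
    {m q : ℕ} (h : m + 2 + q = 2 * n) (h' : q + 1 + (m + 1) = 2 * n)
    {α : E → E [⋀^Fin (m + 2)]→L[ℝ] ℝ} (hα : DifferentiableAt ℝ α y₀) (s : ℝ) :
    -contractInv (Ω y₀) (extDeriv α y₀ - wedgeOne (s • θ) (α y₀)) -
      (extDeriv (fun y => -contractInv (Ω y) (α y)) y₀ -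
        wedgeOne ((s - 1) • θ) (-contractInv (Ω y₀) (α y₀))) =
      star h' (J y₀) (Ω y₀)
        ((extDeriv (fun y => (star h (J y) (Ω y) (α y)).compContinuousLinearMap (J y)) y₀ -
          wedgeOne ((n + s - (m + 2) : ℝ) • θ)
            ((star h (J y₀) (Ω y₀) (α y₀)).compContinuousLinearMap (J y₀))).compContinuousLinearMap
          (-J y₀)) := by
  rw [extDeriv, hΩ.fderiv] at hΩθ
  obtain ⟨A, A', μ, hA⟩ := exists_gauge hJ hΩ θ hH hN hΩθ
  have hg : IsGauge J Ω θ y₀ A A' μ :=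
    ⟨hA.1, hA.2.1, hA.2.2.1, hA.2.2.2.1, hA.2.2.2.2.1, hA.2.2.2.2.2⟩
  obtain ⟨e, he⟩ := hH.self_of_nhds.exists_isUnitaryFrame hd
  have hF := hα.hasFDerivAt.continuousAlternatingMapCompContinuousLinearMap hg.frame_deriv
  -- The three derivatives have weights 0, -2 and 2n - 2(m + 2), and their twists are exactly those
  -- that leave the common tensor F - sθ ⊗ α.
  have t1 := hg.twisted_eq hF (γ := α) LinearMap.id 0
    (Eventually.of_forall fun y => by rw [zpow_zero, one_smul]; rfl) s s (by simp)
  have t2 := hg.twisted_eq hF _ _ (hg.contractInv_comp hH α) s (s - 1) (by push_cast; ring)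
  have t3 := hg.twisted_eq hF _ _ (hg.star_comp hH hd he h α) s (n + s - (m + 2) : ℝ)
    (by push_cast; ring)
  rw [t1, t2, t3, hH.self_of_nhds.star_eq he]
  exact kahlerIdentity hH.self_of_nhds he h h' _

end Local

/-! ### Forms and complex structures in the charts of a manifold -/

section Chart

open Filter Topology Set

variable {n : ℕ} {X : Type*} [TopologicalSpace X]
  [ChartedSpace (EuclideanSpace ℝ (Fin (2 * n))) X]

theorem localRep_two_apply {x : X} {y : EuclideanSpace ℝ (Fin (2 * n))}
    {B : EuclideanSpace ℝ (Fin (2 * n)) ≃L[ℝ]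
        TangentSpace (𝓡 (2 * n)) ((extChartAt (𝓡 (2 * n)) x).symm y)}
    (hB : (B : EuclideanSpace ℝ (Fin (2 * n)) →L[ℝ] _) =
        mfderiv 𝓘(ℝ, EuclideanSpace ℝ (Fin (2 * n))) (𝓡 (2 * n))
          (extChartAt (𝓡 (2 * n)) x).symm y) (Ω : Form n X 2)
    (u v : EuclideanSpace ℝ (Fin (2 * n))) :
    localRep Ω x y ![u, v] = Ω ((extChartAt (𝓡 (2 * n)) x).symm y) ![B u, B v] := by
  rw [localRep, ← hB, ContinuousAlternatingMap.compContinuousLinearMap_apply]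
  congr 1
  funext i
  fin_cases i <;> rfl

/-- The derivative at `x` of the chart at `x`. -/
def chartDeriv (x : X) : TangentSpace (𝓡 (2 * n)) x →L[ℝ] EuclideanSpace ℝ (Fin (2 * n)) :=
  mfderiv (𝓡 (2 * n)) 𝓘(ℝ, EuclideanSpace ℝ (Fin (2 * n))) (extChartAt (𝓡 (2 * n)) x) x

theorem extD_eq {k : ℕ} (α : Form n X k) (x : X) :
    extD α x = (extDeriv (localRep α x) (extChartAt (𝓡 (2 * n)) x x)).compContinuousLinearMap
      (chartDeriv x) := rfl

variable [IsManifold (𝓡 (2 * n)) ∞ X]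

/-- The derivative of the inverse chart, as an isomorphism. -/
theorem exists_symm_equiv (x : X) {y : EuclideanSpace ℝ (Fin (2 * n))}
    (hy : y ∈ (extChartAt (𝓡 (2 * n)) x).target) :
    ∃ B : EuclideanSpace ℝ (Fin (2 * n)) ≃L[ℝ]
        TangentSpace (𝓡 (2 * n)) ((extChartAt (𝓡 (2 * n)) x).symm y),
      (B : EuclideanSpace ℝ (Fin (2 * n)) →L[ℝ] _) =
        mfderiv 𝓘(ℝ, EuclideanSpace ℝ (Fin (2 * n))) (𝓡 (2 * n))
          (extChartAt (𝓡 (2 * n)) x).symm y ∧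
      (B.symm : _ →L[ℝ] EuclideanSpace ℝ (Fin (2 * n))) =
        mfderiv (𝓡 (2 * n)) 𝓘(ℝ, EuclideanSpace ℝ (Fin (2 * n))) (extChartAt (𝓡 (2 * n)) x)
          ((extChartAt (𝓡 (2 * n)) x).symm y) := by
  have h1 := mfderiv_extChartAt_comp_mfderivWithin_extChartAt_symm (I := 𝓡 (2 * n)) hy
  have h2 := mfderivWithin_extChartAt_symm_comp_mfderiv_extChartAt (I := 𝓡 (2 * n)) hy
  rw [ModelWithCorners.range_eq_univ, mfderivWithin_univ] at h1 h2
  exact ⟨ContinuousLinearEquiv.equivOfInverse _ _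
    (fun v => congrArg (fun T : EuclideanSpace ℝ (Fin (2 * n)) →L[ℝ] _ => T v) h1)
    (fun v => congrArg (fun T : EuclideanSpace ℝ (Fin (2 * n)) →L[ℝ]
      EuclideanSpace ℝ (Fin (2 * n)) => T v) h2), rfl, rfl⟩

/-- The derivative of the chart, as an isomorphism. -/
theorem exists_chart_equiv (x : X) :
    ∃ B : TangentSpace (𝓡 (2 * n)) x ≃L[ℝ] EuclideanSpace ℝ (Fin (2 * n)),
      (B : _ →L[ℝ] EuclideanSpace ℝ (Fin (2 * n))) =
        chartDeriv x := by
  obtain ⟨B, hB⟩ := isInvertible_mfderiv_extChartAt (I := 𝓡 (2 * n)) (mem_extChartAt_source x)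
  exact ⟨B, hB⟩

theorem chart_symm_chart (x : X) (v : TangentSpace (𝓡 (2 * n)) x) :
    (mfderiv 𝓘(ℝ, EuclideanSpace ℝ (Fin (2 * n))) (𝓡 (2 * n)) (extChartAt (𝓡 (2 * n)) x).symm
      (extChartAt (𝓡 (2 * n)) x x) (chartDeriv x v) : EuclideanSpace ℝ (Fin (2 * n))) = v := by
  have h2 := mfderivWithin_extChartAt_symm_comp_mfderiv_extChartAt' (I := 𝓡 (2 * n))
    (mem_extChartAt_source x)
  rw [ModelWithCorners.range_eq_univ, mfderivWithin_univ] at h2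
  exact congrArg (fun T : EuclideanSpace ℝ (Fin (2 * n)) →L[ℝ]
      EuclideanSpace ℝ (Fin (2 * n)) => T v) h2

/-- A form at the centre of a chart is the pullback of its local expression. -/
theorem localRep_comp_chart {k : ℕ} (γ : Form n X k) (x : X) :
    (localRep γ x (extChartAt (𝓡 (2 * n)) x x)).compContinuousLinearMap
      (chartDeriv x) =
      γ x := by
  ext v
  -- The inverse chart at the image of x gives x only by a proved equality, so the base point is
  -- generalised before the tangent spaces are identified.
  have key : ∀ (p : X) (w : Fin k → EuclideanSpace ℝ (Fin (2 * n))), p = x →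
      (∀ i, w i = v i) → γ p w = γ x v := by
    rintro p w rfl hw
    congr 1
    funext i
    exact hw i
  exact key _ _ (extChartAt_to_inv x) fun i => chart_symm_chart x (v i)

/-- The expression of the complex structure in the chart at `x`. -/
def chartJ (C : ComplexStructure n X) (x : X) (y : EuclideanSpace ℝ (Fin (2 * n))) :
    EuclideanSpace ℝ (Fin (2 * n)) →L[ℝ] EuclideanSpace ℝ (Fin (2 * n)) :=
  (mfderiv (𝓡 (2 * n)) 𝓘(ℝ, EuclideanSpace ℝ (Fin (2 * n))) (extChartAt (𝓡 (2 * n)) x)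
    ((extChartAt (𝓡 (2 * n)) x).symm y)) ∘L (C.J ((extChartAt (𝓡 (2 * n)) x).symm y)) ∘L
      (mfderiv 𝓘(ℝ, EuclideanSpace ℝ (Fin (2 * n))) (𝓡 (2 * n)) (extChartAt (𝓡 (2 * n)) x).symm y)

theorem chartJ_chart (C : ComplexStructure n X) (x : X) (v : TangentSpace (𝓡 (2 * n)) x) :
    chartDeriv x (C.J x v)
      = chartJ C x (extChartAt (𝓡 (2 * n)) x x) (chartDeriv x v) := by
  have key : ∀ (p : X) (w : EuclideanSpace ℝ (Fin (2 * n))), p = x → w = v →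
      (chartDeriv x
        (C.J x v) : EuclideanSpace ℝ (Fin (2 * n))) =
      mfderiv (𝓡 (2 * n)) 𝓘(ℝ, EuclideanSpace ℝ (Fin (2 * n))) (extChartAt (𝓡 (2 * n)) x) p
        (C.J p w) := by
    rintro p w rfl rfl
    rfl
  exact key _ _ (extChartAt_to_inv x) (chart_symm_chart x v)

theorem chartJ_symm_equiv (C : ComplexStructure n X) (x : X)
    {y : EuclideanSpace ℝ (Fin (2 * n))}
    {B : EuclideanSpace ℝ (Fin (2 * n)) ≃L[ℝ]
        TangentSpace (𝓡 (2 * n)) ((extChartAt (𝓡 (2 * n)) x).symm y)}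
    (hB : (B : EuclideanSpace ℝ (Fin (2 * n)) →L[ℝ] _) =
        mfderiv 𝓘(ℝ, EuclideanSpace ℝ (Fin (2 * n))) (𝓡 (2 * n))
          (extChartAt (𝓡 (2 * n)) x).symm y)
    (hB' : (B.symm : _ →L[ℝ] EuclideanSpace ℝ (Fin (2 * n))) =
        mfderiv (𝓡 (2 * n)) 𝓘(ℝ, EuclideanSpace ℝ (Fin (2 * n))) (extChartAt (𝓡 (2 * n)) x)
          ((extChartAt (𝓡 (2 * n)) x).symm y)) (u : EuclideanSpace ℝ (Fin (2 * n))) :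
    B (chartJ C x y u) = C.J ((extChartAt (𝓡 (2 * n)) x).symm y) (B u) := by
  have : chartJ C x y u = B.symm (C.J ((extChartAt (𝓡 (2 * n)) x).symm y) (B u)) := by
    unfold chartJ
    rw [← hB, ← hB']
    rfl
  rw [this, B.apply_symm_apply]

theorem IsLCK.isHermitian {C : ComplexStructure n X} {Ω : Form n X 2} {θ : Form n X 1}
    (h : IsLCK C Ω θ) (x : X) : IsHermitian (C.J x) (Ω x) :=
  ⟨C.sq x, h.invariant x, h.positive x⟩

theorem IsLCK.isHermitian_chart {C : ComplexStructure n X} {Ω : Form n X 2} {θ : Form n X 1}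
    (h : IsLCK C Ω θ) (x : X) {y : EuclideanSpace ℝ (Fin (2 * n))}
    (hy : y ∈ (extChartAt (𝓡 (2 * n)) x).target) :
    IsHermitian (chartJ C x y) (localRep Ω x y) := by
  obtain ⟨B, hB, hB'⟩ := exists_symm_equiv x hy
  have hJ := chartJ_symm_equiv C x hB hB'
  refine ⟨fun v => B.injective ?_, fun v w => ?_, fun v hv => ?_⟩
  · rw [hJ, hJ, C.sq, map_neg]
  · rw [localRep_two_apply hB, localRep_two_apply hB, hJ, hJ, h.invariant]
  · rw [localRep_two_apply hB, hJ]
    exact h.positive _ _ fun h0 => hv (B.injective (by rw [h0, map_zero]))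

end Chart

/-! ### Integrability in a chart -/

section Nijenhuis

theorem inverse_apply_of_eq {E F : Type*} [AddCommGroup E] [Module ℝ E] [TopologicalSpace E]
    [AddCommGroup F] [Module ℝ F] [TopologicalSpace F] (B : E ≃L[ℝ] F) {T : E →L[ℝ] F}
    (h : (B : E →L[ℝ] F) = T) (w : F) : T.inverse w = B.symm w := by
  rw [← h, ContinuousLinearMap.inverse_equiv]
  rfl

open Filter Topology Set VectorField

theorem lieBracketWithin_eq_of_eventuallyEq {E : Type*} [NormedAddCommGroup E] [NormedSpace ℝ E]
    {V W v w : E → E} {v' w' : E →L[ℝ] E} {s : Set E} {y : E} (hs : s = univ)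
    (hV : V =ᶠ[𝓝 y] v) (hW : W =ᶠ[𝓝 y] w) (hv : HasFDerivAt v v' y) (hw : HasFDerivAt w w' y) :
    lieBracketWithin ℝ V W s y = w' (v y) - v' (w y) := by
  rw [hs, lieBracketWithin_univ, lieBracket, hV.fderiv_eq, hW.fderiv_eq, hv.fderiv, hw.fderiv,
    hV.eq_of_nhds, hW.eq_of_nhds]

variable {n : ℕ} {X : Type*} [TopologicalSpace X]
  [ChartedSpace (EuclideanSpace ℝ (Fin (2 * n))) X] [IsManifold (𝓡 (2 * n)) ∞ X]

theorem chartJ_hasFDerivAt (C : ComplexStructure n X) (x : X) :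
    ∃ J' : EuclideanSpace ℝ (Fin (2 * n)) →L[ℝ] EuclideanSpace ℝ (Fin (2 * n)) →L[ℝ]
      EuclideanSpace ℝ (Fin (2 * n)), HasFDerivAt (chartJ C x) J' (extChartAt (𝓡 (2 * n)) x x) := by
  have h1 : ContDiffOn ℝ ∞ (chartJ C x) (extChartAt (𝓡 (2 * n)) x).target := C.smooth x
  have h2 := (h1.contDiffAt (extChartAt_target_mem_nhds x)).differentiableAt (by simp)
  exact ⟨_, h2.hasFDerivAt⟩

/-- The coordinate vector field of the chart at `x` in the direction `u`. -/
def coordField (x : X) (u : EuclideanSpace ℝ (Fin (2 * n))) (p : X) : TangentSpace (𝓡 (2 * n)) p :=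
  mpullback (𝓡 (2 * n)) 𝓘(ℝ, EuclideanSpace ℝ (Fin (2 * n))) (extChartAt (𝓡 (2 * n)) x)
    (fun _ => u) p

theorem contMDiffAt_coordField (x : X) (u : EuclideanSpace ℝ (Fin (2 * n))) :
    ContMDiffAt (𝓡 (2 * n)) (𝓡 (2 * n)).tangent ∞
      (fun y => (⟨y, coordField x u y⟩ : TangentBundle (𝓡 (2 * n)) X)) x := by
  refine ContMDiffAt.mpullback_vectorField_preimage (n := ∞) ?_ ?_ ?_ ?_
  · exact contMDiffAt_vectorSpace_iff_contDiffAt.2 contDiffAt_const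
  · exact contMDiffAt_extChartAt
  · exact isInvertible_mfderiv_extChartAt (mem_extChartAt_source x)
  · simp

/-- The expression of a vector field in the chart at `x`. -/
theorem mpullbackWithin_symm_apply (x : X) {y : EuclideanSpace ℝ (Fin (2 * n))}
    (hy : y ∈ (extChartAt (𝓡 (2 * n)) x).target) (V : ∀ p : X, TangentSpace (𝓡 (2 * n)) p) :
    mpullbackWithin 𝓘(ℝ, EuclideanSpace ℝ (Fin (2 * n))) (𝓡 (2 * n))
      (extChartAt (𝓡 (2 * n)) x).symm V (range (𝓡 (2 * n))) y =
      mfderiv (𝓡 (2 * n)) 𝓘(ℝ, EuclideanSpace ℝ (Fin (2 * n))) (extChartAt (𝓡 (2 * n)) x)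
        ((extChartAt (𝓡 (2 * n)) x).symm y) (V ((extChartAt (𝓡 (2 * n)) x).symm y)) := by
  obtain ⟨B, hB, hB'⟩ := exists_symm_equiv x hy
  rw [← hB', ModelWithCorners.range_eq_univ, mpullbackWithin_univ]
  exact inverse_apply_of_eq B hB _

theorem coordField_symm (x : X) {y : EuclideanSpace ℝ (Fin (2 * n))}
    (hy : y ∈ (extChartAt (𝓡 (2 * n)) x).target) (u : EuclideanSpace ℝ (Fin (2 * n))) :
    coordField x u ((extChartAt (𝓡 (2 * n)) x).symm y) =
      mfderiv 𝓘(ℝ, EuclideanSpace ℝ (Fin (2 * n))) (𝓡 (2 * n))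
        (extChartAt (𝓡 (2 * n)) x).symm y u := by
  obtain ⟨B, hB, hB'⟩ := exists_symm_equiv x hy
  rw [← hB]
  exact inverse_apply_of_eq B.symm hB' _

theorem mlieBracket_chart (x : X) (V W : ∀ p : X, TangentSpace (𝓡 (2 * n)) p)
    {v w : EuclideanSpace ℝ (Fin (2 * n)) → EuclideanSpace ℝ (Fin (2 * n))}
    {v' w' : EuclideanSpace ℝ (Fin (2 * n)) →L[ℝ] EuclideanSpace ℝ (Fin (2 * n))}
    (hV : ∀ y ∈ (extChartAt (𝓡 (2 * n)) x).target,
      mfderiv (𝓡 (2 * n)) 𝓘(ℝ, EuclideanSpace ℝ (Fin (2 * n))) (extChartAt (𝓡 (2 * n)) x)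
        ((extChartAt (𝓡 (2 * n)) x).symm y) (V ((extChartAt (𝓡 (2 * n)) x).symm y)) = v y)
    (hW : ∀ y ∈ (extChartAt (𝓡 (2 * n)) x).target,
      mfderiv (𝓡 (2 * n)) 𝓘(ℝ, EuclideanSpace ℝ (Fin (2 * n))) (extChartAt (𝓡 (2 * n)) x)
        ((extChartAt (𝓡 (2 * n)) x).symm y) (W ((extChartAt (𝓡 (2 * n)) x).symm y)) = w y)
    (hv : HasFDerivAt v v' (extChartAt (𝓡 (2 * n)) x x))
    (hw : HasFDerivAt w w' (extChartAt (𝓡 (2 * n)) x x)) :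
    chartDeriv x
        (mlieBracket (𝓡 (2 * n)) V W x) =
      w' (v (extChartAt (𝓡 (2 * n)) x x)) - v' (w (extChartAt (𝓡 (2 * n)) x x)) := by
  have ev : ∀ᶠ y in 𝓝 (extChartAt (𝓡 (2 * n)) x x), y ∈ (extChartAt (𝓡 (2 * n)) x).target :=
    extChartAt_target_mem_nhds x
  have hV' : mpullbackWithin 𝓘(ℝ, EuclideanSpace ℝ (Fin (2 * n))) (𝓡 (2 * n))
      (extChartAt (𝓡 (2 * n)) x).symm V (range (𝓡 (2 * n)))
        =ᶠ[𝓝 (extChartAt (𝓡 (2 * n)) x x)] v := by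
    filter_upwards [ev] with y hy
    exact (mpullbackWithin_symm_apply x hy V).trans (hV y hy)
  have hW' : mpullbackWithin 𝓘(ℝ, EuclideanSpace ℝ (Fin (2 * n))) (𝓡 (2 * n))
      (extChartAt (𝓡 (2 * n)) x).symm W (range (𝓡 (2 * n)))
        =ᶠ[𝓝 (extChartAt (𝓡 (2 * n)) x x)] w := by
    filter_upwards [ev] with y hy
    exact (mpullbackWithin_symm_apply x hy W).trans (hW y hy)
  obtain ⟨B, hB⟩ := exists_chart_equiv (n := n) x
  have hm : mlieBracket (𝓡 (2 * n)) V W x = B.symm (lieBracketWithin ℝ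
      (mpullbackWithin 𝓘(ℝ, EuclideanSpace ℝ (Fin (2 * n))) (𝓡 (2 * n))
        (extChartAt (𝓡 (2 * n)) x).symm V (range (𝓡 (2 * n))))
      (mpullbackWithin 𝓘(ℝ, EuclideanSpace ℝ (Fin (2 * n))) (𝓡 (2 * n))
        (extChartAt (𝓡 (2 * n)) x).symm W (range (𝓡 (2 * n))))
      ((extChartAt (𝓡 (2 * n)) x).symm ⁻¹' univ ∩ range (𝓡 (2 * n)))
        (extChartAt (𝓡 (2 * n)) x x)) := inverse_apply_of_eq B hB _
  rw [← hB]
  refine (congrArg B hm).trans ((B.apply_symm_apply _).trans ?_)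
  exact lieBracketWithin_eq_of_eventuallyEq
    (by rw [preimage_univ, univ_inter, ModelWithCorners.range_eq_univ]) hV' hW' hv hw

/-- Vanishing of the Nijenhuis tensor, in the chart at `x`. -/
theorem nijenhuis_chart (C : ComplexStructure n X) (x : X)
    {J' : EuclideanSpace ℝ (Fin (2 * n)) →L[ℝ] EuclideanSpace ℝ (Fin (2 * n)) →L[ℝ]
      EuclideanSpace ℝ (Fin (2 * n))}
    (hJ : HasFDerivAt (chartJ C x) J' (extChartAt (𝓡 (2 * n)) x x))
    (u v : EuclideanSpace ℝ (Fin (2 * n))) :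
    J' (chartJ C x (extChartAt (𝓡 (2 * n)) x x) u) v -
      J' (chartJ C x (extChartAt (𝓡 (2 * n)) x x) v) u +
      chartJ C x (extChartAt (𝓡 (2 * n)) x x) (J' v u) -
      chartJ C x (extChartAt (𝓡 (2 * n)) x x) (J' u v) = 0 := by
  -- The Nijenhuis tensor is evaluated on coordinate fields. In the chart these are constant and
  -- commute, and their images under J are y ↦ `chartJ C x y u`, so only derivatives of J survive in
  -- the brackets.
  have h := C.integrable x (coordField x u) (coordField x v) (contMDiffAt_coordField x u)
    (contMDiffAt_coordField x v)
  have c1 : ∀ w : EuclideanSpace ℝ (Fin (2 * n)), ∀ y ∈ (extChartAt (𝓡 (2 * n)) x).target,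
      mfderiv (𝓡 (2 * n)) 𝓘(ℝ, EuclideanSpace ℝ (Fin (2 * n))) (extChartAt (𝓡 (2 * n)) x)
        ((extChartAt (𝓡 (2 * n)) x).symm y)
        (coordField x w ((extChartAt (𝓡 (2 * n)) x).symm y)) = w := by
    intro w y hy
    obtain ⟨B, hB, hB'⟩ := exists_symm_equiv x hy
    rw [coordField_symm x hy, ← hB, ← hB']
    exact B.symm_apply_apply w
  have c2 : ∀ w : EuclideanSpace ℝ (Fin (2 * n)), ∀ y ∈ (extChartAt (𝓡 (2 * n)) x).target,
      mfderiv (𝓡 (2 * n)) 𝓘(ℝ, EuclideanSpace ℝ (Fin (2 * n))) (extChartAt (𝓡 (2 * n)) x)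
        ((extChartAt (𝓡 (2 * n)) x).symm y)
        (C.J ((extChartAt (𝓡 (2 * n)) x).symm y)
          (coordField x w ((extChartAt (𝓡 (2 * n)) x).symm y))) = chartJ C x y w := by
    intro w y hy
    rw [coordField_symm x hy]
    rfl
  have d1 : ∀ w : EuclideanSpace ℝ (Fin (2 * n)),
      HasFDerivAt (fun _ : EuclideanSpace ℝ (Fin (2 * n)) => w)
        (0 : EuclideanSpace ℝ (Fin (2 * n)) →L[ℝ] EuclideanSpace ℝ (Fin (2 * n)))
        (extChartAt (𝓡 (2 * n)) x x) := fun w => hasFDerivAt_const w _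
  have d2 : ∀ w : EuclideanSpace ℝ (Fin (2 * n)),
      HasFDerivAt (fun y => chartJ C x y w) (J'.flip w) (extChartAt (𝓡 (2 * n)) x x) := by
    intro w
    refine (hJ.clm_apply (d1 w)).congr_fderiv ?_
    ext z
    simp
  let V : EuclideanSpace ℝ (Fin (2 * n)) → ∀ p : X, TangentSpace (𝓡 (2 * n)) p :=
    fun w p => coordField x w p
  let JV : EuclideanSpace ℝ (Fin (2 * n)) → ∀ p : X, TangentSpace (𝓡 (2 * n)) p :=
    fun w p => C.J p (coordField x w p)
  have e1 := mlieBracket_chart x (JV u) (JV v) (c2 u) (c2 v) (d2 u) (d2 v)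
  have e2 := mlieBracket_chart x (JV u) (V v) (c2 u) (c1 v) (d2 u) (d1 v)
  have e3 := mlieBracket_chart x (V u) (JV v) (c1 u) (c2 v) (d1 u) (d2 v)
  have e4 := mlieBracket_chart x (V u) (V v) (c1 u) (c1 v) (d1 u) (d1 v)
  have h' := congrArg (chartDeriv x) h
  rw [map_sub, map_sub, map_sub, chartJ_chart, chartJ_chart, e1, e2, e3, e4, map_zero] at h'
  have h2 : J' (chartJ C x (extChartAt (𝓡 (2 * n)) x x) u) v -
      J' (chartJ C x (extChartAt (𝓡 (2 * n)) x x) v) u -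
      chartJ C x (extChartAt (𝓡 (2 * n)) x x) (0 - J' v u) -
      chartJ C x (extChartAt (𝓡 (2 * n)) x x) (J' u v - 0) - (0 - 0) = 0 := h'
  rwa [sub_zero, sub_zero, sub_zero, zero_sub, map_neg, sub_neg_eq_add] at h2

end Nijenhuis

/-! ### The commutation identity at a point of the manifold -/

section Pointwise

open Filter Topology Set

variable {n : ℕ} {X : Type*} [TopologicalSpace X]
  [ChartedSpace (EuclideanSpace ℝ (Fin (2 * n))) X]

theorem finrank_model : Module.finrank ℝ (EuclideanSpace ℝ (Fin (2 * n))) = 2 * n := by simp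

/-- The wedge product of two forms. -/
theorem localRep_wedge {p q r : ℕ} (h : p + q = r) (α : Form n X p) (β : Form n X q) (x : X)
    (y : EuclideanSpace ℝ (Fin (2 * n))) :
    localRep (fun z => wedge h (α z) (β z)) x y = wedge h (localRep α x y) (localRep β x y) :=
  wedge_comp h _ _ _

theorem Smooth.wedge {p q r : ℕ} (h : p + q = r) {α : Form n X p} {β : Form n X q}
    (hα : Smooth α) (hβ : Smooth β) : Smooth (fun z => wedge h (α z) (β z)) := by
  intro x
  have h1 : ContDiffOn ℝ ∞ (fun y => (wedgeBilin h).toContinuousBilinearMap (localRep α x y)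
      (localRep β x y)) (extChartAt (𝓡 (2 * n)) x).target :=
    (contDiffOn_const.clm_apply (hα x)).clm_apply (hβ x)
  exact h1.congr fun y _ => localRep_wedge h α β x y

theorem Smooth.zero {k : ℕ} : Smooth (0 : Form n X k) := fun _ => contDiffOn_const (c := 0)

theorem Smooth.wedgeLeft {p : ℕ} {η : Form n X p} (hη : Smooth η) {β : MixedForm n X}
    (hβ : ∀ m, Smooth (β m)) (m : ℕ) : Smooth (LCK.wedgeLeft η β m) := by
  unfold LCK.wedgeLeft
  split_ifs with h
  · exact hη.wedge _ (hβ _)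
  · exact Smooth.zero

theorem Smooth.LPow {Ω : Form n X 2} (hΩ : Smooth Ω) (j : ℤ) {β : MixedForm n X}
    (hβ : ∀ m, Smooth (β m)) (m : ℕ) : Smooth (LCK.LPow Ω j β m) := by
  unfold LCK.LPow
  split_ifs
  · generalize j.toNat = i
    induction i generalizing m with
    | zero => exact hβ m
    | succ i ih =>
      rw [Function.iterate_succ_apply']
      exact hΩ.wedgeLeft ih m
  · exact Smooth.zero

theorem wedge_zero_right {V : Type*} [AddCommGroup V] [Module ℝ V] [TopologicalSpace V]
    [IsTopologicalAddGroup V] [ContinuousSMul ℝ V] [T2Space V] [FiniteDimensional ℝ V]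
    {p q r : ℕ} (h : p + q = r) (α : V [⋀^Fin p]→L[ℝ] ℝ) :
    wedge h α (0 : V [⋀^Fin q]→L[ℝ] ℝ) = 0 := map_zero (wedgeBilin h α)

theorem LPow_apply_eq_zero (Ω : Form n X 2) (j : ℤ) {k : ℤ} {α : MixedForm n X}
    (hα : ∀ m : ℕ, (m : ℤ) ≠ k → α m = 0) (m : ℕ) (hm : (m : ℤ) ≠ k + 2 * j) :
    LPow Ω j α m = 0 := by
  unfold LPow
  split_ifs with hj
  · have : j = (j.toNat : ℤ) := (Int.toNat_of_nonneg hj).symm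
    rw [this] at hm
    generalize j.toNat = i at hm
    clear this hj
    induction i generalizing m with
    | zero => exact hα m (by simpa using hm)
    | succ i ih =>
      rw [Function.iterate_succ_apply', wedgeLeft]
      split_ifs with h
      · funext x
        rw [ih (m - 2) (by push_cast [Nat.cast_sub h] at hm ⊢; omega)]
        exact wedge_zero_right _ _
      · rfl
  · rfl

theorem Smooth.differentiableAt {k : ℕ} {α : Form n X k} (hα : Smooth α) (x : X) :
    DifferentiableAt ℝ (localRep α x) (extChartAt (𝓡 (2 * n)) x x) :=
  ((hα x).contDiffAt (extChartAt_target_mem_nhds x)).differentiableAt (by simp)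

variable [IsManifold (𝓡 (2 * n)) ∞ X] {C : ComplexStructure n X} {Ω : Form n X 2} {θ : Form n X 1}

/-- The derivative of the inverse chart carries the local expression of Ω to Ω, so this is the
conformal naturality with factor 1. -/
theorem localRep_neg_contractInv (hΩ : IsLCK C Ω θ) (x : X) {y : EuclideanSpace ℝ (Fin (2 * n))}
    (hy : y ∈ (extChartAt (𝓡 (2 * n)) x).target) {m : ℕ} (β : Form n X (m + 2)) :
    localRep (fun p => -contractInv (Ω p) (β p)) x y =
      -contractInv (localRep Ω x y) (localRep β x y) := by
  obtain ⟨B, hB, -⟩ := exists_symm_equiv x hy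
  have h1 := contractInv_comp (hΩ.isHermitian_chart x hy) (hΩ.isHermitian _) B 1
    (fun u v => by rw [one_mul, localRep_two_apply hB]) (β _)
  rw [one_smul, hB] at h1
  exact congrArg Neg.neg h1

theorem localRep_star_comp (hΩ : IsLCK C Ω θ) (x : X) {y : EuclideanSpace ℝ (Fin (2 * n))}
    (hy : y ∈ (extChartAt (𝓡 (2 * n)) x).target) {m q : ℕ} (h : m + q = 2 * n)
    (β : Form n X m) :
    localRep (fun p => (star h (C.J p) (Ω p) (β p)).compContinuousLinearMap (C.J p)) x y =
      (star h (chartJ C x y) (localRep Ω x y) (localRep β x y)).compContinuousLinearMap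
        (chartJ C x y) := by
  obtain ⟨B, hB, hB'⟩ := exists_symm_equiv x hy
  have hJ := chartJ_symm_equiv C x hB hB'
  have h1 := star_comp (hΩ.isHermitian_chart x hy) (hΩ.isHermitian _) finrank_model B
    (one_ne_zero) hJ (fun u v => by rw [one_pow, one_mul, localRep_two_apply hB]) h (β _)
  rw [one_pow, one_pow, one_mul, one_smul, one_smul, hB] at h1
  have h2 : localRep β x y = (β _).compContinuousLinearMap _ := rfl
  rw [h2, h1, localRep, ← hB]
  ext v
  simp only [ContinuousAlternatingMap.compContinuousLinearMap_apply]
  congr 1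
  funext i
  exact (hJ _).symm

theorem extDeriv_localRep_form (hΩ : IsLCK C Ω θ) (x : X) :
    extDeriv (localRep Ω x) (extChartAt (𝓡 (2 * n)) x x) =
      wedgeOne (oneForm (localRep θ x (extChartAt (𝓡 (2 * n)) x x)))
        (localRep Ω x (extChartAt (𝓡 (2 * n)) x x)) := by
  obtain ⟨B, hB⟩ := exists_chart_equiv (n := n) x
  have h1 := congrFun hΩ.d_form x
  have h2 : (wedge (p := 1) (q := 2) (r := 2 + 1) rfl (localRep θ x (extChartAt (𝓡 (2 * n)) x x))
      (localRep Ω x (extChartAt (𝓡 (2 * n)) x x))).compContinuousLinearMap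
      (chartDeriv x) =
      wedge (p := 1) (q := 2) (r := 2 + 1) rfl (θ x) (Ω x) := by
    rw [wedge_comp, localRep_comp_chart, localRep_comp_chart]
  rw [← h2, extD_eq, ← hB] at h1
  refine Eq.trans ?_ (wedge_eq_wedgeOne (k := 2) (localRep θ x (extChartAt (𝓡 (2 * n)) x x))
    (localRep Ω x (extChartAt (𝓡 (2 * n)) x x)) rfl)
  ext v
  have h3 := congrArg (fun T => T fun i => B.symm (v i)) h1
  simpa only [ContinuousAlternatingMap.compContinuousLinearMap_apply, Function.comp_def,
    ContinuousLinearEquiv.coe_coe, ContinuousLinearEquiv.apply_symm_apply] using h3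

end Pointwise

/-! ### Transport of the identity from the chart to the tangent space. -/

section PointwiseIdentity

theorem sub_compContinuousLinearMap {V W : Type*} [AddCommGroup V] [Module ℝ V]
    [TopologicalSpace V] [AddCommGroup W] [Module ℝ W] [TopologicalSpace W] {k : ℕ}
    (α β : W [⋀^Fin k]→L[ℝ] ℝ) (A : V →L[ℝ] W) :
    α.compContinuousLinearMap A - β.compContinuousLinearMap A =
      (α - β).compContinuousLinearMap A := rfl

theorem neg_compContinuousLinearMap {V W : Type*} [AddCommGroup V] [Module ℝ V]
    [TopologicalSpace V] [AddCommGroup W] [Module ℝ W] [TopologicalSpace W] {k : ℕ}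
    (α : W [⋀^Fin k]→L[ℝ] ℝ) (A : V →L[ℝ] W) :
    -α.compContinuousLinearMap A = (-α).compContinuousLinearMap A := rfl

open Filter Topology Set

variable {n : ℕ} {X : Type*} [TopologicalSpace X]
  [ChartedSpace (EuclideanSpace ℝ (Fin (2 * n))) X] [IsManifold (𝓡 (2 * n)) ∞ X]
  {C : ComplexStructure n X} {Ω : Form n X 2} {θ : Form n X 1}

theorem chart_two_apply (x : X)
    {B : TangentSpace (𝓡 (2 * n)) x ≃L[ℝ] EuclideanSpace ℝ (Fin (2 * n))}
    (hB : (B : _ →L[ℝ] EuclideanSpace ℝ (Fin (2 * n))) =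
      chartDeriv x)
    (Ω : Form n X 2) (u v : TangentSpace (𝓡 (2 * n)) x) :
    localRep Ω x (extChartAt (𝓡 (2 * n)) x x) ![B u, B v] = Ω x ![u, v] := by
  rw [← localRep_comp_chart Ω x, ← hB, ContinuousAlternatingMap.compContinuousLinearMap_apply]
  congr 1
  funext i
  fin_cases i <;> rfl

theorem contractInv_chart (hΩ : IsLCK C Ω θ) (x : X) {k : ℕ}
    (α : EuclideanSpace ℝ (Fin (2 * n)) [⋀^Fin (k + 2)]→L[ℝ] ℝ) :
    contractInv (Ω x) (α.compContinuousLinearMap (chartDeriv x)) =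
      (contractInv (localRep Ω x (extChartAt (𝓡 (2 * n)) x x)) α).compContinuousLinearMap
        (chartDeriv x) := by
  obtain ⟨B, hB⟩ := exists_chart_equiv (n := n) x
  have h1 := contractInv_comp (hΩ.isHermitian x)
    (hΩ.isHermitian_chart x (mem_extChartAt_target x)) B 1
    (fun u v => by rw [one_mul, chart_two_apply x hB]) α
  rw [one_smul, hB] at h1
  exact h1.symm

theorem star_chart (hΩ : IsLCK C Ω θ) (x : X) {k p : ℕ} (h : k + p = 2 * n)
    (α : EuclideanSpace ℝ (Fin (2 * n)) [⋀^Fin k]→L[ℝ] ℝ) :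
    star h (C.J x) (Ω x) (α.compContinuousLinearMap (chartDeriv x)) =
      (star h (chartJ C x (extChartAt (𝓡 (2 * n)) x x)) (localRep Ω x (extChartAt (𝓡 (2 * n)) x x))
        α).compContinuousLinearMap (chartDeriv x) := by
  obtain ⟨B, hB⟩ := exists_chart_equiv (n := n) x
  have hJ : ∀ v, B (C.J x v) = chartJ C x (extChartAt (𝓡 (2 * n)) x x) (B v) := fun v => by
    have := chartJ_chart C x v
    rw [← hB] at this
    exact this
  have h1 := star_comp (hΩ.isHermitian x) (hΩ.isHermitian_chart x (mem_extChartAt_target x))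
    (B.toLinearEquiv.finrank_eq.trans finrank_model) B one_ne_zero hJ
    (fun u v => by rw [one_pow, one_mul, chart_two_apply x hB]) h α
  rw [one_pow, one_pow, one_mul, one_smul, one_smul, hB] at h1
  exact h1

theorem chart_comp_J (C : ComplexStructure n X) (x : X) {k : ℕ}
    (α : EuclideanSpace ℝ (Fin (2 * n)) [⋀^Fin k]→L[ℝ] ℝ) :
    (α.compContinuousLinearMap (chartDeriv x)).compContinuousLinearMap
        (C.J x) =
      (α.compContinuousLinearMap (chartJ C x (extChartAt (𝓡 (2 * n)) x x))).compContinuousLinearMap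
        (chartDeriv x) := by
  ext v
  simp only [ContinuousAlternatingMap.compContinuousLinearMap_apply]
  congr 1
  funext i
  exact chartJ_chart C x (v i)

theorem chart_comp_neg_J (C : ComplexStructure n X) (x : X) {k : ℕ}
    (α : EuclideanSpace ℝ (Fin (2 * n)) [⋀^Fin k]→L[ℝ] ℝ) :
    (α.compContinuousLinearMap (chartDeriv x)).compContinuousLinearMap
        (-C.J x) =
      (α.compContinuousLinearMap (-chartJ C x (extChartAt (𝓡 (2 * n)) x x))).compContinuousLinearMap
        (chartDeriv x) := by
  ext v
  simp only [ContinuousAlternatingMap.compContinuousLinearMap_apply]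
  congr 1
  funext i
  exact (map_neg _ _).trans (congrArg Neg.neg (chartJ_chart C x (v i)))

theorem wedge_chart (θ : Form n X 1) (x : X) {k : ℕ} (h : 1 + k = k + 1) (c : ℤ)
    (α : EuclideanSpace ℝ (Fin (2 * n)) [⋀^Fin k]→L[ℝ] ℝ) :
    wedge h ((c • θ) x) (α.compContinuousLinearMap (chartDeriv x)) =
      (wedgeOne ((c : ℝ) • oneForm (localRep θ x (extChartAt (𝓡 (2 * n)) x x)))
        α).compContinuousLinearMap
        (chartDeriv x) := by
  have h1 : (c • θ) x = ((c : ℝ) • localRep θ x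
      (extChartAt (𝓡 (2 * n)) x x)).compContinuousLinearMap (chartDeriv x) := by
    change c • θ x = (c : ℝ) • (localRep θ x
      (extChartAt (𝓡 (2 * n)) x x)).compContinuousLinearMap (chartDeriv x)
    rw [localRep_comp_chart]
    exact (Int.cast_smul_eq_zsmul ℝ c (θ x)).symm
  have h2 : (c : ℝ) • oneForm (localRep θ x (extChartAt (𝓡 (2 * n)) x x)) =
      oneForm ((c : ℝ) • localRep θ x (extChartAt (𝓡 (2 * n)) x x)) := by
    ext v
    simp
  rw [h1, ← wedge_comp, wedge_eq_wedgeOne, h2]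

/-- The commutation identity at a point, for forms of degree at least two. -/
theorem pointwise_identity (hΩ : IsLCK C Ω θ) (x : X) {m q : ℕ} (h : m + 2 + q = 2 * n)
    (h' : q + 1 + (m + 1) = 2 * n) {β : Form n X (m + 2)} (hβ : Smooth β) (ℓ : ℤ)
    (h1 : 1 + (m + 2) = m + 2 + 1) (h2 : 1 + m = m + 1) (h3 : 1 + q = q + 1) :
    -contractInv (Ω x) (extD β x - wedge h1 ((ℓ • θ) x) (β x)) -
      (extD (fun p => -contractInv (Ω p) (β p)) x -
        wedge h2 (((ℓ - 1) • θ) x) (-contractInv (Ω x) (β x))) =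
      star h' (C.J x) (Ω x)
        ((extD (fun p => (star h (C.J p) (Ω p) (β p)).compContinuousLinearMap (C.J p)) x -
          wedge h3 ((((n : ℤ) + ℓ - (m + 2)) • θ) x)
            ((star h (C.J x) (Ω x) (β x)).compContinuousLinearMap (C.J x))).compContinuousLinearMap
          (-C.J x)) := by
  obtain ⟨J', hJ'⟩ := chartJ_hasFDerivAt C x
  have ev : ∀ᶠ y in 𝓝 (extChartAt (𝓡 (2 * n)) x x), y ∈ (extChartAt (𝓡 (2 * n)) x).target :=
    extChartAt_target_mem_nhds x
  have key := local_identity hJ' (hΩ.smooth_form.differentiableAt x).hasFDerivAt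
    (oneForm (localRep θ x (extChartAt (𝓡 (2 * n)) x x)))
    (ev.mono fun y hy => hΩ.isHermitian_chart x hy) (nijenhuis_chart C x hJ')
    (extDeriv_localRep_form hΩ x) finrank_model h h' (hβ.differentiableAt x) (ℓ : ℝ)
  -- The local expressions are known only on the chart target; this is a neighbourhood of the
  -- centre, which is enough for the exterior derivative there.
  have e1 : localRep (fun p => -contractInv (Ω p) (β p)) x =ᶠ[𝓝 (extChartAt (𝓡 (2 * n)) x x)]
      fun y => -contractInv (localRep Ω x y) (localRep β x y) :=
    ev.mono fun y hy => localRep_neg_contractInv hΩ x hy β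
  have e2 : localRep (fun p => (star h (C.J p) (Ω p) (β p)).compContinuousLinearMap (C.J p)) x
      =ᶠ[𝓝 (extChartAt (𝓡 (2 * n)) x x)] fun y => (star h (chartJ C x y) (localRep Ω x y)
        (localRep β x y)).compContinuousLinearMap (chartJ C x y) :=
    ev.mono fun y hy => localRep_star_comp hΩ x hy h β
  have key' := congrArg (fun T => ContinuousAlternatingMap.compContinuousLinearMap T
    (chartDeriv x)) key
  rw [extD_eq, extD_eq, extD_eq, e1.extDeriv_eq, e2.extDeriv_eq, ← localRep_comp_chart β x,
    contractInv_chart hΩ, neg_compContinuousLinearMap, wedge_chart, wedge_chart, star_chart hΩ,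
    chart_comp_J, wedge_chart, sub_compContinuousLinearMap, sub_compContinuousLinearMap,
    sub_compContinuousLinearMap, contractInv_chart hΩ, neg_compContinuousLinearMap,
    sub_compContinuousLinearMap, chart_comp_neg_J, star_chart hΩ]
  push_cast
  exact key'

/-- The commutation identity at a point, for `1`-forms. -/
theorem pointwise_identity_one (hΩ : IsLCK C Ω θ) (x : X) {q : ℕ} (h : 1 + q = 2 * n)
    (h' : q + 1 + 0 = 2 * n) {β : Form n X 1} (hβ : Smooth β) (ℓ : ℤ) (h1 : 1 + 1 = 1 + 1)
    (h3 : 1 + q = q + 1) :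
    -contractInv (Ω x) (extD β x - wedge h1 ((ℓ • θ) x) (β x)) =
      star h' (C.J x) (Ω x)
        ((extD (fun p => (star h (C.J p) (Ω p) (β p)).compContinuousLinearMap (C.J p)) x -
          wedge h3 ((((n : ℤ) + ℓ - 1) • θ) x)
            ((star h (C.J x) (Ω x) (β x)).compContinuousLinearMap (C.J x))).compContinuousLinearMap
          (-C.J x)) := by
  obtain ⟨J', hJ'⟩ := chartJ_hasFDerivAt C x
  have ev : ∀ᶠ y in 𝓝 (extChartAt (𝓡 (2 * n)) x x), y ∈ (extChartAt (𝓡 (2 * n)) x).target :=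
    extChartAt_target_mem_nhds x
  have key := local_identity_one hJ' (hΩ.smooth_form.differentiableAt x).hasFDerivAt
    (oneForm (localRep θ x (extChartAt (𝓡 (2 * n)) x x)))
    (ev.mono fun y hy => hΩ.isHermitian_chart x hy) (nijenhuis_chart C x hJ')
    (extDeriv_localRep_form hΩ x) finrank_model h h' (hβ.differentiableAt x) (ℓ : ℝ)
  have e2 : localRep (fun p => (star h (C.J p) (Ω p) (β p)).compContinuousLinearMap (C.J p)) x
      =ᶠ[𝓝 (extChartAt (𝓡 (2 * n)) x x)] fun y => (star h (chartJ C x y) (localRep Ω x y)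
        (localRep β x y)).compContinuousLinearMap (chartJ C x y) :=
    ev.mono fun y hy => localRep_star_comp hΩ x hy h β
  have key' := congrArg (fun T => ContinuousAlternatingMap.compContinuousLinearMap T
    (chartDeriv x)) key
  rw [extD_eq, extD_eq, e2.extDeriv_eq, ← localRep_comp_chart β x, wedge_chart, star_chart hΩ,
    chart_comp_J, wedge_chart, sub_compContinuousLinearMap, sub_compContinuousLinearMap,
    contractInv_chart hΩ, neg_compContinuousLinearMap, chart_comp_neg_J, star_chart hΩ]
  push_cast
  exact key'

end PointwiseIdentity

/-! ### Components of forms of mixed degree -/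

section Components

variable {n : ℕ} {X : Type*} [TopologicalSpace X]
  [ChartedSpace (EuclideanSpace ℝ (Fin (2 * n))) X]

theorem extD_zero {k : ℕ} (x : X) : extD (0 : Form n X k) x = 0 := by
  have h1 : localRep (0 : Form n X k) x = fun _ => 0 := rfl
  rw [extD_eq, h1, extDeriv, fderiv_const_apply]
  ext v
  simp [ContinuousAlternatingMap.alternatizeUncurryFin_apply]

theorem wedgeLeft_one_succ (η : Form n X 1) (β : MixedForm n X) (q : ℕ) (h : 1 + q = q + 1)
    (x : X) :
    wedgeLeft η β (q + 1) x = wedge h (η x) (β q x) := by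
  have h1 : 1 ≤ q + 1 := Nat.le_add_left 1 q
  unfold wedgeLeft
  rw [dif_pos h1]
  rfl

theorem dTwisted_zero (η : Form n X 1) (β : MixedForm n X) : dTwisted η β 0 = 0 := by
  change d β 0 - wedgeLeft η β 0 = 0
  unfold wedgeLeft
  rw [dif_neg (by omega)]
  exact sub_zero _

theorem dTwisted_succ (η : Form n X 1) (β : MixedForm n X) (q : ℕ) (h : 1 + q = q + 1) (x : X) :
    dTwisted η β (q + 1) x = extD (β q) x - wedge h (η x) (β q x) := by
  change d β (q + 1) x - wedgeLeft η β (q + 1) x = _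
  rw [wedgeLeft_one_succ η β q h]
  rfl

theorem dTwisted_succ_of_eq_zero (η : Form n X 1) {β : MixedForm n X} {q : ℕ} (hβ : β q = 0)
    (x : X) : dTwisted η β (q + 1) x = 0 := by
  rw [dTwisted_succ η β q (Nat.add_comm 1 q), hβ, extD_zero]
  exact sub_eq_zero.2 (wedge_zero_right _ _).symm

theorem contractInv_zero {V : Type*} [AddCommGroup V] [Module ℝ V] [TopologicalSpace V]
    [IsTopologicalAddGroup V] [ContinuousSMul ℝ V] [FiniteDimensional ℝ V]
    (Ω : V [⋀^Fin 2]→L[ℝ] ℝ) (k : ℕ) : contractInv Ω (0 : V [⋀^Fin (k + 2)]→L[ℝ] ℝ) = 0 :=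
  map_zero (contractInvₗ Ω k)

theorem star_zero {V : Type*} [AddCommGroup V] [Module ℝ V] [TopologicalSpace V]
    [IsTopologicalAddGroup V] [ContinuousSMul ℝ V] [T2Space V] [FiniteDimensional ℝ V]
    {n k p : ℕ} (h : k + p = 2 * n) (J : V →L[ℝ] V) (Ω : V [⋀^Fin 2]→L[ℝ] ℝ) :
    star h J Ω 0 = 0 := by
  unfold star
  split_ifs
  · simp [starFrame]
  · rfl

theorem Lam_apply_of_eq_zero (Ω : Form n X 2) {β : MixedForm n X} {m : ℕ} (hβ : β (m + 2) = 0) :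
    Lam Ω β m = 0 := by
  funext x
  change -contractInv (Ω x) (β (m + 2) x) = 0
  rw [hβ]
  exact neg_eq_zero.2 (contractInv_zero _ _)

variable [IsManifold (𝓡 (2 * n)) ∞ X]

theorem form_eq_zero_of_lt {k : ℕ} (hk : 2 * n < k) (α : Form n X k) : α = 0 := by
  funext x
  rw [← localRep_comp_chart α x, form_eq_zero_of_finrank_lt (by rwa [finrank_model])
    (localRep α x (extChartAt (𝓡 (2 * n)) x x))]
  rfl

theorem hodge_apply (C : ComplexStructure n X) (Ω : Form n X 2) (β : MixedForm n X) {k p : ℕ}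
    (h : k + p = 2 * n) (x : X) : hodge C Ω β p x = star h (C.J x) (Ω x) (β k x) := by
  obtain rfl : k = 2 * n - p := by omega
  unfold hodge
  rw [dif_pos (by omega : p ≤ 2 * n)]

/-- The degrees run m, q = 2n - m, q + 1, p = m - 1. -/
theorem hodge_dcTwisted_apply (C : ComplexStructure n X) (Ω : Form n X 2) (η : Form n X 1)
    (β : MixedForm n X) {m p q : ℕ} (h : m + q = 2 * n) (h' : q + 1 + p = 2 * n)
    (h3 : 1 + q = q + 1) (x : X) :
    hodge C Ω (dcTwisted C η (hodge C Ω β)) p x = star h' (C.J x) (Ω x)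
      ((extD (fun y => (star h (C.J y) (Ω y) (β m y)).compContinuousLinearMap (C.J y)) x -
        wedge h3 (η x) ((star h (C.J x) (Ω x) (β m x)).compContinuousLinearMap
          (C.J x))).compContinuousLinearMap (-C.J x)) := by
  have h1 : actJ C (hodge C Ω β) q = fun y =>
      (star h (C.J y) (Ω y) (β m y)).compContinuousLinearMap (C.J y) := by
    funext y
    exact congrArg (fun T => ContinuousAlternatingMap.compContinuousLinearMap T (C.J y))
      (hodge_apply C Ω β h y)
  rw [hodge_apply C Ω _ h']
  change star h' (C.J x) (Ω x) ((dTwisted η (actJ C (hodge C Ω β)) (q + 1)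
    x).compContinuousLinearMap (-C.J x)) = _
  rw [dTwisted_succ η _ q h3, h1]

theorem hodge_dcTwisted_of_eq_zero (C : ComplexStructure n X) (Ω : Form n X 2) (η : Form n X 1)
    {β : MixedForm n X} {p : ℕ} (hβ : β (p + 1) = 0) (x : X) :
    hodge C Ω (dcTwisted C η (hodge C Ω β)) p x = 0 := by
  rcases lt_trichotomy p (2 * n) with hp | hp | hp
  · obtain ⟨q, hq⟩ : ∃ q, q + 1 + p = 2 * n := ⟨2 * n - p - 1, by omega⟩
    have h1 : actJ C (hodge C Ω β) q = 0 := by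
      funext y
      change (hodge C Ω β q y).compContinuousLinearMap (C.J y) = 0
      rw [hodge_apply C Ω β (by omega : p + 1 + q = 2 * n), hβ]
      exact congrArg (fun T => ContinuousAlternatingMap.compContinuousLinearMap T (C.J y))
        (star_zero _ _ _)
    rw [hodge_apply C Ω _ hq]
    change star hq (C.J x) (Ω x) ((dTwisted η (actJ C (hodge C Ω β)) (q + 1)
      x).compContinuousLinearMap (-C.J x)) = 0
    rw [dTwisted_succ_of_eq_zero η h1]
    exact star_zero _ _ _
  -- In degree p = 2n the outer star reads the component of degree 0 of a twisted differential,
  -- which is 0; above 2n the star is 0 by convention.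
  · rw [hodge_apply C Ω _ (by omega : 0 + p = 2 * n)]
    change star _ (C.J x) (Ω x) ((dTwisted η (actJ C (hodge C Ω β)) 0
      x).compContinuousLinearMap (-C.J x)) = 0
    rw [dTwisted_zero]
    exact star_zero _ _ _
  · unfold hodge
    rw [dif_neg (by omega)]
    rfl

/-- The commutation identity for smooth forms of pure degree. -/
theorem commutation_of_pure {C : ComplexStructure n X} {Ω : Form n X 2} {θ : Form n X 1}
    (hΩ : IsLCK C Ω θ) {β : MixedForm n X} (hs : ∀ m, Smooth (β m)) {K : ℤ}
    (hK : ∀ m : ℕ, (m : ℤ) ≠ K → β m = 0) (ℓ : ℤ) :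
    Lam Ω (dTwisted (ℓ • θ) β) - dTwisted ((ℓ - 1) • θ) (Lam Ω β) =
      -dcStar C Ω (((n : ℤ) + ℓ - K) • θ) β := by
  funext p x
  have hR : (-dcStar C Ω (((n : ℤ) + ℓ - K) • θ) β) p x =
      hodge C Ω (dcTwisted C (((n : ℤ) + ℓ - K) • θ) (hodge C Ω β)) p x := by
    rw [dcStar, neg_neg]
  rw [hR]
  change -contractInv (Ω x) (dTwisted (ℓ • θ) β (p + 1 + 1) x) -
    dTwisted ((ℓ - 1) • θ) (Lam Ω β) p x = _
  -- Both sides lower the degree by one, so their component p depends only on the component p + 1 of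
  -- β. If that is nonzero, then K = p + 1 ≤ 2n.
  by_cases hp : β (p + 1) = 0
  · rw [hodge_dcTwisted_of_eq_zero C Ω _ hp, dTwisted_succ_of_eq_zero _ hp, contractInv_zero,
      neg_zero, zero_sub, neg_eq_zero]
    cases p with
    | zero => rw [dTwisted_zero]; rfl
    | succ m => exact dTwisted_succ_of_eq_zero _ (Lam_apply_of_eq_zero Ω hp) x
  · have hKp : K = ((p + 1 : ℕ) : ℤ) := by
      by_contra hne
      exact hp (hK _ (Ne.symm hne))
    have hle : p + 1 ≤ 2 * n := by
      by_contra hlt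
      exact hp (form_eq_zero_of_lt (not_le.1 hlt) _)
    obtain ⟨q, hq⟩ : ∃ q, p + 1 + q = 2 * n := ⟨2 * n - (p + 1), by omega⟩
    rw [hodge_dcTwisted_apply C Ω _ β hq (by omega) (Nat.add_comm 1 q),
      dTwisted_succ _ β (p + 1) (Nat.add_comm 1 (p + 1)), hKp]
    cases p with
    | zero =>
      rw [dTwisted_zero]
      exact (sub_zero _).trans (pointwise_identity_one hΩ x hq (by omega) (hs _) ℓ _ _)
    | succ m =>
      rw [dTwisted_succ _ _ m (Nat.add_comm 1 m)]
      exact pointwise_identity hΩ x hq (by omega) (hs _) ℓ _ _ _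

end Components

end LCK

end

theorem mainTheorem7 (n : ℕ) {X : Type*} [TopologicalSpace X]
    [ChartedSpace (EuclideanSpace ℝ (Fin (2 * n))) X] [IsManifold (𝓡 (2 * n)) ∞ X]
    (C : LCK.ComplexStructure n X) (Ω : LCK.Form n X 2) (θ : LCK.Form n X 1)
    (hΩ : LCK.IsLCK C Ω θ) (j k ℓ : ℤ)
    (β : LCK.MixedForm n X) (hβ : β ∈ LCK.LPow Ω j '' LCK.Primitive Ω k) :
    LCK.Lam Ω (LCK.dTwisted (ℓ • θ) β) - LCK.dTwisted ((ℓ - 1) • θ) (LCK.Lam Ω β) =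
      -LCK.dcStar C Ω (((n : ℤ) + ℓ - k - 2 * j) • θ) β := by
  obtain ⟨α, ⟨hs, hdeg, -⟩, rfl⟩ := hβ
  -- Applying L^j to α gives a smooth form of pure degree K = k + 2j.
  have h := LCK.commutation_of_pure hΩ (β := LCK.LPow Ω j α)
    (fun m => hΩ.smooth_form.LPow j hs m) (LCK.LPow_apply_eq_zero Ω j hdeg) ℓ
  rwa [← sub_sub] at h
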